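/- \textbf{Setting.} Concept, role and individual names are given. Basic roles are $Q::=P\mid P^-$ and basic concepts are $B::=A\mid\exists Q$. A G-DL-Lite$_R$ ontology $\mathcal O=(\mathcal T,\mathcal A)$ consists of a finite TBox $\mathcal T$ of graded inclusions $\langle B\sqsubseteq C,d\rangle$, $\langle Q\sqsubseteq R,d\rangle$ (where $C$ is $B'$ or $\neg B'$, and $R$ is $Q'$ or $\neg Q'$) and a finite ABox $\mathcal A$ of graded assertions $\langle B(a),d\rangle$, $\langle P(a,b),d\rangle$, with $d\in[0,1]$. A fuzzy interpretation $\mathcal I$ has a non-empty domain, maps individual names to elements, and maps concept and role names to $[0,1]$-valued unary and binary relations; $(P^-)^{\mathcal I}(\delta,\eta)=P^{\mathcal I}(\eta,\delta)$, $(\exists Q)^{\mathcal I}(\delta)=\sup_{\eta}Q^{\mathcal I}(\delta,\eta)$, and $\neg$ is interpreted by the G\"odel negation $\ominus d=(d\Rightarrow 0)$, where $d\Rightarrow e$ is $1$ if $d\le e$ and $e$ otherwise. An inclusion $\langle X\sqsubseteq Y,d\rangle$ holds in $\mathcal I$ if $X^{\mathcal I}\Rightarrow Y^{\mathcal I}\ge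 d$ everywhere, and an assertion $\langle\alpha,d\rangle$ if $\alpha^{\mathcal I}\ge d$. An interpretation is \emph{witnessed} if all suprema interpreting $\exists Q$ are attained. An ontology is consistent if it has a model. A conjunctive query (CQ) $q(\mathbf x)=\exists\mathbf y.\varphi(\mathbf x,\mathbf y)$ is a conjunction of atoms $B(t)$, $P(t_1,t_2)$ over variables and individual names; $q^{\mathcal I}(\mathbf a)$ is the supremum, over all assignments of $\mathbf y$, of the minimum of the degrees of the atoms ($1$ if there are none). A threshold query attaches a bound to each atom, and $\mathcal I$ satisfies it at $\mathbf a$ if some single assignment of $\mathbf y$ meets all bounds; $TQ(q,d)$ attaches $d$ to every atom of $q$. $\mathcal O\models q(\mathbf a)\ge d$ means that $q^{\mathcal I}(\mathbf a)\ge d$ for all models $\mathcal I$ of $\mathcal O$, and $\mathcal O\models t(\mathbf a)$ means that all models satisfy the threshold query $t$ at $\mathbf a$; $\models_w$ is the same with witnessed models only. $\mathsf{ans}(q,\mathcal O)$ is the set of pairs $(\mathbf a,d)$ with $\mathcal O\models q(\mathbf a)\ge d$ and $\mathcal O\not\models q(\mathbf a)\ge d'$ for all $d'>d$. \textbf{Statement.}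 (1) For every consistent G-DL-Lite$_R$ ontology $\mathcal O$, CQ $q$, tuple $\mathbf a$ and $d\in[0,1]$: \[\mathcal O\models q(\mathbf a)\ge d\iff\mathcal O\models_w q(\mathbf a)\ge d\iff\mathcal O\models_w TQ(q,d)(\mathbf a),\] and $\mathcal O\models q(\mathbf a)\ge d$ iff $\mathcal O\models TQ(q,d')(\mathbf a)$ for all $d'<d$. (2) Answering CQs with respect to consistent G-DL-Lite$_R$ ontologies is in uniform AC$^0$ in data complexity. That is, let $b\ge2$, let names be written as distinct binary words and degrees as finite base-$b$ expansions, and fix a finite TBox $\mathcal T$ with such degrees and a CQ $q$. There are first-order uniform families of circuits (AND and OR gates of unbounded fan-in over literals) of constant depth and polynomial size which, for every ABox $\mathcal A$ such that $\mathcal O=(\mathcal T,\mathcal A)$ is consistent and every tuple $\mathbf a$ (and degree $d$), given as a word listing the assertions of $\mathcal A$ followed by $\mathbf a$ (and $d$), (i) decide whether $\mathcal O\models q(\mathbf a)\ge d$; (ii) decide whether $(\mathbf a,d)\in\mathsf{ans}(q,\mathcal O)$; (iii) on input $\mathcal A,\mathbf a$ output an expansion of the degree $d$ with $(\mathbf a,d)\in\mathsf{ans}(q,\mathcal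 O)$. Each of these families is correct both when all models and when only witnessed models are considered. -/

import Mathlib

namespace FuzzyDL

/-! ## Fuzzy DL-Lite_R: syntax -/

/-- Truth degrees: the real interval `[0,1]`. -/
abbrev Degree : Type := unitInterval

/-- Basic roles `Q ::= P | P⁻`. -/
inductive Role (NR : Type) where
  | name (P : NR)
  | inv (P : NR)

/-- Basic concepts `B ::= A | ∃Q`. -/
inductive Basic (NC NR : Type) where
  | name (A : NC)
  | ex (Q : Role NR)

/-- General concepts `C ::= B | ¬B`. -/
inductive Concept (NC NR : Type) where
  | pos (B : Basic NC NR)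
  | neg (B : Basic NC NR)

/-- General roles `R ::= Q | ¬Q`. -/
inductive GRole (NR : Type) where
  | pos (Q : Role NR)
  | neg (Q : Role NR)

/-- Graded inclusions `⟨B ⊑ C, d⟩` and `⟨Q ⊑ R, d⟩`, the elements of a TBox. -/
inductive Inclusion (NC NR : Type) where
  | concept (B : Basic NC NR) (C : Concept NC NR) (d : Degree)
  | role (Q : Role NR) (R : GRole NR) (d : Degree)

/-- The degree annotating an inclusion. -/
def Inclusion.degree {NC NR : Type} : Inclusion NC NR → Degree
  | .concept _ _ d => d
  | .role _ _ d => d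

/-- Graded assertions `⟨B(a), d⟩` and `⟨P(a,b), d⟩`, with the degrees taken from `D`
(`D = Degree` for the elements of an ABox, a type of numerals for ABoxes given as input). -/
inductive Assertion (NC NR NI D : Type) where
  | concept (B : Basic NC NR) (a : NI) (d : D)
  | role (P : NR) (a b : NI) (d : D)

/-- Change of the degree of an assertion along a map. -/
def Assertion.map {NC NR NI D E : Type} (f : D → E) :
    Assertion NC NR NI D → Assertion NC NR NI E
  | .concept B a d => .concept B a (f d)
  | .role P a b d => .role P a b (f d)

/-- An ontology: a finite TBox and a finite ABox. -/
structure Ontology (NC NR NI : Type) where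
  tbox : Set (Inclusion NC NR)
  tbox_finite : tbox.Finite
  abox : Set (Assertion NC NR NI Degree)
  abox_finite : abox.Finite

/-! ## Gödel semantics -/

/-- The Gödel t-norm. -/
noncomputable def gTnorm (d e : Degree) : Degree := min d e

/-- The residuum of the Gödel t-norm. -/
noncomputable def gImp (d e : Degree) : Degree := if d ≤ e then 1 else e

/-- The Gödel negation. -/
noncomputable def gNeg (d : Degree) : Degree := gImp d 0

/-- Fuzzy interpretations. -/
structure Interp (NC NR NI : Type) where
  Dom : Type
  nonempty : Nonempty Dom
  ind : NI → Dom
  conc : NC → Dom → Degree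
  role : NR → Dom → Dom → Degree

namespace Interp

variable {NC NR NI : Type} (I : Interp NC NR NI)

def evalRole : Role NR → I.Dom → I.Dom → Degree
  | .name P, x, y => I.role P x y
  | .inv P, x, y => I.role P y x

noncomputable def evalBasic : Basic NC NR → I.Dom → Degree
  | .name A, x => I.conc A x
  | .ex Q, x => ⨆ y, I.evalRole Q x y

noncomputable def evalConcept : Concept NC NR → I.Dom → Degree
  | .pos B, x => I.evalBasic B x
  | .neg B, x => gNeg (I.evalBasic B x)

noncomputable def evalGRole : GRole NR → I.Dom → I.Dom → Degree
  | .pos Q, x, y => I.evalRole Q x y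
  | .neg Q, x, y => gNeg (I.evalRole Q x y)

def SatInclusion : Inclusion NC NR → Prop
  | .concept B C d => ∀ x, d ≤ gImp (I.evalBasic B x) (I.evalConcept C x)
  | .role Q R d => ∀ x y, d ≤ gImp (I.evalRole Q x y) (I.evalGRole R x y)

def SatAssertion : Assertion NC NR NI Degree → Prop
  | .concept B a d => d ≤ I.evalBasic B (I.ind a)
  | .role P a b d => d ≤ I.role P (I.ind a) (I.ind b)

/-- `I` is a model of the ontology `O`. -/
def IsModel (O : Ontology NC NR NI) : Prop :=
  (∀ α ∈ O.tbox, I.SatInclusion α) ∧ (∀ β ∈ O.abox, I.SatAssertion β)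

/-- `I` is witnessed: every supremum that interprets an existential restriction is attained. -/
def Witnessed : Prop :=
  ∀ (Q : Role NR) (x : I.Dom), ∃ y, I.evalRole Q x y = ⨆ z, I.evalRole Q x z

end Interp

/-- The two usual readings of "every model": all models, or all witnessed models. -/
inductive Sem where
  | all
  | witnessed

def Interp.Admissible {NC NR NI : Type} (I : Interp NC NR NI) : Sem → Prop
  | .all => True
  | .witnessed => I.Witnessed

/-- `O` has a model. -/
def Ontology.Consistent {NC NR NI : Type} (s : Sem) (O : Ontology NC NR NI) : Prop :=
  ∃ I : Interp NC NR NI, I.Admissible s ∧ I.IsModel O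

/-! ## Queries -/

/-- Terms over `k` answer variables, `m` existential variables and the individual names. -/
inductive Tm (NI : Type) (k m : ℕ) where
  | ans (i : Fin k)
  | exi (j : Fin m)
  | ind (a : NI)

/-- Query atoms `B(t)` and `P(t₁,t₂)`. -/
inductive Atom (NC NR NI : Type) (k m : ℕ) where
  | concept (B : Basic NC NR) (t : Tm NI k m)
  | role (P : NR) (t₁ t₂ : Tm NI k m)

/-- Conjunctive queries `∃ y. φ(x, y)` with `|x| = k`; `φ` is the conjunction of `atoms`. -/
structure CQ (NC NR NI : Type) (k : ℕ) where
  numEx : ℕ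
  atoms : List (Atom NC NR NI k numEx)

/-- Threshold queries: each atom `α` carries its own bound, `α ≥ d`. -/
structure TQ (NC NR NI : Type) (k : ℕ) where
  numEx : ℕ
  atoms : List (Atom NC NR NI k numEx × Degree)

/-- `TQ(q, d)`: the threshold query that puts the bound `d` on every atom of `q`. -/
def CQ.toTQ {NC NR NI : Type} {k : ℕ} (q : CQ NC NR NI k) (d : Degree) : TQ NC NR NI k where
  numEx := q.numEx
  atoms := q.atoms.map fun α => (α, d)

namespace Interp

variable {NC NR NI : Type} (I : Interp NC NR NI) {k m : ℕ}

/-- The match that sends the answer variables to the interpretations of the individuals `a`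
and the existential variables to the elements `e`. -/
def evalTm (a : Fin k → NI) (e : Fin m → I.Dom) : Tm NI k m → I.Dom
  | .ans i => I.ind (a i)
  | .exi j => e j
  | .ind c => I.ind c

noncomputable def evalAtom (a : Fin k → NI) (e : Fin m → I.Dom) : Atom NC NR NI k m → Degree
  | .concept B t => I.evalBasic B (I.evalTm a e t)
  | .role P t₁ t₂ => I.role P (I.evalTm a e t₁) (I.evalTm a e t₂)

/-- The degree of a CQ with respect to a match: the t-norm of the degrees of its atoms. -/
noncomputable def matchDegree (q : CQ NC NR NI k) (a : Fin k → NI) (e : Fin q.numEx → I.Dom) :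
    Degree :=
  (q.atoms.map (I.evalAtom a e)).foldr gTnorm 1

/-- `q^I(a^I)`, the supremum over all matches. -/
noncomputable def queryDegree (q : CQ NC NR NI k) (a : Fin k → NI) : Degree :=
  ⨆ e : Fin q.numEx → I.Dom, I.matchDegree q a e

/-- `I ⊨ t(a)` for a threshold query `t`: some match satisfies every threshold atom. -/
def SatTQ (t : TQ NC NR NI k) (a : Fin k → NI) : Prop :=
  ∃ e : Fin t.numEx → I.Dom, ∀ p ∈ t.atoms, p.2 ≤ I.evalAtom a e p.1

end Interp

namespace Ontology

variable {NC NR NI : Type} {k : ℕ}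

/-- `O ⊨ q(a) ≥ d`. -/
def EntailsDeg (s : Sem) (O : Ontology NC NR NI) (q : CQ NC NR NI k) (a : Fin k → NI)
    (d : Degree) : Prop :=
  ∀ I : Interp NC NR NI, I.Admissible s → I.IsModel O → d ≤ I.queryDegree q a

/-- `O ⊨ t(a)` for a threshold query `t`. -/
def EntailsTQ (s : Sem) (O : Ontology NC NR NI) (t : TQ NC NR NI k) (a : Fin k → NI) : Prop :=
  ∀ I : Interp NC NR NI, I.Admissible s → I.IsModel O → I.SatTQ t a

/-- `(a, d) ∈ ans(q(x), O)`: `d` is the (greatest) degree of the answer `a`. -/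
def IsAnsDegree (s : Sem) (O : Ontology NC NR NI) (q : CQ NC NR NI k) (a : Fin k → NI)
    (d : Degree) : Prop :=
  O.EntailsDeg s q a d ∧ ∀ d' : Degree, d < d' → ¬ O.EntailsDeg s q a d'

end Ontology

/-! ## Uniform AC⁰

Circuits of constant depth and polynomial size with AND and OR gates of unbounded fan-in, whose
inputs are literals. The families are first-order uniform: the gates of the `n`-th circuit are
numbers below a polynomial in `n`, and the description of the circuit is given by first-order
formulas with addition and multiplication whose quantifiers range over numbers polynomially bounded
in the arguments. This is equivalent to uniformity in deterministic logarithmic time and at least as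
strict as uniformity in logarithmic space. -/

/-- Relations on the natural numbers that are definable by a bounded first-order formula over
`0, 1, +, ×` (the Δ₀ relations). -/
inductive Delta0 : {k : ℕ} → ((Fin k → ℕ) → Prop) → Prop
  | eq {k : ℕ} (p q : MvPolynomial (Fin k) ℕ) :
      Delta0 (fun v => MvPolynomial.eval v p = MvPolynomial.eval v q)
  | not {k : ℕ} {R : (Fin k → ℕ) → Prop} : Delta0 R → Delta0 (fun v => ¬ R v)
  | and {k : ℕ} {R S : (Fin k → ℕ) → Prop} : Delta0 R → Delta0 S →
      Delta0 (fun v => R v ∧ S v)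
  | exLt {k : ℕ} (p : MvPolynomial (Fin k) ℕ) {R : (Fin (k + 1) → ℕ) → Prop} : Delta0 R →
      Delta0 (fun v => ∃ y, y < MvPolynomial.eval v p ∧ R (Fin.cons y v))

/-- Gates of a circuit reading words of length `n` over the alphabet `S`: a literal
"the `i`-th letter is `c`" (for `S = Bool`: a variable or its negation), AND, or OR. -/
inductive Gate (S : Type) (n : ℕ) where
  | literal (i : Fin n) (c : S)
  | and
  | or

/-- A circuit that reads a word of length `n` over `S` and writes a word of length at most `outLen`
over `G`; `wire g h` says that gate `h` feeds gate `g`; gate `out i c` says that the `i`-th output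
letter is `c`. A path into the gate `g` has at most `level g` wires; in particular there are no
cycles. -/
structure Circuit (S G : Type) (n : ℕ) where
  size : ℕ
  gate : Fin size → Gate S n
  wire : Fin size → Fin size → Prop
  level : Fin size → ℕ
  level_lt : ∀ g h, wire g h → level h < level g
  outLen : ℕ
  out : Fin outLen → G → Fin size

namespace Circuit

variable {S G : Type} {n : ℕ}

/-- The truth value computed by a gate on the input word `x`. -/
def eval (C : Circuit S G n) (x : Fin n → S) (g : Fin C.size) : Prop :=
  match C.gate g with
  | .literal i c => x i = c
  | .and => ∀ h, (hw : C.wire g h) → C.eval x h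
  | .or => ∃ h, ∃ _ : C.wire g h, C.eval x h
termination_by C.level g
decreasing_by
  · exact C.level_lt _ _ hw
  · rename_i hw; exact C.level_lt _ _ hw

/-- On the input `x` the circuit writes the word `y` (the unused output positions stay blank). -/
def Outputs (C : Circuit S G n) (x : Fin n → S) (y : List G) : Prop :=
  y.length ≤ C.outLen ∧ ∀ (i : Fin C.outLen) (c : G), C.eval x (C.out i c) ↔ y[i.val]? = some c

end Circuit

/-- One circuit for each input length. -/
abbrev CircuitFamily (S G : Type) : Type := (n : ℕ) → Circuit S G n

namespace CircuitFamily

variable {S G : Type}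

def ConstantDepth (C : CircuitFamily S G) : Prop :=
  ∃ d : ℕ, ∀ n g, (C n).level g ≤ d

def PolySize (C : CircuitFamily S G) : Prop :=
  ∃ p : Polynomial ℕ, ∀ n, (C n).size ≤ p.eval n ∧ (C n).outLen ≤ p.eval n

/-- The relations that describe the circuits are first-order definable, uniformly in `n`. -/
structure Uniform (C : CircuitFamily S G) : Prop where
  size : Delta0 (fun v : Fin 2 → ℕ => v 1 < (C (v 0)).size)
  literal : ∀ c : S, Delta0 (fun v : Fin 3 → ℕ =>
    ∃ (hg : v 1 < (C (v 0)).size) (hi : v 2 < v 0),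
      (C (v 0)).gate ⟨v 1, hg⟩ = Gate.literal ⟨v 2, hi⟩ c)
  and : Delta0 (fun v : Fin 2 → ℕ =>
    ∃ hg : v 1 < (C (v 0)).size, (C (v 0)).gate ⟨v 1, hg⟩ = Gate.and)
  or : Delta0 (fun v : Fin 2 → ℕ =>
    ∃ hg : v 1 < (C (v 0)).size, (C (v 0)).gate ⟨v 1, hg⟩ = Gate.or)
  wire : Delta0 (fun v : Fin 3 → ℕ =>
    ∃ (hg : v 1 < (C (v 0)).size) (hh : v 2 < (C (v 0)).size),
      (C (v 0)).wire ⟨v 1, hg⟩ ⟨v 2, hh⟩)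
  outLen : Delta0 (fun v : Fin 2 → ℕ => v 1 < (C (v 0)).outLen)
  out : ∀ c : G, Delta0 (fun v : Fin 3 → ℕ =>
    ∃ hi : v 1 < (C (v 0)).outLen, ((C (v 0)).out ⟨v 1, hi⟩ c : ℕ) = v 2)

/-- `C` is a uniform AC⁰ family. -/
structure IsAC0 (C : CircuitFamily S G) : Prop where
  constantDepth : C.ConstantDepth
  polySize : C.PolySize
  uniform : C.Uniform

/-- On the input word `w` the family writes the word `y`. -/
def Outputs (C : CircuitFamily S G) (w : List S) (y : List G) : Prop :=
  (C w.length).Outputs w.get y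

/-- On the input word `w` the family answers whether `p` holds. -/
def Answers (C : CircuitFamily S Bool) (w : List S) (p : Prop) : Prop :=
  (p → C.Outputs w [true]) ∧ (¬ p → C.Outputs w [false])

end CircuitFamily

/-! ## Input words -/

/-- The value `Σ cᵢ b⁻ⁱ` of the base-`b` expansion `0.c₁c₂…cₘ`. -/
noncomputable def fracVal {b : ℕ} : List (Fin b) → ℝ
  | [] => 0
  | c :: cs => ((c : ℕ) + fracVal cs) / b

theorem fracVal_mem {b : ℕ} (cs : List (Fin b)) : fracVal cs ∈ Set.Icc (0 : ℝ) 1 := by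
  induction cs with
  | nil => simp [fracVal]
  | cons c cs ih =>
    obtain ⟨h0, h1⟩ := ih
    have hb : (0 : ℝ) < b := by exact_mod_cast c.pos
    have hc : ((c : ℕ) : ℝ) + 1 ≤ b := by exact_mod_cast c.isLt
    refine ⟨?_, ?_⟩
    · simp only [fracVal]; positivity
    · simp only [fracVal]
      rw [div_le_one hb]
      linarith

/-- Base-`b` numerals for degrees: `1`, or a finite expansion `0.c₁c₂…cₘ`. -/
inductive Numeral (b : ℕ) where
  | one
  | frac (cs : List (Fin b))

noncomputable def Numeral.val {b : ℕ} : Numeral b → Degree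
  | .one => 1
  | .frac cs => ⟨fracVal cs, fracVal_mem cs⟩

/-- The ontology with TBox `T` and with the ABox that lists the assertions `A`. -/
def Ontology.ofData {NC NR NI : Type} {b : ℕ} (T : Set (Inclusion NC NR)) (hT : T.Finite)
    (A : List (Assertion NC NR NI (Numeral b))) : Ontology NC NR NI where
  tbox := T
  tbox_finite := hT
  abox := {β | ∃ α ∈ A, α.map Numeral.val = β}
  abox_finite := (List.finite_toSet A).image (Assertion.map Numeral.val)

/-- Names are written as distinct binary words. -/
structure Naming (NC NR NI : Type) where
  conc : NC → List Bool
  role : NR → List Bool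
  ind : NI → List Bool
  conc_injective : Function.Injective conc
  role_injective : Function.Injective role
  ind_injective : Function.Injective ind

/-- The letters of the input words. -/
inductive Letter (b : ℕ) where
  | bit (v : Bool)
  | sep
  | digit (c : Fin b)
  | one
  | halt
  | nameTag
  | exTag
  | exInvTag
  | roleTag
  | ansTag
  | degTag

section Encoding

variable {NC NR NI : Type} {b : ℕ}

def encWord (w : List Bool) : List (Letter b) := w.map Letter.bit ++ [Letter.sep]

def encNumeral : Numeral b → List (Letter b)
  | .one => [Letter.one, Letter.halt]
  | .frac cs => cs.map Letter.digit ++ [Letter.halt]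

def encBasic (N : Naming NC NR NI) : Basic NC NR → List (Letter b)
  | .name A => Letter.nameTag :: encWord (N.conc A)
  | .ex (.name P) => Letter.exTag :: encWord (N.role P)
  | .ex (.inv P) => Letter.exInvTag :: encWord (N.role P)

def encAssertion (N : Naming NC NR NI) : Assertion NC NR NI (Numeral b) → List (Letter b)
  | .concept B a d => encBasic N B ++ encWord (N.ind a) ++ encNumeral d
  | .role P a c d =>
      Letter.roleTag :: encWord (N.role P) ++ encWord (N.ind a) ++ encWord (N.ind c) ++
        encNumeral d

/-- The input word for an ABox and a candidate tuple. -/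
def encInput (N : Naming NC NR NI) {k : ℕ} (A : List (Assertion NC NR NI (Numeral b)))
    (a : Fin k → NI) : List (Letter b) :=
  A.flatMap (encAssertion N) ++
    (List.ofFn a).flatMap fun c => Letter.ansTag :: encWord (N.ind c)

/-- The input word for an ABox, a candidate tuple and a degree. -/
def encInputDeg (N : Naming NC NR NI) {k : ℕ} (A : List (Assertion NC NR NI (Numeral b)))
    (a : Fin k → NI) (d : Numeral b) : List (Letter b) :=
  encInput N A a ++ Letter.degTag :: encNumeral d

end Encoding

end FuzzyDL

open FuzzyDL

/-!
The proof rests on one reduction. For a degree `d > 0`, consider the *cut* of an ontology at `d`: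
its inclusions and assertions of degree at least `d`, with the degrees forgotten. The query has
degree at least `d` in all models exactly if the crisp *chase* of the cut satisfies the query
(`entailsDeg_iff`). In one direction the chase maps homomorphically into the `d`-cut of every
witnessed model, and into the strict `d'`-cut of every model for `d' < d` (`Interp.exists_hom`),
because a supremum above `d'` has a witness above `d'`. In the other direction, finitely many
degrees leave a gap below `d`, and for a degree `e` in the gap the following three-valued
interpretation is a witnessed model: the facts in the chase of the cut have degree `1`, the other
facts in the chase of all axioms of positive degree have degree `e`, and all remaining facts have
degree `0` (`chaseInterp_isModel`). Negative inclusions hold in it since Gödel negation only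
distinguishes `0` from the positive degrees, and since the chase of the positive axioms maps into
the positive part of some model. Hence all models and witnessed models give the same answers.

For the data complexity no rewriting of the query is computed. All rules of the chase have a single
premise, so every fact stems from a single assertion, and the query is entailed if and only if it is
entailed by a choice of one assertion for each query atom (`chaseEntails_iff_exists`). Whether such
a choice entails the query depends only on a finite *pattern*: on the predicates of the chosen
assertions, of which only finitely many matter, and on the equalities among their individuals, the
answer tuple and the individuals of the query (`ChaseEntails.of_pattern`). So entailment at `d` is
expressed by a first-order formula over the input word: some assertions with degree at least `d`
have one of finitely many good patterns. Only finitely many cuts of the fixed TBox occur, and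
numerals are compared digit by digit. The degree of an answer is `0`, `1` or a degree of the
ontology, so maximality needs to be checked against these degrees only, and a formula can select the
first such degree and read off its digits (`exists_isAnsDegree`, `QuerySetup.exists_output`).

First-order formulas with arithmetic over words (`FO`) define uniform AC⁰ families
(`exists_isAC0_outputs`). The circuit has a few layers for each subformula, which compute it and its
complement; a gate of a layer is numbered by the code of an assignment of the free variables. The
codes are iterated polynomial pairings, so the wiring is `Δ₀`-definable (`FO.realize`,
`layerCircuit_isAC0`).
-/

namespace FuzzyDL

/-! ### The crisp chase -/

section Chase

variable {NC NR NI : Type}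

/-- The inverse of a basic role. -/
def Role.flip : Role NR → Role NR
  | .name P => .inv P
  | .inv P => .name P

theorem Role.flip_flip (Q : Role NR) : Q.flip.flip = Q := by cases Q <;> rfl

/-- Replaces `∃Q` by `∃Q⁻`. -/
def Basic.flip : Basic NC NR → Basic NC NR
  | .name A => .name A
  | .ex Q => .ex Q.flip

theorem Basic.flip_flip (B : Basic NC NR) : B.flip.flip = B := by
  cases B <;> simp [Basic.flip, Role.flip_flip]

/-- Ground facts over the elements `E`. -/
inductive Fact (NC NR E : Type) where
  | conc (B : Basic NC NR) (x : E)
  | role (Q : Role NR) (x y : E)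

/-- The basic concept a fact speaks about; role facts `Q(x,y)` count as `∃Q`. -/
def Fact.basic {E : Type} : Fact NC NR E → Basic NC NR
  | .conc B _ => B
  | .role Q _ _ => .ex Q

/-- Application of a map of elements to a fact. -/
def Fact.map {E E' : Type} (f : E → E') : Fact NC NR E → Fact NC NR E'
  | .conc B x => .conc B (f x)
  | .role Q x y => .role Q (f x) (f y)

/-- The elements of the chase: an individual, or the dummy individual `none` that keeps the domain
non-empty, followed by the (reversed) list of the roles that lead to an anonymous successor. -/
abbrev Elt (NR NI : Type) : Type := Option NI × List (Role NR)

/-- The oblivious chase of an ABox with the positive inclusions of a TBox. All degrees are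
ignored. Every rule has at most one premise. -/
inductive Chase (T : Set (Inclusion NC NR)) (A : Set (Assertion NC NR NI Degree)) :
    Fact NC NR (Elt NR NI) → Prop
  | conc {B a d} : Assertion.concept B a d ∈ A → Chase T A (.conc B (some a, []))
  | role {P a b d} : Assertion.role P a b d ∈ A →
      Chase T A (.role (.name P) (some a, []) (some b, []))
  | subC {B B' d x} : Inclusion.concept B (.pos B') d ∈ T → Chase T A (.conc B x) →
      Chase T A (.conc B' x)
  | subR {Q Q' d x y} : Inclusion.role Q (.pos Q') d ∈ T → Chase T A (.role Q x y) →
      Chase T A (.role Q' x y)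
  | inv {Q x y} : Chase T A (.role Q x y) → Chase T A (.role Q.flip y x)
  | ex {Q x y} : Chase T A (.role Q x y) → Chase T A (.conc (.ex Q) x)
  | wit {Q x} : Chase T A (.conc (.ex Q) x) → Chase T A (.role Q x (x.1, Q :: x.2))

theorem Chase.mono {T T' : Set (Inclusion NC NR)} {A A' : Set (Assertion NC NR NI Degree)}
    (hT : T ⊆ T') (hA : A ⊆ A') {F : Fact NC NR (Elt NR NI)} (h : Chase T A F) :
    Chase T' A' F := by
  induction h with
  | conc h => exact .conc (hA h)
  | role h => exact .role (hA h)
  | subC h _ ih => exact .subC (hT h) ih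
  | subR h _ ih => exact .subR (hT h) ih
  | inv _ ih => exact .inv ih
  | ex _ ih => exact .ex ih
  | wit _ ih => exact .wit ih

theorem Chase.conc_ex_iff {T : Set (Inclusion NC NR)} {A : Set (Assertion NC NR NI Degree)}
    {Q : Role NR} {x : Elt NR NI} :
    Chase T A (.conc (.ex Q) x) ↔ ∃ y, Chase T A (.role Q x y) :=
  ⟨fun h => ⟨_, .wit h⟩, fun ⟨_, h⟩ => .ex h⟩

theorem Chase.flip_iff {T : Set (Inclusion NC NR)} {A : Set (Assertion NC NR NI Degree)}
    {Q : Role NR} {x y : Elt NR NI} :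
    Chase T A (.role Q.flip x y) ↔ Chase T A (.role Q y x) :=
  ⟨fun h => by simpa [Role.flip_flip] using h.inv, .inv⟩

/-- Since the rules are linear, every fact stems from a single assertion. -/
theorem Chase.exists_singleton {T : Set (Inclusion NC NR)}
    {A : Set (Assertion NC NR NI Degree)} {F : Fact NC NR (Elt NR NI)} (h : Chase T A F) :
    ∃ β ∈ A, Chase T {β} F := by
  induction h with
  | conc h => exact ⟨_, h, .conc rfl⟩
  | role h => exact ⟨_, h, .role rfl⟩
  | subC h _ ih => obtain ⟨β, hβ, ih⟩ := ih; exact ⟨β, hβ, .subC h ih⟩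
  | subR h _ ih => obtain ⟨β, hβ, ih⟩ := ih; exact ⟨β, hβ, .subR h ih⟩
  | inv _ ih => obtain ⟨β, hβ, ih⟩ := ih; exact ⟨β, hβ, .inv ih⟩
  | ex _ ih => obtain ⟨β, hβ, ih⟩ := ih; exact ⟨β, hβ, .ex ih⟩
  | wit _ ih => obtain ⟨β, hβ, ih⟩ := ih; exact ⟨β, hβ, .wit ih⟩

/-- The predicate of an assertion. -/
def Assertion.kind {D : Type} : Assertion NC NR NI D → Basic NC NR ⊕ NR
  | .concept B _ _ => .inl B
  | .role P _ _ _ => .inr P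

/-- The basic concept of a predicate; the role name `P` counts as `∃P`. -/
def kindBasic : Basic NC NR ⊕ NR → Basic NC NR
  | .inl B => B
  | .inr P => .ex (.name P)

/-- The first individual of an assertion. -/
def Assertion.fst {D : Type} : Assertion NC NR NI D → NI
  | .concept _ a _ => a
  | .role _ a _ _ => a

/-- The last individual of an assertion (for concept assertions, the same as the first). -/
def Assertion.snd {D : Type} : Assertion NC NR NI D → NI
  | .concept _ a _ => a
  | .role _ _ b _ => b

/-- The degree of an assertion. -/
def Assertion.deg {D : Type} : Assertion NC NR NI D → D
  | .concept _ _ d => d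
  | .role _ _ _ d => d

@[simp] theorem Assertion.kind_map {D E : Type} (f : D → E) (α : Assertion NC NR NI D) :
    (α.map f).kind = α.kind := by cases α <;> rfl

@[simp] theorem Assertion.fst_map {D E : Type} (f : D → E) (α : Assertion NC NR NI D) :
    (α.map f).fst = α.fst := by cases α <;> rfl

@[simp] theorem Assertion.snd_map {D E : Type} (f : D → E) (α : Assertion NC NR NI D) :
    (α.map f).snd = α.snd := by cases α <;> rfl

@[simp] theorem Assertion.deg_map {D E : Type} (f : D → E) (α : Assertion NC NR NI D) :
    (α.map f).deg = f α.deg := by cases α <;> rfl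

/-- The left-hand side of an inclusion. -/
def Inclusion.lhs : Inclusion NC NR → Basic NC NR
  | .concept B _ _ => B
  | .role Q _ _ => .ex Q

/-- If `X` is closed under inverses and contains the left-hand sides of the TBox, then facts about
members of `X` stem from assertions about members of `X`. -/
theorem Chase.kindBasic_mem {T : Set (Inclusion NC NR)} {X : Set (Basic NC NR)}
    (hT : ∀ α ∈ T, α.lhs ∈ X) (hX : ∀ B ∈ X, B.flip ∈ X) {β : Assertion NC NR NI Degree}
    {F : Fact NC NR (Elt NR NI)} (h : Chase T {β} F) (hF : F.basic ∈ X) :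
    kindBasic β.kind ∈ X := by
  induction h with
  | conc h => obtain rfl := h; exact hF
  | role h => obtain rfl := h; exact hF
  | subC h _ ih => exact ih (hT _ h)
  | subR h _ ih => exact ih (hT _ h)
  | @inv Q x y _ ih =>
    refine ih ?_
    have := hX _ hF
    simpa [Fact.basic, Basic.flip, Role.flip_flip] using this
  | ex _ ih => exact ih hF
  | wit _ ih => exact ih hF

/-- Renaming of individuals, extended to the elements of the chase. -/
def Elt.map (f : NI → NI) (x : Elt NR NI) : Elt NR NI := (x.1.map f, x.2)

theorem Chase.map_range {ι : Type} {T : Set (Inclusion NC NR)}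
    {α α' : ι → Assertion NC NR NI Degree} {f : NI → NI}
    (hk : ∀ i, (α i).kind = (α' i).kind) (h1 : ∀ i, f (α i).fst = (α' i).fst)
    (h2 : ∀ i, f (α i).snd = (α' i).snd) {F : Fact NC NR (Elt NR NI)}
    (h : Chase T (Set.range α) F) : Chase T (Set.range α') (F.map (Elt.map f)) := by
  induction h with
  | @conc B a d h =>
    obtain ⟨i, hi⟩ := h
    have hk := hk i; have h1 := h1 i
    rw [hi] at hk h1
    cases hα : α' i with
    | concept B' a' d' =>
      rw [hα] at hk h1
      simp only [Assertion.kind, Sum.inl.injEq, Assertion.fst] at hk h1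
      subst hk h1
      exact .conc (d := d') ⟨i, hα⟩
    | role => rw [hα] at hk; simp [Assertion.kind] at hk
  | @role P a b d h =>
    obtain ⟨i, hi⟩ := h
    have hk := hk i; have h1 := h1 i; have h2 := h2 i
    rw [hi] at hk h1 h2
    cases hα : α' i with
    | role P' a' b' d' =>
      rw [hα] at hk h1 h2
      simp only [Assertion.kind, Sum.inr.injEq, Assertion.fst, Assertion.snd] at hk h1 h2
      subst hk h1 h2
      exact .role (d := d') ⟨i, hα⟩
    | concept => rw [hα] at hk; simp [Assertion.kind] at hk
  | subC h _ ih => exact .subC h ih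
  | subR h _ ih => exact .subR h ih
  | inv _ ih => exact .inv ih
  | ex _ ih => exact .ex ih
  | wit _ ih => exact .wit ih

/-- Interpretation of terms in the chase. -/
def tmElt {k m : ℕ} (a : Fin k → NI) (e : Fin m → Elt NR NI) : Tm NI k m → Elt NR NI
  | .ans i => (some (a i), [])
  | .exi j => e j
  | .ind c => (some c, [])

/-- The fact that a query atom becomes under a match. -/
def atomFact {k m : ℕ} (a : Fin k → NI) (e : Fin m → Elt NR NI) :
    Atom NC NR NI k m → Fact NC NR (Elt NR NI)
  | .concept B t => .conc B (tmElt a e t)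
  | .role P t₁ t₂ => .role (.name P) (tmElt a e t₁) (tmElt a e t₂)

/-- The chase satisfies the query. -/
def ChaseEntails (T : Set (Inclusion NC NR)) (A : Set (Assertion NC NR NI Degree)) {k : ℕ}
    (q : CQ NC NR NI k) (a : Fin k → NI) : Prop :=
  ∃ e : Fin q.numEx → Elt NR NI, ∀ α ∈ q.atoms, Chase T A (atomFact a e α)

/-- The basic concept of a query atom. -/
def Atom.basic {k m : ℕ} : Atom NC NR NI k m → Basic NC NR
  | .concept B _ => B
  | .role P _ _ => .ex (.name P)

theorem atomFact_basic {k m : ℕ} (a : Fin k → NI) (e : Fin m → Elt NR NI)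
    (α : Atom NC NR NI k m) : (atomFact a e α).basic = α.basic := by cases α <;> rfl

theorem ChaseEntails.mono {T T' : Set (Inclusion NC NR)}
    {A A' : Set (Assertion NC NR NI Degree)} (hT : T ⊆ T') (hA : A ⊆ A') {k : ℕ}
    {q : CQ NC NR NI k} {a : Fin k → NI} (h : ChaseEntails T A q a) :
    ChaseEntails T' A' q a := by
  obtain ⟨e, he⟩ := h
  exact ⟨e, fun α hα => (he α hα).mono hT hA⟩

/-- A query needs at most one relevant assertion for each of its atoms. This takes the place of a
query rewriting. -/
theorem chaseEntails_iff_exists {T : Set (Inclusion NC NR)} {X : Set (Basic NC NR)}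
    (hT : ∀ α ∈ T, α.lhs ∈ X) (hX : ∀ B ∈ X, B.flip ∈ X) {k : ℕ} {q : CQ NC NR NI k}
    (hq : ∀ α ∈ q.atoms, α.basic ∈ X) {A : Set (Assertion NC NR NI Degree)} {a : Fin k → NI} :
    ChaseEntails T A q a ↔ ∃ α : Fin q.atoms.length → Assertion NC NR NI Degree,
      (∀ i, α i ∈ A ∧ kindBasic (α i).kind ∈ X) ∧ ChaseEntails T (Set.range α) q a := by
  constructor
  · rintro ⟨e, he⟩
    have key : ∀ i : Fin q.atoms.length, ∃ β ∈ A, Chase T {β} (atomFact a e (q.atoms.get i)) :=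
      fun i => (he _ (List.get_mem _ _)).exists_singleton
    choose α hα hc using key
    refine ⟨α, fun i => ⟨hα i, (hc i).kindBasic_mem hT hX ?_⟩, e, fun β hβ => ?_⟩
    · rw [atomFact_basic]; exact hq _ (List.get_mem _ _)
    · obtain ⟨i, rfl⟩ := List.get_of_mem hβ
      exact (hc i).mono subset_rfl (by rintro _ rfl; exact ⟨i, rfl⟩)
  · rintro ⟨α, hα, h⟩
    exact h.mono subset_rfl (by rintro _ ⟨i, rfl⟩; exact (hα i).1)

/-- The individual names that occur in a term. -/
def Tm.inds {k m : ℕ} : Tm NI k m → List NI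
  | .ind c => [c]
  | _ => []

/-- The individual names that occur in a query atom. -/
def Atom.inds {k m : ℕ} : Atom NC NR NI k m → List NI
  | .concept _ t => t.inds
  | .role _ t₁ t₂ => t₁.inds ++ t₂.inds

theorem tmElt_map {k m : ℕ} {a a' : Fin k → NI} {f : NI → NI} (ha : ∀ i, f (a i) = a' i)
    (e : Fin m → Elt NR NI) (t : Tm NI k m) (hc : ∀ c ∈ t.inds, f c = c) :
    tmElt a' (fun j => (e j).map f) t = (tmElt a e t).map f := by
  cases t with
  | ans i => simp [tmElt, Elt.map, ha]
  | exi j => rfl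
  | ind c => simp [tmElt, Elt.map, hc c (by simp [Tm.inds])]

theorem atomFact_map {k m : ℕ} {a a' : Fin k → NI} {f : NI → NI} (ha : ∀ i, f (a i) = a' i)
    (e : Fin m → Elt NR NI) (α : Atom NC NR NI k m) (hc : ∀ c ∈ α.inds, f c = c) :
    atomFact a' (fun j => (e j).map f) α = (atomFact a e α).map (Elt.map f) := by
  cases α with
  | concept B t => simp only [atomFact, Fact.map]; rw [tmElt_map ha e t hc]
  | role P t₁ t₂ =>
    simp only [atomFact, Fact.map]
    rw [tmElt_map ha e t₁ fun c h => hc c (List.mem_append_left _ h),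
      tmElt_map ha e t₂ fun c h => hc c (List.mem_append_right _ h)]

/-- Entailment from indexed assertions depends only on their predicates, and is preserved along
renamings of the individuals that fix the individual names of the query. -/
theorem ChaseEntails.map_range {ι : Type} {T : Set (Inclusion NC NR)}
    {α α' : ι → Assertion NC NR NI Degree} {f : NI → NI}
    (hk : ∀ i, (α i).kind = (α' i).kind) (h1 : ∀ i, f (α i).fst = (α' i).fst)
    (h2 : ∀ i, f (α i).snd = (α' i).snd) {k : ℕ} {q : CQ NC NR NI k} {a a' : Fin k → NI}
    (ha : ∀ i, f (a i) = a' i) (hc : ∀ β ∈ q.atoms, ∀ c ∈ β.inds, f c = c)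
    (h : ChaseEntails T (Set.range α) q a) : ChaseEntails T (Set.range α') q a' := by
  obtain ⟨e, he⟩ := h
  refine ⟨fun j => (e j).map f, fun β hβ => ?_⟩
  rw [atomFact_map ha e β (hc β hβ)]
  exact (he β hβ).map_range hk h1 h2

/-- The individual named in a slot: the first or the last individual of an assertion, or an
answer. -/
def slotInd {ι : Type} {k : ℕ} (α : ι → Assertion NC NR NI Degree) (a : Fin k → NI) :
    ι ⊕ ι ⊕ Fin k → NI
  | .inl i => (α i).fst
  | .inr (.inl i) => (α i).snd
  | .inr (.inr i) => a i

/-- Entailment from indexed assertions depends only on their predicates and on which slots name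
the same individual or an individual of the query. -/
theorem ChaseEntails.of_pattern {ι : Type} {T : Set (Inclusion NC NR)}
    {α α' : ι → Assertion NC NR NI Degree} {k : ℕ} {q : CQ NC NR NI k} {a a' : Fin k → NI}
    (hk : ∀ i, (α i).kind = (α' i).kind)
    (hs : ∀ s t, slotInd α a s = slotInd α a t ↔ slotInd α' a' s = slotInd α' a' t)
    (hc : ∀ s, ∀ β ∈ q.atoms, ∀ c ∈ β.inds, slotInd α a s = c ↔ slotInd α' a' s = c)
    (h : ChaseEntails T (Set.range α) q a) : ChaseEntails T (Set.range α') q a' := by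
  classical
  -- Slots that name the same individual on the left do so on the right, so this is well defined.
  let f : NI → NI := fun x =>
    if h : ∃ s, slotInd α a s = x then slotInd α' a' h.choose else x
  have hf : ∀ s, f (slotInd α a s) = slotInd α' a' s := by
    intro s
    have hex : ∃ t, slotInd α a t = slotInd α a s := ⟨s, rfl⟩
    simp only [f, dif_pos hex]
    exact (hs _ _).1 hex.choose_spec
  refine h.map_range (f := f) hk (fun i => hf (.inl i)) (fun i => hf (.inr (.inl i)))
    (fun i => hf (.inr (.inr i))) fun β hβ c hcc => ?_
  by_cases hex : ∃ t, slotInd α a t = c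
  · obtain ⟨t, rfl⟩ := hex
    rw [hf]
    exact (hc t β hβ _ hcc).1 rfl
  · simp only [f, dif_neg hex]

end Chase

/-! ### Entailment is satisfaction in the chase of a cut -/

section Semantics

variable {NC NR NI : Type}

/-- The inclusions whose degree lies in `U`. -/
def cutT (T : Set (Inclusion NC NR)) (U : Set Degree) : Set (Inclusion NC NR) :=
  {α ∈ T | α.degree ∈ U}

/-- The assertions whose degree lies in `U`. -/
def cutA (A : Set (Assertion NC NR NI Degree)) (U : Set Degree) :
    Set (Assertion NC NR NI Degree) :=
  {β ∈ A | β.deg ∈ U}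

theorem le_gImp_iff {d x y : Degree} : d ≤ gImp x y ↔ min d x ≤ y := by
  unfold gImp
  split_ifs with h
  · simp [unitInterval.le_one', h]
  · simp [h]

theorem le_gImp_gNeg_iff {d x y : Degree} :
    d ≤ gImp x (gNeg y) ↔ d = 0 ∨ x = 0 ∨ y = 0 := by
  rw [le_gImp_iff]
  unfold gNeg gImp
  have h0 : ∀ z : Degree, z ≤ 0 ↔ z = 0 := fun z =>
    ⟨fun h => le_antisymm h unitInterval.nonneg', fun h => h.le⟩
  split_ifs with h
  · simp [unitInterval.le_one', (h0 y).1 h]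
  · rw [min_le_iff, h0, h0]
    have : y ≠ 0 := fun h' => h h'.le
    tauto

theorem Interp.evalRole_flip (I : Interp NC NR NI) (Q : Role NR) (x y : I.Dom) :
    I.evalRole Q.flip x y = I.evalRole Q y x := by cases Q <;> rfl

/-- The degree of a fact under a map of its elements to an interpretation. -/
noncomputable def Interp.evalFact (I : Interp NC NR NI) {E : Type} (h : E → I.Dom) :
    Fact NC NR E → Degree
  | .conc B x => I.evalBasic B (h x)
  | .role Q x y => I.evalRole Q (h x) (h y)

/-- The chase maps homomorphically into the `U`-cut of every model, if `U` is an upper set such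
that suprema that lie in `U` have a witness in `U`. -/
theorem Interp.exists_hom (I : Interp NC NR NI) {T : Set (Inclusion NC NR)}
    {A : Set (Assertion NC NR NI Degree)} {U : Set Degree} (hU : IsUpperSet U)
    (hw : ∀ Q x, (⨆ y, I.evalRole Q x y) ∈ U → ∃ y, I.evalRole Q x y ∈ U)
    (hT : ∀ α ∈ T, I.SatInclusion α ∧ α.degree ∈ U)
    (hA : ∀ β ∈ A, I.SatAssertion β ∧ β.deg ∈ U) :
    ∃ h : Elt NR NI → I.Dom, (∀ a, h (some a, []) = I.ind a) ∧
      ∀ F, Chase T A F → I.evalFact h F ∈ U := by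
  classical
  -- An anonymous element goes to a witness for the last role on the path that leads to it.
  let wit : Role NR → I.Dom → I.Dom := fun Q x =>
    if h : ∃ y, I.evalRole Q x y ∈ U then h.choose else x
  let hom : Option NI → List (Role NR) → I.Dom := fun o l =>
    l.foldr wit (o.elim I.nonempty.some I.ind)
  have hmin : ∀ {d x y : Degree}, d ∈ U → x ∈ U → d ≤ gImp x y → y ∈ U := by
    intro d x y hd hx h
    rw [le_gImp_iff] at h
    refine hU h ?_
    rcases min_choice d x with h | h <;> rw [h] <;> assumption
  refine ⟨fun x => hom x.1 x.2, fun a => rfl, fun F hF => ?_⟩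
  induction hF with
  | conc h => exact hU (hA _ h).1 (hA _ h).2
  | role h => exact hU (hA _ h).1 (hA _ h).2
  | subC h _ ih => exact hmin (hT _ h).2 ih ((hT _ h).1 _)
  | subR h _ ih => exact hmin (hT _ h).2 ih ((hT _ h).1 _ _)
  | inv _ ih => simpa only [Interp.evalFact, Interp.evalRole_flip] using ih
  | ex _ ih => exact hU (le_iSup (fun y => I.evalRole _ _ y) _) ih
  | @wit Q x _ ih =>
    have hex := hw _ _ ih
    have : hom x.1 (Q :: x.2) = hex.choose := by
      change wit Q (hom x.1 x.2) = _
      simp only [wit, dif_pos hex]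
    simp only [Interp.evalFact]
    rw [this]
    exact hex.choose_spec

theorem Interp.evalAtom_eq_evalFact (I : Interp NC NR NI) {k m : ℕ} (a : Fin k → NI)
    (e : Fin m → Elt NR NI) (h : Elt NR NI → I.Dom) (hh : ∀ a, h (some a, []) = I.ind a)
    (α : Atom NC NR NI k m) :
    I.evalAtom a (fun j => h (e j)) α = I.evalFact h (atomFact a e α) := by
  have ht : ∀ t : Tm NI k m, I.evalTm a (fun j => h (e j)) t = h (tmElt a e t) := by
    intro t; cases t <;> simp [Interp.evalTm, tmElt, hh]
  cases α <;> simp [Interp.evalAtom, Interp.evalFact, Interp.evalRole, atomFact, ht]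

/-- Three-valued degrees: `1` if `p`, otherwise `e` if `p'`, otherwise `0`. -/
noncomputable def lvl (e : Degree) (p p' : Prop) : Degree :=
  open Classical in if p then 1 else if p' then e else 0

theorem iSup_lvl {ι : Type} (e : Degree) (p p' : ι → Prop) :
    ⨆ y, lvl e (p y) (p' y) = lvl e (∃ y, p y) (∃ y, p' y) := by
  apply le_antisymm
  · refine iSup_le fun y => ?_
    by_cases h1 : ∃ y, p y
    · simp [lvl, h1, unitInterval.le_one']
    · have h2 : ¬ p y := fun h => h1 ⟨y, h⟩
      by_cases h3 : p' y
      · simp [lvl, h1, h2, h3, Exists.intro y h3]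
      · simp [lvl, h2, h3]
  · by_cases h1 : ∃ y, p y
    · obtain ⟨y, hy⟩ := h1
      refine le_trans unitInterval.le_one' (le_trans ?_ (le_iSup _ y))
      simp [lvl, hy]
    · by_cases h2 : ∃ y, p' y
      · obtain ⟨y, hy⟩ := h2
        refine le_trans ?_ (le_iSup _ y)
        have : ¬ p y := fun h => h1 ⟨y, h⟩
        simp only [lvl, if_neg h1, if_neg this, if_pos hy, if_pos (⟨y, hy⟩ : ∃ y, p' y)]
        exact le_rfl
      · simp only [lvl, if_neg h1, if_neg h2]
        exact unitInterval.nonneg'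

/-- The chase with inclusions `T` and assertions `A` at degree `1`, and with `T'` and `A'` at
degree `e`. -/
noncomputable abbrev chaseInterp (T T' : Set (Inclusion NC NR))
    (A A' : Set (Assertion NC NR NI Degree)) (e : Degree) : Interp NC NR NI where
  Dom := Elt NR NI
  nonempty := ⟨(none, [])⟩
  ind a := (some a, [])
  conc B x := lvl e (Chase T A (.conc (.name B) x)) (Chase T' A' (.conc (.name B) x))
  role P x y := lvl e (Chase T A (.role (.name P) x y)) (Chase T' A' (.role (.name P) x y))

variable {T T' : Set (Inclusion NC NR)} {A A' : Set (Assertion NC NR NI Degree)} {e : Degree}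

theorem chaseInterp_evalRole (Q : Role NR) (x y : Elt NR NI) :
    (chaseInterp T T' A A' e).evalRole Q x y =
      lvl e (Chase T A (.role Q x y)) (Chase T' A' (.role Q x y)) := by
  cases Q with
  | name P => rfl
  | inv P =>
    have h := fun (T : Set (Inclusion NC NR)) (A : Set (Assertion NC NR NI Degree)) =>
      Chase.flip_iff (T := T) (A := A) (Q := .name P) (x := x) (y := y)
    simp only [Role.flip] at h
    rw [h, h]
    rfl

theorem chaseInterp_evalBasic (B : Basic NC NR) (x : Elt NR NI) :
    (chaseInterp T T' A A' e).evalBasic B x =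
      lvl e (Chase T A (.conc B x)) (Chase T' A' (.conc B x)) := by
  cases B with
  | name _ => rfl
  | ex Q =>
    rw [Chase.conc_ex_iff, Chase.conc_ex_iff, ← iSup_lvl]
    exact iSup_congr fun y => chaseInterp_evalRole Q x y

theorem chaseInterp_witnessed : (chaseInterp T T' A A' e).Witnessed := by
  intro Q x
  have h : (⨆ y, (chaseInterp T T' A A' e).evalRole Q x y) = _ :=
    chaseInterp_evalBasic (T := T) (T' := T') (A := A) (A' := A') (e := e) (.ex Q) x
  rw [h, Chase.conc_ex_iff, Chase.conc_ex_iff]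
  by_cases h1 : ∃ y, Chase T A (.role Q x y)
  · refine ⟨h1.choose, ?_⟩
    rw [chaseInterp_evalRole]
    simp only [lvl, if_pos h1, if_pos h1.choose_spec]
  · by_cases h2 : ∃ y, Chase T' A' (.role Q x y)
    · refine ⟨h2.choose, ?_⟩
      have h3 : ¬ Chase T A (.role Q x h2.choose) := fun h => h1 ⟨_, h⟩
      rw [chaseInterp_evalRole]
      simp only [lvl, if_neg h1, if_neg h3, if_pos h2, if_pos h2.choose_spec]
    · refine ⟨x, ?_⟩
      rw [chaseInterp_evalRole]
      have h3 : ¬ Chase T A (.role Q x x) := fun h => h1 ⟨_, h⟩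
      have h4 : ¬ Chase T' A' (.role Q x x) := fun h => h2 ⟨_, h⟩
      simp only [lvl, if_neg h1, if_neg h2, if_neg h3, if_neg h4]

/-- `lvl` respects an implication up to degree `f` if the implication holds for the lower cut, and
for the upper cut unless `f ≤ e`. -/
theorem min_lvl_le {f : Degree} {p p' r r' : Prop} (h' : p' → r') (hpp : p → p')
    (h : (p → r) ∨ f ≤ e) : min f (lvl e p p') ≤ lvl e r r' := by
  by_cases hr : r
  · simp [lvl, hr, unitInterval.le_one']
  by_cases hr' : r'
  · simp only [lvl, if_neg hr, if_pos hr']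
    rcases h with h | h
    · refine (min_le_right _ _).trans ?_
      rw [if_neg fun hp => hr (h hp)]
      split_ifs
      · exact le_rfl
      · exact unitInterval.nonneg'
    · exact (min_le_left _ _).trans h
  · have h1 : ¬ p' := fun h => hr' (h' h)
    have h2 : ¬ p := fun h => h1 (hpp h)
    simp [lvl, hr, hr', h1, h2]

theorem Ontology.Consistent.all {O : Ontology NC NR NI} {s : Sem} (h : O.Consistent s) :
    O.Consistent .all := by
  obtain ⟨I, _, h⟩ := h
  exact ⟨I, trivial, h⟩

/-- The set of the positive degrees. -/
abbrev posDeg : Set Degree := Set.Ioi 0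

/-- Consistent ontologies: the chase of all inclusions and assertions of positive degree satisfies
the negative inclusions. -/
theorem exists_hom_posDeg {O : Ontology NC NR NI} (hO : O.Consistent .all) :
    ∃ I : Interp NC NR NI, I.IsModel O ∧ ∃ h : Elt NR NI → I.Dom,
      ∀ F, Chase (cutT O.tbox posDeg) (cutA O.abox posDeg) F → I.evalFact h F ≠ 0 := by
  obtain ⟨I, -, hI⟩ := hO
  obtain ⟨h, -, hF⟩ := I.exists_hom (U := posDeg) (isUpperSet_Ioi 0)
    (fun Q x h => lt_iSup_iff.1 (Set.mem_Ioi.1 h))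
    (fun α (hα : α ∈ cutT O.tbox posDeg) => ⟨hI.1 α hα.1, hα.2⟩)
    (fun β (hβ : β ∈ cutA O.abox posDeg) => ⟨hI.2 β hβ.1, hβ.2⟩)
  exact ⟨I, hI, h, fun F hC => (hF F hC).ne'⟩

/-- For a consistent ontology, the chase of a cut at `d > 0`, filled up with the facts of positive
degree at a degree `e < d` above all smaller degrees of the ontology, is a model. -/
theorem chaseInterp_isModel {O : Ontology NC NR NI} (hO : O.Consistent .all) {d : Degree}
    (hd : 0 < d) (hT : ∀ α ∈ O.tbox, α.degree < d → α.degree ≤ e)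
    (hA : ∀ β ∈ O.abox, β.deg < d → β.deg ≤ e) :
    (chaseInterp (cutT O.tbox (Set.Ici d)) (cutT O.tbox posDeg)
      (cutA O.abox (Set.Ici d)) (cutA O.abox posDeg) e).IsModel O := by
  obtain ⟨I, hI, h, hF⟩ := exists_hom_posDeg hO
  have hsub : Set.Ici d ⊆ posDeg := fun x hx => lt_of_lt_of_le hd hx
  have hmono : ∀ F, Chase (cutT O.tbox (Set.Ici d)) (cutA O.abox (Set.Ici d)) F →
      Chase (cutT O.tbox posDeg) (cutA O.abox posDeg) F := fun F hF =>
    hF.mono (fun α hα => And.intro (And.left hα) (hsub (And.right hα)))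
      (fun β hβ => And.intro (And.left hβ) (hsub (And.right hβ)))
  have hpos : ∀ f : Degree, f ∉ posDeg → f = 0 := fun f hf =>
    le_antisymm (not_lt.1 hf) unitInterval.nonneg'
  have hlvl : ∀ p p' : Prop, (p → p') → ¬ p' → lvl e p p' = 0 := by
    intro p p' h1 h2
    have h3 : ¬ p := fun h => h2 (h1 h)
    simp [lvl, h2, h3]
  constructor
  · intro α hα
    by_cases hpd : α.degree ∈ posDeg
    swap
    · rcases α with ⟨B, C, f⟩ | ⟨Q, R, f⟩
      · intro x; rw [show f = 0 from hpos _ hpd]; exact unitInterval.nonneg'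
      · intro x y; rw [show f = 0 from hpos _ hpd]; exact unitInterval.nonneg'
    have hcase : α.degree ≤ e ∨ d ≤ α.degree := by
      by_cases h : d ≤ α.degree
      · exact .inr h
      · exact .inl (hT α hα (not_le.1 h))
    rcases α with ⟨B, C | C, f⟩ | ⟨Q, R | R, f⟩
    · intro x
      rw [le_gImp_iff]
      simp only [Interp.evalConcept, chaseInterp_evalBasic]
      refine min_lvl_le (Chase.subC ⟨hα, hpd⟩) (hmono _) ?_
      exact hcase.symm.imp (fun h => Chase.subC ⟨hα, h⟩) id
    · intro x
      simp only [Interp.evalConcept, chaseInterp_evalBasic]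
      rw [le_gImp_gNeg_iff]
      have hI := hI.1 _ hα (h x)
      simp only [Interp.evalConcept] at hI
      rw [le_gImp_gNeg_iff] at hI
      refine hI.imp id (Or.imp ?_ ?_) <;> intro h0 <;>
        exact hlvl _ _ (hmono _) fun hc => hF (.conc _ _) hc h0
    · intro x y
      rw [le_gImp_iff]
      simp only [Interp.evalGRole, chaseInterp_evalRole]
      refine min_lvl_le (Chase.subR ⟨hα, hpd⟩) (hmono _) ?_
      exact hcase.symm.imp (fun h => Chase.subR ⟨hα, h⟩) id
    · intro x y
      simp only [Interp.evalGRole, chaseInterp_evalRole]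
      rw [le_gImp_gNeg_iff]
      have hI := hI.1 _ hα (h x) (h y)
      simp only [Interp.evalGRole] at hI
      rw [le_gImp_gNeg_iff] at hI
      refine hI.imp id (Or.imp ?_ ?_) <;> intro h0 <;>
        exact hlvl _ _ (hmono _) fun hc => hF (.role _ _ _) hc h0
  · intro β hβ
    have key : ∀ p p' : Prop, (β.deg ∈ posDeg → p') → (d ≤ β.deg → p) →
        β.deg ≤ lvl e p p' := by
      intro p p' h1 h2
      by_cases hp : p
      · simp [lvl, hp, unitInterval.le_one']
      by_cases hp' : p'
      · simp only [lvl, if_neg hp, if_pos hp']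
        exact hA β hβ (not_le.1 fun h => hp (h2 h))
      · rw [hpos β.deg fun h => hp' (h1 h)]
        exact unitInterval.nonneg'
    rcases β with ⟨B, a, f⟩ | ⟨P, a, b, f⟩
    · change f ≤ _
      rw [chaseInterp_evalBasic]
      exact key _ _ (fun h => .conc ⟨hβ, h⟩) (fun h => .conc ⟨hβ, h⟩)
    · exact key _ _ (fun h => .role ⟨hβ, h⟩) (fun h => .role ⟨hβ, h⟩)

theorem Interp.le_matchDegree_iff (I : Interp NC NR NI) {k : ℕ} (q : CQ NC NR NI k)
    (a : Fin k → NI) (m : Fin q.numEx → I.Dom) (d : Degree) :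
    d ≤ I.matchDegree q a m ↔ ∀ α ∈ q.atoms, d ≤ I.evalAtom a m α := by
  unfold Interp.matchDegree
  induction q.atoms with
  | nil => simp [unitInterval.le_one']
  | cons α l ih => simp [gTnorm, ih]

theorem Interp.satTQ_toTQ_iff (I : Interp NC NR NI) {k : ℕ} (q : CQ NC NR NI k)
    (a : Fin k → NI) (d : Degree) :
    I.SatTQ (q.toTQ d) a ↔ ∃ m : Fin q.numEx → I.Dom, d ≤ I.matchDegree q a m := by
  simp only [Interp.le_matchDegree_iff]
  constructor
  · rintro ⟨m, hm⟩
    exact ⟨m, fun α hα => hm (α, d) (List.mem_map_of_mem hα)⟩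
  · rintro ⟨m, hm⟩
    refine ⟨m, fun p hp => ?_⟩
    obtain ⟨α, hα, rfl⟩ := List.mem_map.1 hp
    exact hm α hα

theorem Interp.SatTQ.le_queryDegree {I : Interp NC NR NI} {k : ℕ} {q : CQ NC NR NI k}
    {a : Fin k → NI} {d : Degree} (h : I.SatTQ (q.toTQ d) a) : d ≤ I.queryDegree q a := by
  obtain ⟨m, hm⟩ := (I.satTQ_toTQ_iff q a d).1 h
  exact hm.trans (le_iSup (fun m => I.matchDegree q a m) m)

theorem Interp.satTQ_of_lt_queryDegree {I : Interp NC NR NI} {k : ℕ} {q : CQ NC NR NI k}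
    {a : Fin k → NI} {d : Degree} (h : d < I.queryDegree q a) : I.SatTQ (q.toTQ d) a := by
  obtain ⟨m, hm⟩ := lt_iSup_iff.1 h
  exact (I.satTQ_toTQ_iff q a d).2 ⟨m, hm.le⟩

/-- A finite set of degrees leaves a gap below every positive degree. -/
theorem exists_gap {S : Set Degree} (hS : S.Finite) {d : Degree} (hd : 0 < d) :
    ∃ e, e < d ∧ ∀ f ∈ S, f < d → f ≤ e := by
  have hfin : (insert 0 {f ∈ S | f < d}).Finite := (hS.subset (Set.sep_subset _ _)).insert 0
  obtain ⟨e, he, hmax⟩ := hfin.exists_maximal ⟨0, Set.mem_insert _ _⟩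
  refine ⟨e, ?_, fun f hf hfd => ?_⟩
  · rcases he with rfl | he
    · exact hd
    · exact he.2
  · rcases le_total f e with h | h
    · exact h
    · exact hmax (Set.mem_insert_of_mem _ ⟨hf, hfd⟩) h

/-- The degrees that occur in an ontology. -/
def Ontology.degrees (O : Ontology NC NR NI) : Set Degree :=
  Inclusion.degree '' O.tbox ∪ Assertion.deg '' O.abox

theorem Ontology.degrees_finite (O : Ontology NC NR NI) : O.degrees.Finite :=
  (O.tbox_finite.image _).union (O.abox_finite.image _)

/-- The chase of the cut of an ontology at `d` satisfies the query. -/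
def Ontology.CutEntails (O : Ontology NC NR NI) {k : ℕ} (q : CQ NC NR NI k) (a : Fin k → NI)
    (d : Degree) : Prop :=
  ChaseEntails (cutT O.tbox (Set.Ici d)) (cutA O.abox (Set.Ici d)) q a

/-- Every model in which suprema that lie in the upper set `U` have a witness in `U` matches the
query in `U`. For witnessed models `U = [d, 1]` qualifies, for all models `U = (d'', 1]`. -/
theorem Ontology.CutEntails.satTQ {O : Ontology NC NR NI} {k : ℕ} {q : CQ NC NR NI k}
    {a : Fin k → NI} {d d' : Degree} (h : O.CutEntails q a d) {I : Interp NC NR NI}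
    (hI : I.IsModel O) {U : Set Degree} (hU : IsUpperSet U) (hd : d ∈ U)
    (hU' : ∀ x ∈ U, d' ≤ x)
    (hw : ∀ Q x, (⨆ y, I.evalRole Q x y) ∈ U → ∃ y, I.evalRole Q x y ∈ U) :
    I.SatTQ (q.toTQ d') a := by
  obtain ⟨h, hh, hF⟩ := I.exists_hom hU hw
    (fun α (hα : α ∈ cutT O.tbox (Set.Ici d)) => ⟨hI.1 α hα.1, hU hα.2 hd⟩)
    (fun β (hβ : β ∈ cutA O.abox (Set.Ici d)) => ⟨hI.2 β hβ.1, hU hβ.2 hd⟩)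
  obtain ⟨m, hm⟩ := ‹O.CutEntails q a d›
  rw [I.satTQ_toTQ_iff]
  refine ⟨fun j => h (m j), ?_⟩
  rw [I.le_matchDegree_iff]
  intro α hα
  rw [I.evalAtom_eq_evalFact a m h hh]
  exact hU' _ (hF _ (hm α hα))

theorem Ontology.CutEntails.entailsTQ_witnessed {O : Ontology NC NR NI} {k : ℕ}
    {q : CQ NC NR NI k} {a : Fin k → NI} {d : Degree} (h : O.CutEntails q a d) :
    O.EntailsTQ .witnessed (q.toTQ d) a := by
  intro I hw hI
  refine h.satTQ hI (isUpperSet_Ici d) (Set.mem_Ici.2 le_rfl) (fun x hx => hx) fun Q x hx => ?_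
  obtain ⟨y, hy⟩ := hw Q x
  exact ⟨y, by rw [hy]; exact hx⟩

theorem Ontology.CutEntails.entailsDeg {O : Ontology NC NR NI} {k : ℕ}
    {q : CQ NC NR NI k} {a : Fin k → NI} {d : Degree} (h : O.CutEntails q a d) :
    O.EntailsDeg .all q a d := by
  intro I _ hI
  refine le_of_forall_lt fun d' hd' => ?_
  obtain ⟨d'', h1, h2⟩ := exists_between hd'
  refine h1.trans_le (Interp.SatTQ.le_queryDegree ?_)
  exact h.satTQ hI (isUpperSet_Ioi d'') h2 (fun x hx => le_of_lt hx) fun Q x hx =>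
    lt_iSup_iff.1 (Set.mem_Ioi.1 hx)

/-- The converse of `Ontology.CutEntails.entailsDeg`: the chase yields a witnessed model in which
the query has degree at least `d` only if the chase of the cut at `d` satisfies it. -/
theorem Ontology.EntailsDeg.cutEntails {O : Ontology NC NR NI} (hO : O.Consistent .all) {k : ℕ}
    {q : CQ NC NR NI k} {a : Fin k → NI} {d : Degree} (hd : 0 < d)
    (h : O.EntailsDeg .witnessed q a d) : O.CutEntails q a d := by
  obtain ⟨e, hed, he⟩ := exists_gap O.degrees_finite hd
  have hm := chaseInterp_isModel hO hd (fun α hα => he _ (.inl ⟨α, hα, rfl⟩))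
    (fun β hβ => he _ (.inr ⟨β, hβ, rfl⟩))
  -- A match of degree above `d' > e` only uses facts of degree `1`, the facts of the cut.
  obtain ⟨d', h1, h2⟩ := exists_between hed
  have hq := lt_of_lt_of_le h2 (h _ chaseInterp_witnessed hm)
  obtain ⟨m, hm⟩ := lt_iSup_iff.1 hq
  rw [← not_le] at hm
  refine ⟨m, fun α hα => ?_⟩
  have hle := (Interp.le_matchDegree_iff _ q a m d').1 (not_le.1 hm).le α hα
  have key : ∀ p p' : Prop, d' ≤ lvl e p p' → p := by
    intro p p' hl
    by_contra hp
    simp only [lvl, if_neg hp] at hl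
    split_ifs at hl
    · exact absurd (h1.trans_le hl) (lt_irrefl _)
    · exact absurd ((unitInterval.nonneg'.trans_lt h1).trans_le hl) (lt_irrefl _)
  have ht : ∀ t : Tm NI k q.numEx, (chaseInterp (cutT O.tbox (Set.Ici d)) (cutT O.tbox posDeg)
      (cutA O.abox (Set.Ici d)) (cutA O.abox posDeg) e).evalTm a m t = tmElt a m t := by
    intro t; cases t <;> rfl
  cases α with
  | concept B t =>
    simp only [Interp.evalAtom, chaseInterp_evalBasic, ht] at hle
    exact key _ _ hle
  | role P t₁ t₂ =>
    simp only [Interp.evalAtom, ht] at hle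
    exact key _ _ hle

theorem Ontology.entailsDeg_zero (O : Ontology NC NR NI) (s : Sem) {k : ℕ} (q : CQ NC NR NI k)
    (a : Fin k → NI) : O.EntailsDeg s q a 0 := fun _ _ _ => unitInterval.nonneg'

theorem Ontology.EntailsDeg.witnessed {O : Ontology NC NR NI} {s : Sem} {k : ℕ}
    {q : CQ NC NR NI k} {a : Fin k → NI} {d : Degree} (h : O.EntailsDeg s q a d) :
    O.EntailsDeg .witnessed q a d := by
  cases s
  · exact fun I _ hI => h I trivial hI
  · exact h

theorem Ontology.EntailsDeg.of_all {O : Ontology NC NR NI} {s : Sem} {k : ℕ}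
    {q : CQ NC NR NI k} {a : Fin k → NI} {d : Degree} (h : O.EntailsDeg .all q a d) :
    O.EntailsDeg s q a d := fun I _ hI => h I trivial hI

/-- Both for all and for witnessed models, entailment of a positive degree is satisfaction of the
query in the chase of the cut. -/
theorem entailsDeg_iff {O : Ontology NC NR NI} {s : Sem} (hO : O.Consistent s) {k : ℕ}
    {q : CQ NC NR NI k} {a : Fin k → NI} {d : Degree} :
    O.EntailsDeg s q a d ↔ d = 0 ∨ O.CutEntails q a d := by
  constructor
  · intro h
    rcases (unitInterval.nonneg' : 0 ≤ d).eq_or_lt with h0 | h0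
    · exact .inl h0.symm
    · exact .inr (h.witnessed.cutEntails hO.all h0)
  · rintro (rfl | h)
    · exact O.entailsDeg_zero s q a
    · exact h.entailsDeg.of_all

theorem entailsDeg_witnessed_iff_entailsTQ {O : Ontology NC NR NI} (hO : O.Consistent .all)
    {k : ℕ} (q : CQ NC NR NI k) (a : Fin k → NI) (d : Degree) :
    O.EntailsDeg .witnessed q a d ↔ O.EntailsTQ .witnessed (q.toTQ d) a := by
  constructor
  · intro h
    rcases (unitInterval.nonneg' : 0 ≤ d).eq_or_lt with h0 | h0
    · intro I _ _
      rw [I.satTQ_toTQ_iff]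
      exact ⟨fun _ => I.nonempty.some, h0 ▸ unitInterval.nonneg'⟩
    · exact (h.cutEntails hO h0).entailsTQ_witnessed
  · exact fun h I hw hI => (h I hw hI).le_queryDegree

theorem entailsDeg_all_iff_witnessed {O : Ontology NC NR NI} (hO : O.Consistent .all)
    {k : ℕ} (q : CQ NC NR NI k) (a : Fin k → NI) (d : Degree) :
    O.EntailsDeg .all q a d ↔ O.EntailsDeg .witnessed q a d := by
  refine ⟨fun h => h.witnessed, fun h => ?_⟩
  rcases (unitInterval.nonneg' : 0 ≤ d).eq_or_lt with rfl | h0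
  · exact O.entailsDeg_zero _ q a
  · exact (h.cutEntails hO h0).entailsDeg

theorem entailsDeg_all_iff_forall_entailsTQ (O : Ontology NC NR NI)
    {k : ℕ} (q : CQ NC NR NI k) (a : Fin k → NI) (d : Degree) :
    O.EntailsDeg .all q a d ↔ ∀ d' : Degree, d' < d → O.EntailsTQ .all (q.toTQ d') a := by
  constructor
  · exact fun h d' hd' I hw hI =>
      Interp.satTQ_of_lt_queryDegree (hd'.trans_le (h I hw hI))
  · exact fun h I hw hI => le_of_forall_lt_imp_le_of_dense fun d' hd' =>
      (h d' hd' I hw hI).le_queryDegree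

/-- Entailment of a degree is witnessed by a degree of the ontology, or by `1`. -/
theorem Ontology.CutEntails.exists_degree {O : Ontology NC NR NI} {k : ℕ} {q : CQ NC NR NI k}
    {a : Fin k → NI} {d : Degree} (h : O.CutEntails q a d) :
    ∃ d' ∈ insert 1 O.degrees, d ≤ d' ∧ O.CutEntails q a d' := by
  have hfin : {f ∈ insert 1 O.degrees | d ≤ f}.Finite :=
    (O.degrees_finite.insert 1).subset (Set.sep_subset _ _)
  obtain ⟨e, he, hmin⟩ := hfin.exists_minimal ⟨1, Set.mem_insert _ _, unitInterval.le_one'⟩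
  have hmin' : ∀ f ∈ O.degrees, d ≤ f → e ≤ f := fun f hf hdf =>
    (le_total e f).elim id fun h => hmin ⟨Set.mem_insert_of_mem _ hf, hdf⟩ h
  refine ⟨e, he.1, he.2, ChaseEntails.mono ?_ ?_ h⟩
  · exact fun α hα => ⟨hα.1, hmin' _ (.inl ⟨α, hα.1, rfl⟩) hα.2⟩
  · exact fun β hβ => ⟨hβ.1, hmin' _ (.inr ⟨β, hβ.1, rfl⟩) hβ.2⟩

/-- Maximality of a degree has to be checked against finitely many degrees only. -/
theorem isAnsDegree_iff {O : Ontology NC NR NI} {s : Sem} (hO : O.Consistent s) {k : ℕ}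
    {q : CQ NC NR NI k} {a : Fin k → NI} {d : Degree} :
    O.IsAnsDegree s q a d ↔ O.EntailsDeg s q a d ∧
      ∀ d' ∈ insert 1 O.degrees, d < d' → ¬ O.EntailsDeg s q a d' := by
  refine and_congr_right fun _ => ⟨fun h d' _ => h d', fun h d' hd' hE => ?_⟩
  rcases (entailsDeg_iff hO).1 hE with rfl | hc
  · exact absurd (unitInterval.nonneg'.trans_lt hd') (lt_irrefl _)
  · obtain ⟨f, hf, hdf, hc⟩ := hc.exists_degree
    exact h f hf (hd'.trans_le hdf) ((entailsDeg_iff hO).2 (.inr hc))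

/-- The degree of an answer is `0`, `1` or a degree of the ontology. -/
theorem exists_isAnsDegree {O : Ontology NC NR NI} {s : Sem} (hO : O.Consistent s) {k : ℕ}
    (q : CQ NC NR NI k) (a : Fin k → NI) :
    ∃ d ∈ insert 0 (insert 1 O.degrees), O.IsAnsDegree s q a d := by
  have hfin : {f ∈ insert 0 (insert 1 O.degrees) | O.EntailsDeg s q a f}.Finite :=
    ((O.degrees_finite.insert 1).insert 0).subset (Set.sep_subset _ _)
  obtain ⟨e, he, hmax⟩ := hfin.exists_maximal ⟨0, Set.mem_insert _ _, O.entailsDeg_zero s q a⟩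
  refine ⟨e, he.1, (isAnsDegree_iff hO).2 ⟨he.2, fun d' hd' hlt hE => ?_⟩⟩
  exact absurd (hmax ⟨Set.mem_insert_of_mem _ hd', hE⟩ hlt.le) (not_le.2 hlt)

end Semantics

/-! ### Bounded first-order definability -/

/-- Polynomial functions of a tuple of natural numbers. -/
def Term {k : ℕ} (t : (Fin k → ℕ) → ℕ) : Prop :=
  ∃ p : MvPolynomial (Fin k) ℕ, ∀ v, t v = MvPolynomial.eval v p

namespace Term

variable {k m : ℕ} {s t : (Fin k → ℕ) → ℕ}

theorem var (i : Fin k) : Term fun v => v i := ⟨.X i, fun v => by simp⟩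

theorem const (c : ℕ) : Term fun _ : Fin k → ℕ => c := ⟨.C c, fun v => by simp⟩

theorem add (hs : Term s) (ht : Term t) : Term fun v => s v + t v := by
  obtain ⟨p, hp⟩ := hs
  obtain ⟨q, hq⟩ := ht
  exact ⟨p + q, fun v => by simp [hp, hq]⟩

theorem mul (hs : Term s) (ht : Term t) : Term fun v => s v * t v := by
  obtain ⟨p, hp⟩ := hs
  obtain ⟨q, hq⟩ := ht
  exact ⟨p * q, fun v => by simp [hp, hq]⟩

theorem comp {t : (Fin m → ℕ) → ℕ} (ht : Term t) {s : Fin m → (Fin k → ℕ) → ℕ}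
    (hs : ∀ i, Term (s i)) : Term fun v => t fun i => s i v := by
  obtain ⟨p, hp⟩ := ht
  choose q hq using hs
  refine ⟨MvPolynomial.bind₁ q p, fun v => ?_⟩
  change t _ = _
  rw [hp, show (fun i => s i v) = fun i => MvPolynomial.eval v (q i) from funext fun i => hq i v]
  exact (MvPolynomial.eval₂Hom_bind₁ (RingHom.id ℕ) v q p).symm

theorem tail (ht : Term t) : Term fun v : Fin (k + 1) → ℕ => t (Fin.tail v) :=
  ht.comp fun i => .var i.succ

theorem polynomial (p : Polynomial ℕ) (ht : Term t) : Term fun v => p.eval (t v) := by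
  induction p using Polynomial.induction_on' with
  | add p q hp hq => simpa using hp.add hq
  | monomial n a =>
    simp only [Polynomial.eval_monomial]
    refine (const a).mul ?_
    induction n with
    | zero => simpa using const 1
    | succ n ih => simpa [pow_succ] using ih.mul ht

end Term

namespace Delta0

variable {k m : ℕ} {P Q : (Fin k → ℕ) → Prop} {s t : (Fin k → ℕ) → ℕ}

theorem of_iff (h : Delta0 P) (hPQ : ∀ v, Q v ↔ P v) : Delta0 Q := by
  rwa [show Q = P from funext fun v => propext (hPQ v)]

theorem eq' (hs : Term s) (ht : Term t) : Delta0 fun v => s v = t v := by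
  obtain ⟨p, hp⟩ := hs
  obtain ⟨q, hq⟩ := ht
  exact (Delta0.eq p q).of_iff fun v => by rw [hp, hq]

theorem const (p : Prop) : Delta0 fun _ : Fin k → ℕ => p := by
  by_cases hp : p
  · exact (eq' (.const 0) (.const 0)).of_iff fun v => by simp [hp]
  · exact (eq' (.const 0) (.const 1)).of_iff fun v => by simp [hp]

theorem or (hP : Delta0 P) (hQ : Delta0 Q) : Delta0 fun v => P v ∨ Q v :=
  (hP.not.and hQ.not).not.of_iff fun v => by tauto

theorem ex {P : (Fin k → ℕ) → ℕ → Prop} (ht : Term t)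
    (hP : Delta0 fun v : Fin (k + 1) → ℕ => P (Fin.tail v) (v 0)) :
    Delta0 fun v => ∃ y, y < t v ∧ P v y := by
  obtain ⟨p, hp⟩ := ht
  exact (Delta0.exLt p hP).of_iff fun v => by simp [hp]

theorem lt (hs : Term s) (ht : Term t) : Delta0 fun v => s v < t v :=
  (ex (P := fun v y => y = s v) ht (eq' (.var 0) hs.tail)).of_iff fun v => by simp

theorem comp {R : (Fin m → ℕ) → Prop} (hR : Delta0 R) :
    ∀ {k : ℕ} {s : Fin m → (Fin k → ℕ) → ℕ}, (∀ i, Term (s i)) →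
      Delta0 fun v => R fun i => s i v := by
  induction hR with
  | eq p q =>
    exact fun hs => eq' (Term.comp ⟨p, fun _ => rfl⟩ hs) (Term.comp ⟨q, fun _ => rfl⟩ hs)
  | not _ ih => exact fun hs => (ih hs).not
  | and _ _ ih1 ih2 => exact fun hs => (ih1 hs).and (ih2 hs)
  | @exLt m p R _ ih =>
    intro k s hs
    refine ex (P := fun v y => R (Fin.cons y fun i => s i v))
      (Term.comp ⟨p, fun _ => rfl⟩ hs) ?_
    have h := ih (s := Fin.cons (fun v : Fin (k + 1) → ℕ => v 0) fun i v => s i (Fin.tail v))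
      (Fin.cases (.var 0) fun i => (hs i).tail)
    refine h.of_iff fun v => ?_
    have : (Fin.cons (v 0) fun i => s i (Fin.tail v) : Fin (m + 1) → ℕ) =
        fun i => (Fin.cons (fun v : Fin (k + 1) → ℕ => v 0) fun i v => s i (Fin.tail v) :
          Fin (m + 1) → (Fin (k + 1) → ℕ) → ℕ) i v := by
      funext i
      induction i using Fin.cases <;> rfl
    rw [this]

theorem tail (h : Delta0 P) : Delta0 fun v : Fin (k + 1) → ℕ => P (Fin.tail v) :=
  h.comp (s := fun i v => v i.succ) fun _ => .var _

/-- Disjunctions whose length is fixed. -/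
theorem exFin (K : ℕ) {P : ℕ → (Fin k → ℕ) → Prop} (h : ∀ t, Delta0 (P t)) :
    Delta0 fun v => ∃ t, t < K ∧ P t v := by
  induction K with
  | zero => exact (const False).of_iff fun v => by simp
  | succ K ih =>
    refine (ih.or (h K)).of_iff fun v => ⟨?_, ?_⟩
    · rintro ⟨t, ht, hP⟩
      rcases Nat.lt_succ_iff_lt_or_eq.1 ht with h | rfl
      · exact .inl ⟨t, h, hP⟩
      · exact .inr hP
    · rintro (⟨t, ht, hP⟩ | hP)
      · exact ⟨t, ht.trans K.lt_succ_self, hP⟩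
      · exact ⟨K, K.lt_succ_self, hP⟩

/-- Division by a constant is definable. -/
theorem divMod {K : ℕ} (hK : 0 < K) {P : ℕ → (Fin k → ℕ) → ℕ → Prop}
    (h : ∀ r, Delta0 fun v : Fin (k + 1) → ℕ => P r (Fin.tail v) (v 0)) (ht : Term t) :
    Delta0 fun v => P (t v % K) v (t v / K) := by
  have h1 : ∀ r, Delta0 fun v => ∃ x, x < t v + 1 ∧ (t v = x * K + r ∧ P r v x) := fun r =>
    ex (ht.add (.const 1))
      ((eq' ht.tail (((Term.var 0).mul (.const K)).add (.const r))).and (h r))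
  refine (exFin K h1).of_iff fun v => ⟨fun hP => ?_, ?_⟩
  · refine ⟨t v % K, Nat.mod_lt _ hK, t v / K, Nat.lt_succ_of_le (Nat.div_le_self _ _), ?_, hP⟩
    rw [mul_comm, Nat.div_add_mod]
  · rintro ⟨r, hr, x, -, hx, hP⟩
    have h2 : t v % K = r := by
      rw [hx, mul_comm, Nat.mul_add_mod, Nat.mod_eq_of_lt hr]
    have h3 : t v / K = x := by
      rw [hx, mul_comm, Nat.mul_add_div hK, Nat.div_eq_of_lt hr, add_zero]
    rw [h2, h3]
    exact hP

/-- Bounded quantification over tuples. -/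
theorem exVec : ∀ {k m : ℕ} {R : (Fin m → ℕ) → (Fin k → ℕ) → Prop} {t : (Fin m → ℕ) → ℕ},
    Term t → Delta0 (fun u : Fin (k + m) → ℕ =>
      R (fun j => u (Fin.natAdd k j)) fun i => u (Fin.castAdd m i)) →
    Delta0 fun u => ∃ v : Fin k → ℕ, (∀ i, v i < t u) ∧ R u v := by
  intro k
  induction k with
  | zero =>
    intro m R t ht h
    refine (h.comp (s := fun i u => u (i.cast (Nat.zero_add m))) fun i => .var _).of_iff
      fun u => ?_
    simp only [IsEmpty.forall_iff, true_and]
    constructor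
    · rintro ⟨v, hv⟩
      convert hv using 2
      simp
    · intro hR
      refine ⟨Fin.elim0, ?_⟩
      convert hR using 2
      simp
  | succ k ih =>
    intro m R t ht h
    have h1 : Delta0 fun u : Fin (m + 1) → ℕ => ∃ v : Fin k → ℕ, (∀ i, v i < t (Fin.tail u)) ∧
        R (Fin.tail u) (Fin.cons (u 0) v) := by
      refine ih (R := fun u v => R (Fin.tail u) (Fin.cons (u 0) v)) ht.tail ?_
      let s : Fin (k + 1 + m) → (Fin (k + (m + 1)) → ℕ) → ℕ :=
        Fin.addCases
          (Fin.cases (fun u => u (Fin.natAdd k 0)) fun i u => u (Fin.castAdd (m + 1) i))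
          fun j u => u (Fin.natAdd k j.succ)
      have hs : ∀ i, Term (s i) := by
        refine Fin.addCases (Fin.cases ?_ fun i => ?_) fun j => ?_ <;>
          simp only [s, Fin.addCases_left, Fin.addCases_right, Fin.cases_zero, Fin.cases_succ] <;>
          exact .var _
      refine (h.comp hs).of_iff fun u => ?_
      have e1 : (fun j => s (Fin.natAdd (k + 1) j) u) =
          Fin.tail fun j => u (Fin.natAdd k j) := by
        funext j
        simp only [s, Fin.addCases_right]
        rfl
      have e2 : (fun i => s (Fin.castAdd m i) u) =
          Fin.cons (u (Fin.natAdd k 0)) fun i => u (Fin.castAdd (m + 1) i) := by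
        funext i
        induction i using Fin.cases <;> simp [s, Fin.addCases_left]
      rw [e1, e2]
    refine (ex (P := fun u y => ∃ v : Fin k → ℕ, (∀ i, v i < t u) ∧ R u (Fin.cons y v))
      ht h1).of_iff fun u => ⟨?_, ?_⟩
    · rintro ⟨v, hv, hR⟩
      exact ⟨v 0, hv 0, Fin.tail v, fun i => hv i.succ, by rwa [Fin.cons_self_tail]⟩
    · rintro ⟨y, hy, v, hv, hR⟩
      exact ⟨Fin.cons y v, Fin.cases hy hv, hR⟩

end Delta0

/-! ### Coding of tuples -/

/-- A polynomial pairing function. -/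
def pairCode (a b : ℕ) : ℕ := (a + b) ^ 2 + a

theorem pairCode_injective {a b a' b' : ℕ} (h : pairCode a b = pairCode a' b') :
    a = a' ∧ b = b' := by
  unfold pairCode at h
  have h1 : a + b = a' + b' := by
    rcases lt_trichotomy (a + b) (a' + b') with hlt | heq | hlt
    · nlinarith
    · exact heq
    · nlinarith
  rw [h1] at h
  omega

/-- The code of a tuple. -/
def code : {k : ℕ} → (Fin k → ℕ) → ℕ
  | 0, _ => 0
  | _ + 1, v => pairCode (v 0) (code (Fin.tail v))

theorem code_cons {k : ℕ} (y : ℕ) (v : Fin k → ℕ) :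
    code (Fin.cons y v : Fin (k + 1) → ℕ) = pairCode y (code v) := by
  simp [code]

theorem code_injective {k : ℕ} {v v' : Fin k → ℕ} (h : code v = code v') : v = v' := by
  induction k with
  | zero => exact Subsingleton.elim _ _
  | succ k ih =>
    obtain ⟨h0, ht⟩ := pairCode_injective h
    rw [← Fin.cons_self_tail v, ← Fin.cons_self_tail v', h0, ih ht]

theorem le_code {k : ℕ} (v : Fin k → ℕ) (i : Fin k) : v i ≤ code v := by
  induction k with
  | zero => exact i.elim0
  | succ k ih =>
    have h : code v = (v 0 + code (Fin.tail v)) ^ 2 + v 0 := rfl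
    induction i using Fin.cases with
    | zero => rw [h]; omega
    | succ i =>
      have h1 := ih (Fin.tail v) i
      have h2 : v i.succ = Fin.tail v i := rfl
      rw [h, h2]
      nlinarith [Nat.zero_le (v 0)]

theorem Term.pairCode {k : ℕ} {s t : (Fin k → ℕ) → ℕ} (hs : Term s) (ht : Term t) :
    Term fun v => pairCode (s v) (t v) := by
  simp only [FuzzyDL.pairCode, pow_two]
  exact ((hs.add ht).mul (hs.add ht)).add hs

theorem Term.code {k : ℕ} : Term (code : (Fin k → ℕ) → ℕ) := by
  induction k with
  | zero => exact .const 0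
  | succ k ih => exact .pairCode (.var 0) ih.tail

/-- A bound for the codes of tuples with entries below `B`. -/
noncomputable def codeBound (B : Polynomial ℕ) : ℕ → Polynomial ℕ
  | 0 => 1
  | k + 1 => (B + codeBound B k) ^ 2 + B

theorem code_lt {B : Polynomial ℕ} {n k : ℕ} {v : Fin k → ℕ} (h : ∀ i, v i < B.eval n) :
    code v < (codeBound B k).eval n := by
  induction k with
  | zero => simp [code, codeBound]
  | succ k ih =>
    have h0 := h 0
    have h1 := ih (v := Fin.tail v) fun i => h i.succ
    have h2 : code v = (v 0 + code (Fin.tail v)) ^ 2 + v 0 := rfl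
    simp only [codeBound, Polynomial.eval_add, Polynomial.eval_pow]
    rw [h2]
    have h3 : (v 0 + code (Fin.tail v)) ^ 2 ≤
        (B.eval n + (codeBound B k).eval n) ^ 2 := Nat.pow_le_pow_left (by omega) 2
    omega

/-- Decoding of tuples is definable. -/
theorem Delta0.decode {k m : ℕ} {R : (Fin m → ℕ) → (Fin k → ℕ) → Prop} {t : (Fin m → ℕ) → ℕ}
    (ht : Term t) (h : Delta0 fun u : Fin (k + m) → ℕ =>
      R (fun j => u (Fin.natAdd k j)) fun i => u (Fin.castAdd m i)) :
    Delta0 fun u => ∃ v : Fin k → ℕ, t u = code v ∧ R u v := by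
  refine (exVec (R := fun u v => t u = code v ∧ R u v) (ht.add (.const 1))
    (.and (.eq' (ht.comp fun j => .var _) (Term.code.comp fun i => .var _)) h)).of_iff
    fun u => ⟨?_, ?_⟩
  · rintro ⟨v, hv, hR⟩
    exact ⟨v, fun i => by rw [hv]; exact Nat.lt_succ_of_le (le_code v i), hv, hR⟩
  · rintro ⟨v, -, h⟩
    exact ⟨v, h⟩

/-! ### Layered circuits -/

section Layers

variable {S : Type}

/-- The kinds of layers of a layered circuit. -/
inductive LayerKind (S : Type) where
  | lit (c : S)
  | conj
  | disj

/-- A layer of a layered circuit: it has one gate for each number `x`; on words of length `n`, the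
gate `x` is fed by the gate `y` of the layer `t` if `wire t n x y`. -/
structure Layer (S : Type) where
  kind : LayerKind S
  wire : ℕ → ℕ → ℕ → ℕ → Prop
  delta0 : ∀ t, Delta0 fun v : Fin 3 → ℕ => wire t (v 0) (v 1) (v 2)

/-- The value of the gate `x` in the `t`-th layer, when each layer is cut off at the number `X`. -/
def layerVal (π : ℕ → Layer S) (X : ℕ) (w : List S) (t x : ℕ) : Prop :=
  match (π t).kind with
  | .lit c => w[x]? = some c
  | .conj => ∀ t', (_ : t' < t) → ∀ x', x' < X → (π t).wire t' w.length x x' →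
      layerVal π X w t' x'
  | .disj => ∃ t', ∃ _ : t' < t, ∃ x', x' < X ∧ (π t).wire t' w.length x x' ∧
      layerVal π X w t' x'
termination_by t

theorem layerVal_lit {π : ℕ → Layer S} {X : ℕ} {w : List S} {t x : ℕ} {c : S}
    (h : (π t).kind = .lit c) : layerVal π X w t x ↔ w[x]? = some c := by
  rw [layerVal, h]

theorem layerVal_conj {π : ℕ → Layer S} {X : ℕ} {w : List S} {t x : ℕ}
    (h : (π t).kind = .conj) : layerVal π X w t x ↔
      ∀ t' < t, ∀ x' < X, (π t).wire t' w.length x x' → layerVal π X w t' x' := by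
  rw [layerVal, h]

theorem layerVal_disj {π : ℕ → Layer S} {X : ℕ} {w : List S} {t x : ℕ}
    (h : (π t).kind = .disj) : layerVal π X w t x ↔
      ∃ t' < t, ∃ x' < X, (π t).wire t' w.length x x' ∧ layerVal π X w t' x' := by
  rw [layerVal, h]
  simp

theorem layerVal_congr {π π' : ℕ → Layer S} {K : ℕ} (h : ∀ t < K, π' t = π t) {X : ℕ}
    {w : List S} {t : ℕ} (ht : t < K) (x : ℕ) :
    layerVal π' X w t x ↔ layerVal π X w t x := by
  induction t using Nat.strong_induction_on generalizing x with
  | _ t ih =>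
    cases hk : (π t).kind with
    | lit c => rw [layerVal_lit hk, layerVal_lit (by rw [h t ht]; exact hk)]
    | conj =>
      rw [layerVal_conj hk, layerVal_conj (by rw [h t ht]; exact hk), h t ht]
      exact forall₄_congr fun t' ht' x' _ => by rw [ih t' ht' (ht'.trans ht)]
    | disj =>
      rw [layerVal_disj hk, layerVal_disj (by rw [h t ht]; exact hk), h t ht]
      refine exists_congr fun t' => and_congr_right fun ht' => exists_congr fun x' => ?_
      rw [ih t' ht' (ht'.trans ht)]

/-- The gate of a circuit that realizes the `x`-th gate of a layer of the given kind. A literal at a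
position beyond the end of the word is false, which an empty disjunction expresses. -/
def LayerKind.gate (n x : ℕ) : LayerKind S → Gate S n
  | .lit c => if h : x < n then .literal ⟨x, h⟩ c else .or
  | .conj => .and
  | .disj => .or

/-- Whether the gates of a layer are literals. -/
def LayerKind.isLit : LayerKind S → Prop
  | .lit _ => True
  | _ => False

variable {G : Type}

/-- The circuit family given by the first `K` layers, where the wires into literal layers are
dropped; `x * K + t` is the number of the `x`-th gate
of the `t`-th layer, and the `i`-th output letter is `c` if the gate `code ![i]` of the layer `o c`
has the value true. -/
noncomputable def layerCircuit (π : ℕ → Layer S) (K : ℕ) (X L : Polynomial ℕ) (o : G → ℕ)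
    (ho : ∀ c, o c < K) (hL : ∀ n, ∀ i < L.eval n, code ![i] < X.eval n) :
    CircuitFamily S G := fun n =>
  { size := X.eval n * K
    gate := fun g => (π (g.val % K)).kind.gate n (g.val / K)
    wire := fun g h => (¬ (π (g.val % K)).kind.isLit ∧ h.val % K < g.val % K) ∧
      (π (g.val % K)).wire (h.val % K) n (g.val / K) (h.val / K)
    level := fun g => g.val % K
    level_lt := fun _ _ h => h.1.2
    outLen := L.eval n
    out := fun i c => ⟨code ![i.val] * K + o c, by
      have h1 := hL n i i.isLt
      have h2 := ho c
      calc code ![i.val] * K + o c < code ![i.val] * K + K := by omega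
        _ = (code ![i.val] + 1) * K := by ring
        _ ≤ _ := Nat.mul_le_mul_right _ h1⟩ }

variable {π : ℕ → Layer S} {K : ℕ} {X L : Polynomial ℕ} {o : G → ℕ}
    {ho : ∀ c, o c < K} {hL : ∀ n, ∀ i < L.eval n, code ![i] < X.eval n}

theorem mul_add_mod_div {x K t : ℕ} (ht : t < K) : (x * K + t) % K = t ∧ (x * K + t) / K = x := by
  rw [mul_comm]
  constructor
  · rw [Nat.mul_add_mod, Nat.mod_eq_of_lt ht]
  · rw [Nat.mul_add_div (by omega), Nat.div_eq_of_lt ht, add_zero]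

theorem layerCircuit_eval (hK : 0 < K) (w : List S)
    (g : Fin ((layerCircuit π K X L o ho hL w.length).size)) :
    (layerCircuit π K X L o ho hL w.length).eval w.get g ↔
      layerVal π (X.eval w.length) w (g.val % K) (g.val / K) := by
  generalize ht : g.val % K = t
  induction t using Nat.strong_induction_on generalizing g with
  | _ t ih =>
    have hgt : t < K := ht ▸ Nat.mod_lt _ hK
    have hgate : (layerCircuit π K X L o ho hL w.length).gate g =
        (π t).kind.gate w.length (g.val / K) := by rw [← ht]; rfl
    have hsize : (layerCircuit π K X L o ho hL w.length).size = X.eval w.length * K := rfl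
    have hwire : ∀ h : Fin (layerCircuit π K X L o ho hL w.length).size,
        (layerCircuit π K X L o ho hL w.length).wire g h ↔ (¬ (π t).kind.isLit ∧ h.val % K < t) ∧
          (π t).wire (h.val % K) w.length (g.val / K) (h.val / K) := by
      intro h; rw [← ht]; rfl
    have hnum : ∀ t' < t, ∀ x' < X.eval w.length,
        x' * K + t' < (layerCircuit π K X L o ho hL w.length).size := by
      intro t' ht' x' hx'
      rw [hsize]
      calc x' * K + t' < x' * K + K := by omega
        _ = (x' + 1) * K := by ring
        _ ≤ _ := Nat.mul_le_mul_right _ hx'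
    have hdiv : ∀ h : Fin (layerCircuit π K X L o ho hL w.length).size,
        h.val / K < X.eval w.length := fun h =>
      Nat.div_lt_of_lt_mul (by rw [mul_comm]; exact h.isLt)
    rw [Circuit.eval]
    cases hk : (π t).kind with
    | lit c =>
      rw [layerVal_lit hk, hgate, hk]
      by_cases hx : g.val / K < w.length
      · simp only [LayerKind.gate, dif_pos hx, List.get_eq_getElem]
        rw [List.getElem?_eq_getElem hx, Option.some_inj]
      · simp only [LayerKind.gate, dif_neg hx]
        rw [List.getElem?_eq_none (not_lt.1 hx)]
        simp only [hwire, hk, LayerKind.isLit]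
        simp
    | conj =>
      rw [layerVal_conj hk, hgate, hk]
      simp only [LayerKind.gate]
      constructor
      · intro H t' ht' x' hx' hw
        obtain ⟨h1, h2⟩ := mul_add_mod_div (x := x') (ht'.trans hgt)
        have := H ⟨x' * K + t', hnum t' ht' x' hx'⟩
          ((hwire _).2 (by simp only [h1, h2, hk, LayerKind.isLit]; exact ⟨⟨id, ht'⟩, hw⟩))
        rw [ih t' ht' _ h1] at this
        simpa only [h2] using this
      · intro H h hw
        have hw' := (hwire h).1 hw
        rw [ih _ hw'.1.2 h rfl]
        exact H _ hw'.1.2 _ (hdiv h) hw'.2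
    | disj =>
      rw [layerVal_disj hk, hgate, hk]
      simp only [LayerKind.gate]
      constructor
      · rintro ⟨h, hw, hv⟩
        have hw' := (hwire h).1 hw
        rw [ih _ hw'.1.2 h rfl] at hv
        exact ⟨_, hw'.1.2, _, hdiv h, hw'.2, hv⟩
      · rintro ⟨t', ht', x', hx', hw, hv⟩
        obtain ⟨h1, h2⟩ := mul_add_mod_div (x := x') (ht'.trans hgt)
        refine ⟨⟨x' * K + t', hnum t' ht' x' hx'⟩,
          (hwire _).2 (by simp only [h1, h2, hk, LayerKind.isLit]; exact ⟨⟨id, ht'⟩, hw⟩), ?_⟩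
        rw [ih t' ht' _ h1]
        simpa only [h2] using hv

theorem layerCircuit_isAC0 (hK : 0 < K) : (layerCircuit π K X L o ho hL).IsAC0 := by
  have hsz : ∀ {k : ℕ} {s t : (Fin k → ℕ) → ℕ}, Term s → Term t →
      Delta0 fun v => t v < X.eval (s v) * K := fun hs ht =>
    .lt ht ((Term.polynomial X hs).mul (.const K))
  have hgate : ∀ n (g : Fin (layerCircuit π K X L o ho hL n).size),
      (layerCircuit π K X L o ho hL n).gate g = (π (g.val % K)).kind.gate n (g.val / K) :=
    fun _ _ => rfl
  refine ⟨⟨K, fun n g => (Nat.mod_lt _ hK).le⟩, ⟨X * Polynomial.C K + L, fun n => ?_⟩, ?_⟩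
  · constructor
    · change X.eval n * K ≤ _
      simp
    · change L.eval n ≤ _
      simp
  · constructor
    · exact hsz (.var 0) (.var 1)
    · intro c
      refine ((hsz (.var 0) (.var 1)).and ((Delta0.lt (.var 2) (.var 0)).and
        (Delta0.divMod hK (P := fun r v x => (π r).kind = .lit c ∧ x = v 2)
          (fun r => (Delta0.const _).and (.eq' (.var 0) (.var 3))) (.var 1)))).of_iff
        fun v => ?_
      refine ⟨fun ⟨hg, hi, h⟩ => ⟨hg, hi, ?_⟩, fun ⟨hg, hi, h1, h2⟩ => ⟨hg, hi, ?_⟩⟩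
      · rw [hgate] at h
        cases hk : (π (v 1 % K)).kind with
        | lit c' =>
          rw [hk] at h
          simp only [LayerKind.gate] at h
          split_ifs at h with hx
          · simp only [Gate.literal.injEq, Fin.mk.injEq] at h
            exact ⟨by rw [h.2], h.1⟩
        | conj => rw [hk] at h; simp [LayerKind.gate] at h
        | disj => rw [hk] at h; simp [LayerKind.gate] at h
      · rw [hgate]
        simp only [h1, LayerKind.gate, h2, dif_pos hi]
    · refine ((hsz (.var 0) (.var 1)).and
        (Delta0.divMod hK (P := fun r _ _ => (π r).kind = .conj)
          (fun r => Delta0.const _) (.var 1))).of_iff fun v => ?_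
      refine ⟨fun ⟨hg, h⟩ => ⟨hg, ?_⟩, fun ⟨hg, h⟩ => ⟨hg, ?_⟩⟩
      · rw [hgate] at h
        cases hk : (π (v 1 % K)).kind with
        | lit c' =>
          rw [hk] at h
          simp only [LayerKind.gate] at h
          split_ifs at h
        | conj => rfl
        | disj => rw [hk] at h; simp [LayerKind.gate] at h
      · rw [hgate]
        simp only [h, LayerKind.gate]
    · refine ((hsz (.var 0) (.var 1)).and
        (Delta0.divMod hK (P := fun r v x => (π r).kind = .disj ∨
            (π r).kind.isLit ∧ ¬ x < v 0)
          (fun r => (Delta0.const _).or ((Delta0.const _).and (Delta0.lt (.var 0) (.var 1)).not))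
          (.var 1))).of_iff fun v => ?_
      refine ⟨fun ⟨hg, h⟩ => ⟨hg, ?_⟩, fun ⟨hg, h⟩ => ⟨hg, ?_⟩⟩
      · rw [hgate] at h
        cases hk : (π (v 1 % K)).kind with
        | lit c' =>
          rw [hk] at h
          simp only [LayerKind.gate] at h
          split_ifs at h with hx
          exact .inr ⟨trivial, hx⟩
        | conj => rw [hk] at h; simp [LayerKind.gate] at h
        | disj => exact .inl rfl
      · rw [hgate]
        cases hk : (π (v 1 % K)).kind with
        | lit c' =>
          rw [hk] at h
          simp only [LayerKind.gate]
          rw [dif_neg]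
          exact (h.resolve_left (by simp)).2
        | conj => rw [hk] at h; simp [LayerKind.isLit] at h
        | disj => rfl
    · refine ((hsz (.var 0) (.var 1)).and ((hsz (.var 0) (.var 2)).and
        (Delta0.divMod hK (P := fun r v x => (¬ (π r).kind.isLit ∧ v 2 % K < r) ∧
            (π r).wire (v 2 % K) (v 0) x (v 2 / K)) (fun r => ?_) (.var 1)))).of_iff fun v => ?_
      · exact Delta0.divMod hK (P := fun r' v x' => (¬ (π r).kind.isLit ∧ r' < r) ∧
            (π r).wire r' (v 1) (v 0) x')
          (fun r' => (Delta0.const _).and (((π r).delta0 r').comp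
            (s := ![fun v => v 2, fun v => v 1, fun v => v 0]) (by
              intro i; fin_cases i <;> exact .var _))) (.var 3)
      · exact ⟨fun ⟨hg, hh, h⟩ => ⟨hg, hh, h⟩, fun ⟨hg, hh, h⟩ => ⟨hg, hh, h⟩⟩
    · exact Delta0.lt (.var 1) (.polynomial L (.var 0))
    · intro c
      refine ((Delta0.lt (.var 1) (.polynomial L (.var 0))).and (Delta0.eq'
        (((Term.code (k := 1)).comp (s := ![fun v => v 1]) (by
          intro i; fin_cases i; exact .var _) |>.mul (.const K)).add (.const (o c)))
        (.var 2))).of_iff fun v => ?_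
      have e : ∀ y : Fin 3 → ℕ, (fun i => (![fun v : Fin 3 → ℕ => v 1] : Fin 1 → _) i y) =
          ![y 1] := by
        intro y; funext i; fin_cases i; rfl
      simp only [e]
      exact ⟨fun ⟨hi, h⟩ => ⟨hi, h⟩, fun ⟨hi, h⟩ => ⟨hi, h⟩⟩

theorem layerCircuit_outputs (hK : 0 < K) (w : List S) (y : List G)
    (hy : y.length ≤ L.eval w.length)
    (h : ∀ i < L.eval w.length, ∀ c,
      layerVal π (X.eval w.length) w (o c) (code ![i]) ↔ y[i]? = some c) :
    (layerCircuit π K X L o ho hL).Outputs w y := by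
  refine ⟨hy, fun i c => ?_⟩
  rw [layerCircuit_eval hK, ← h i i.isLt c]
  obtain ⟨h1, h2⟩ := mul_add_mod_div (x := code ![i.val]) (ho c)
  change layerVal π _ w ((code ![i.val] * K + o c) % K) ((code ![i.val] * K + o c) / K) ↔ _
  rw [h1, h2]

end Layers

/-! ### First-order formulas define uniform AC⁰ families -/

section FirstOrder

variable {S : Type}

/-- First-order definable relations between words and tuples of numbers: the letters of the word
can be tested, arithmetic is available, and quantifiers range over numbers bounded by the length of
the word plus a constant. -/
inductive FO : {k : ℕ} → (List S → (Fin k → ℕ) → Prop) → Prop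
  | rel {k : ℕ} {R : ℕ → (Fin k → ℕ) → Prop} :
      Delta0 (fun v : Fin (k + 1) → ℕ => R (v 0) (Fin.tail v)) → FO fun w v => R w.length v
  | letter {k : ℕ} (i : Fin k) (c : S) : FO fun w v => w[v i]? = some c
  | not {k : ℕ} {P : List S → (Fin k → ℕ) → Prop} : FO P → FO fun w v => ¬ P w v
  | and {k : ℕ} {P Q : List S → (Fin k → ℕ) → Prop} : FO P → FO Q → FO fun w v => P w v ∧ Q w v
  | ex {k : ℕ} (b : ℕ) {P : List S → (Fin k → ℕ) → ℕ → Prop} :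
      FO (fun w (v : Fin (k + 1) → ℕ) => P w (Fin.tail v) (v 0)) →
      FO fun w v => ∃ y, y < w.length + b ∧ P w v y

/-- The first `K'` layers of `π'` extend the first `K` layers of `π`. -/
def Extends (π : ℕ → Layer S) (K : ℕ) (π' : ℕ → Layer S) (K' : ℕ) : Prop :=
  K ≤ K' ∧ ∀ t < K, π' t = π t

theorem Extends.trans {π₁ π₂ π₃ : ℕ → Layer S} {K₁ K₂ K₃ : ℕ} (h : Extends π₁ K₁ π₂ K₂)
    (h' : Extends π₂ K₂ π₃ K₃) : Extends π₁ K₁ π₃ K₃ :=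
  ⟨h.1.trans h'.1, fun t ht => (h'.2 t (ht.trans_le h.1)).trans (h.2 t ht)⟩

/-- The first `K` layers provide all literals and the constant true. -/
def Ready (π : ℕ → Layer S) (K : ℕ) : Prop :=
  (∀ c, ∃ t < K, (π t).kind = .lit c) ∧
    ∃ t < K, (π t).kind = .conj ∧ ∀ t' n x x', ¬ (π t).wire t' n x x'

theorem Ready.extends {π π' : ℕ → Layer S} {K K' : ℕ} (h : Ready π K)
    (hE : Extends π K π' K') : Ready π' K' := by
  refine ⟨fun c => ?_, ?_⟩
  · obtain ⟨t, ht, hk⟩ := h.1 c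
    exact ⟨t, ht.trans_le hE.1, by rw [hE.2 t ht, hk]⟩
  · obtain ⟨t, ht, hk⟩ := h.2
    exact ⟨t, ht.trans_le hE.1, by rw [hE.2 t ht]; exact hk⟩

/-- The layer `t` computes `P` on codes of tuples with entries below `B`. -/
def Realizes (π : ℕ → Layer S) (X B : Polynomial ℕ) (t : ℕ) {k : ℕ}
    (P : List S → (Fin k → ℕ) → Prop) : Prop :=
  ∀ w v, (∀ i, v i < B.eval w.length) →
    (layerVal π (X.eval w.length) w t (code v) ↔ P w v)

theorem Realizes.extends {π π' : ℕ → Layer S} {K K' : ℕ} {X B : Polynomial ℕ} {t k : ℕ}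
    {P : List S → (Fin k → ℕ) → Prop} (h : Realizes π X B t P) (ht : t < K)
    (hE : Extends π K π' K') : Realizes π' X B t P := fun w v hv => by
  rw [layerVal_congr hE.2 ht, h w v hv]

/-- A disjunctive and a conjunctive layer can be added. -/
theorem exists_extends (π : ℕ → Layer S) (K : ℕ) {W W' : ℕ → ℕ → ℕ → ℕ → Prop}
    (hW : ∀ t, Delta0 fun v : Fin 3 → ℕ => W t (v 0) (v 1) (v 2))
    (hW' : ∀ t, Delta0 fun v : Fin 3 → ℕ => W' t (v 0) (v 1) (v 2)) :
    ∃ π', Extends π K π' (K + 2) ∧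
      (∀ X w x, layerVal π' X w K x ↔
        ∃ t < K, ∃ y < X, W t w.length x y ∧ layerVal π X w t y) ∧
      ∀ X w x, layerVal π' X w (K + 1) x ↔
        ∀ t < K, ∀ y < X, W' t w.length x y → layerVal π X w t y := by
  let π' : ℕ → Layer S := fun t =>
    if t < K then π t
    else if t = K then ⟨.disj, W, hW⟩
    else ⟨.conj, fun t n x y => t < K ∧ W' t n x y, fun t => (Delta0.const _).and (hW' t)⟩
  have h0 : ∀ t < K, π' t = π t := fun t ht => by simp only [π', if_pos ht]
  have h1 : π' K = ⟨.disj, W, hW⟩ := by simp [π']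
  have h2 : π' (K + 1) = ⟨.conj, fun t n x y => t < K ∧ W' t n x y,
      fun t => (Delta0.const _).and (hW' t)⟩ := by simp [π']
  refine ⟨π', ⟨Nat.le_add_right _ _, h0⟩, fun X w x => ?_, fun X w x => ?_⟩
  · rw [layerVal_disj (by rw [h1]), h1]
    refine exists_congr fun t => and_congr_right fun ht => ?_
    simp only [layerVal_congr h0 ht]
  · rw [layerVal_conj (by rw [h2]), h2]
    constructor
    · intro H t ht y hy hw
      exact (layerVal_congr h0 ht y).1 (H t (ht.trans K.lt_succ_self) y hy ⟨ht, hw⟩)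
    · intro H t _ y hy hw
      exact (layerVal_congr h0 hw.1 y).2 (H t hw.1 y hy hw.2)

/-- A `Δ₀` condition on the tuple coded by the number of the upper gate defines wires. -/
theorem delta0_decode_pair {k : ℕ} {R : ℕ → ℕ → (Fin k → ℕ) → Prop}
    (h : Delta0 fun u : Fin (k + 3) → ℕ =>
      R (u (Fin.natAdd k 0)) (u (Fin.natAdd k 2)) fun i => u (Fin.castAdd 3 i)) :
    Delta0 fun v : Fin 3 → ℕ => ∃ u : Fin k → ℕ, v 1 = code u ∧ R (v 0) (v 2) u :=
  Delta0.decode (R := fun v u => R (v 0) (v 2) u) (.var 1) h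

/-- First-order definable relations are computed by layered circuits, together with their
complements, since there are no negation gates. The layers extend given ones, which may serve other
formulas; the width `X` of the layers can be any sufficiently large polynomial. -/
theorem FO.realize {k : ℕ} {P : List S → (Fin k → ℕ) → Prop} (h : FO P) :
    ∀ B : Polynomial ℕ, ∃ X₀ : Polynomial ℕ, ∀ X : Polynomial ℕ,
      (∀ n, X₀.eval n ≤ X.eval n) → ∀ (π : ℕ → Layer S) (K : ℕ), Ready π K →
        ∃ π' K', Extends π K π' K' ∧ (∃ t < K', Realizes π' X B t P) ∧
          ∃ t < K', Realizes π' X B t fun w v => ¬ P w v := by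
  induction h with
  | @rel k R hR =>
    intro B
    refine ⟨1, fun X hX π K hπ => ?_⟩
    have hX : ∀ n, 0 < X.eval n := fun n => by have := hX n; simp at this; omega
    obtain ⟨t₁, ht₁, hk, hw⟩ := hπ.2
    have htrue : ∀ X w x, layerVal π X w t₁ x := fun X w x => by
      rw [layerVal_conj hk]
      exact fun t' _ x' _ h => absurd h (hw _ _ _ _)
    -- `R` is computed by a disjunction with a wire to a true gate if `R` holds.
    have hdec : ∀ {R' : ℕ → (Fin k → ℕ) → Prop},
        Delta0 (fun v : Fin (k + 1) → ℕ => R' (v 0) (Fin.tail v)) → ∀ t,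
        Delta0 fun v : Fin 3 → ℕ =>
          t = t₁ ∧ ∃ u : Fin k → ℕ, v 1 = code u ∧ (v 2 = 0 ∧ R' (v 0) u) := by
      intro R' hR' t
      refine (Delta0.const _).and (delta0_decode_pair (R := fun n y u => y = 0 ∧ R' n u)
        ((Delta0.eq' (.var _) (.const 0)).and ?_))
      refine (hR'.comp (s := Fin.cons (fun u : Fin (k + 3) → ℕ => u (Fin.natAdd k 0))
        fun i u => u (Fin.castAdd 3 i)) ?_).of_iff fun u => ?_
      · exact Fin.cases (.var _) fun i => .var _
      · exact Iff.rfl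
    have hval : ∀ {R' : ℕ → (Fin k → ℕ) → Prop} (w : List S) (v : Fin k → ℕ),
        (∃ t < K, ∃ y < X.eval w.length, (t = t₁ ∧ ∃ u : Fin k → ℕ, code v = code u ∧
          (y = 0 ∧ R' w.length u)) ∧ layerVal π (X.eval w.length) w t y) ↔ R' w.length v := by
      intro R' w v
      constructor
      · rintro ⟨_, _, _, _, ⟨_, u, hu, _, hR⟩, _⟩
        rwa [code_injective hu]
      · exact fun hR => ⟨t₁, ht₁, 0, hX _, ⟨rfl, v, rfl, rfl, hR⟩, htrue _ _ _⟩
    obtain ⟨π₁, hE₁, hd₁, -⟩ := exists_extends π K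
      (W := fun t n x y => t = t₁ ∧ ∃ u : Fin k → ℕ, x = code u ∧ (y = 0 ∧ R n u))
      (W' := fun _ _ _ _ => True) (hdec hR) fun _ => .const _
    obtain ⟨π₂, hE₂, hd₂, -⟩ := exists_extends π₁ (K + 2)
      (W := fun t n x y => t = t₁ ∧ ∃ u : Fin k → ℕ, x = code u ∧ (y = 0 ∧ ¬ R n u))
      (W' := fun _ _ _ _ => True) (hdec (R' := fun n v => ¬ R n v) hR.not) fun _ => .const _
    have hK : K < K + 2 := by omega
    refine ⟨π₂, K + 2 + 2, hE₁.trans hE₂, ⟨K, by omega, ?_⟩, K + 2, by omega, ?_⟩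
    · refine Realizes.extends (fun w v _ => ?_) hK hE₂
      rw [hd₁]
      exact hval w v
    · intro w v _
      rw [hd₂]
      constructor
      · rintro ⟨_, _, _, _, ⟨_, u, hu, _, hR⟩, _⟩
        rwa [code_injective hu]
      · refine fun hR => ⟨t₁, by omega, 0, hX _, ⟨rfl, v, rfl, rfl, hR⟩, ?_⟩
        rw [layerVal_congr hE₁.2 ht₁]
        exact htrue _ _ _
  | @letter k i c =>
    intro B
    refine ⟨B + 1, fun X hX π K hπ => ?_⟩
    have hX : ∀ n, B.eval n < X.eval n := fun n => by
      have := hX n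
      simp only [Polynomial.eval_add, Polynomial.eval_one] at this
      omega
    obtain ⟨t₁, ht₁, hk, hw⟩ := hπ.2
    choose tl htl hkl using hπ.1
    have htrue : ∀ X w x, layerVal π X w t₁ x := fun X w x => by
      rw [layerVal_conj hk]
      exact fun t' _ x' _ h => absurd h (hw _ _ _ _)
    have hpos : ∀ (p : ℕ → Prop) (t : ℕ), Delta0 fun v : Fin 3 → ℕ =>
        p t ∧ ∃ u : Fin k → ℕ, v 1 = code u ∧ v 2 = u i := fun p t =>
      (Delta0.const _).and (delta0_decode_pair (R := fun n y u => y = u i)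
        (.eq' (.var _) (.var _)))
    -- The negation of a literal: another letter, or a position beyond the end of the word.
    have hneg : ∀ t : ℕ, Delta0 fun v : Fin 3 → ℕ =>
        ((∃ c', c' ≠ c ∧ t = tl c') ∧ ∃ u : Fin k → ℕ, v 1 = code u ∧ v 2 = u i) ∨
        t = t₁ ∧ ∃ u : Fin k → ℕ, v 1 = code u ∧ (v 2 = 0 ∧ ¬ u i < v 0) := fun t =>
      (hpos (fun t => ∃ c', c' ≠ c ∧ t = tl c') t).or ((Delta0.const _).and
        (delta0_decode_pair (R := fun n y u => y = 0 ∧ ¬ u i < n)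
          (.and (.eq' (.var _) (.const 0)) (Delta0.lt (.var _) (.var _)).not)))
    obtain ⟨π₁, hE₁, hd₁, -⟩ := exists_extends π K
      (W := fun t _ x y => t = tl c ∧ ∃ u : Fin k → ℕ, x = code u ∧ y = u i)
      (W' := fun _ _ _ _ => True) (hpos fun t => t = tl c) fun _ => .const _
    obtain ⟨π₂, hE₂, hd₂, -⟩ := exists_extends π₁ (K + 2)
      (W := fun t n x y =>
        ((∃ c', c' ≠ c ∧ t = tl c') ∧ ∃ u : Fin k → ℕ, x = code u ∧ y = u i) ∨
        t = t₁ ∧ ∃ u : Fin k → ℕ, x = code u ∧ (y = 0 ∧ ¬ u i < n))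
      (W' := fun _ _ _ _ => True) hneg fun _ => .const _
    have hK : K < K + 2 := by omega
    refine ⟨π₂, K + 2 + 2, hE₁.trans hE₂, ⟨K, by omega, ?_⟩, K + 2, by omega, ?_⟩
    · refine Realizes.extends (fun w v hv => ?_) hK hE₂
      rw [hd₁]
      constructor
      · rintro ⟨_, _, _, _, ⟨rfl, u, hu, rfl⟩, h⟩
        rw [layerVal_lit (hkl c)] at h
        rwa [code_injective hu]
      · intro h
        refine ⟨tl c, htl c, v i, (hv i).trans (hX _), ⟨rfl, v, rfl, rfl⟩, ?_⟩
        rwa [layerVal_lit (hkl c)]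
    · intro w v hv
      rw [hd₂]
      beta_reduce
      constructor
      · rintro ⟨_, _, _, _, ⟨⟨c', hc', rfl⟩, u, hu, rfl⟩ | ⟨_, u, hu, _, h⟩, h'⟩
        · rw [layerVal_congr hE₁.2 (htl c'), layerVal_lit (hkl c')] at h'
          rw [code_injective hu, h', Option.some_inj]
          exact hc'
        · rw [code_injective hu, List.getElem?_eq_none (not_lt.1 h)]
          simp
      · intro h
        by_cases hn : v i < w.length
        · rw [List.getElem?_eq_getElem hn, Option.some_inj] at h
          refine ⟨tl w[v i], (htl _).trans hK, v i, (hv i).trans (hX _),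
            .inl ⟨⟨_, h, rfl⟩, v, rfl, rfl⟩, ?_⟩
          rw [layerVal_congr hE₁.2 (htl _), layerVal_lit (hkl _)]
          exact List.getElem?_eq_getElem hn
        · refine ⟨t₁, ht₁.trans hK, 0, (Nat.zero_le _).trans_lt (hX _),
            .inr ⟨rfl, v, rfl, rfl, hn⟩, ?_⟩
          rw [layerVal_congr hE₁.2 ht₁]
          exact htrue _ _ _
  | @not k P _ ih =>
    intro B
    obtain ⟨X₀, h⟩ := ih B
    refine ⟨X₀, fun X hX π K hπ => ?_⟩
    obtain ⟨π', K', hE, ⟨t, ht, hp⟩, hn⟩ := h X hX π K hπ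
    exact ⟨π', K', hE, hn, t, ht, fun w v hv => by
      rw [hp w v hv]
      exact not_not.symm⟩
  | @and k P Q _ _ ih₁ ih₂ =>
    intro B
    obtain ⟨X₁, h₁⟩ := ih₁ B
    obtain ⟨X₂, h₂⟩ := ih₂ B
    refine ⟨X₁ + X₂ + codeBound B k, fun X hX π K hπ => ?_⟩
    simp only [Polynomial.eval_add] at hX
    obtain ⟨π₁, K₁, hE₁, ⟨p₁, hp₁, hP₁⟩, n₁, hn₁, hN₁⟩ :=
      h₁ X (fun n => by have := hX n; omega) π K hπ
    obtain ⟨π₂, K₂, hE₂, ⟨p₂, hp₂, hP₂⟩, n₂, hn₂, hN₂⟩ :=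
      h₂ X (fun n => by have := hX n; omega) π₁ K₁ (hπ.extends hE₁)
    replace hP₁ := hP₁.extends hp₁ hE₂
    replace hN₁ := hN₁.extends hn₁ hE₂
    have hD : ∀ (p : ℕ → Prop) (t : ℕ), Delta0 fun v : Fin 3 → ℕ => p t ∧ v 2 = v 1 :=
      fun p t => (Delta0.const _).and (.eq' (.var _) (.var _))
    obtain ⟨π₃, hE₃, hd, hc⟩ := exists_extends π₂ K₂
      (W := fun t _ x y => (t = n₁ ∨ t = n₂) ∧ y = x)
      (W' := fun t _ x y => (t = p₁ ∨ t = p₂) ∧ y = x) (hD fun t => t = n₁ ∨ t = n₂)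
      (hD fun t => t = p₁ ∨ t = p₂)
    have hlt : ∀ (w : List S) (v : Fin k → ℕ), (∀ i, v i < B.eval w.length) →
        code v < X.eval w.length := fun w v hv =>
      (code_lt hv).trans_le (by have := hX w.length; omega)
    have hp₁' := hp₁.trans_le hE₂.1
    have hn₁' := hn₁.trans_le hE₂.1
    refine ⟨π₃, K₂ + 2, hE₁.trans (hE₂.trans hE₃), ⟨K₂ + 1, by omega, fun w v hv => ?_⟩, K₂,
      by omega, fun w v hv => ?_⟩
    · rw [hc]
      beta_reduce
      rw [← hP₁ w v hv, ← hP₂ w v hv]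
      constructor
      · exact fun H => ⟨H p₁ hp₁' _ (hlt w v hv) ⟨.inl rfl, rfl⟩,
          H p₂ hp₂ _ (hlt w v hv) ⟨.inr rfl, rfl⟩⟩
      · rintro ⟨H₁, H₂⟩ t _ _ _ ⟨rfl | rfl, rfl⟩ <;> assumption
    · rw [hd]
      beta_reduce
      rw [not_and_or, ← show _ ↔ ¬ P w v from hN₁ w v hv, ← show _ ↔ ¬ Q w v from hN₂ w v hv]
      constructor
      · rintro ⟨t, _, _, _, ⟨rfl | rfl, rfl⟩, h⟩
        · exact .inl h
        · exact .inr h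
      · rintro (h | h)
        · exact ⟨n₁, hn₁', _, hlt w v hv, ⟨.inl rfl, rfl⟩, h⟩
        · exact ⟨n₂, hn₂, _, hlt w v hv, ⟨.inr rfl, rfl⟩, h⟩
  | @ex k b P _ ih =>
    intro B
    obtain ⟨X₁, h₁⟩ := ih (B + Polynomial.X + Polynomial.C b)
    refine ⟨X₁ + codeBound (B + Polynomial.X + Polynomial.C b) (k + 1), fun X hX π K hπ => ?_⟩
    simp only [Polynomial.eval_add] at hX
    obtain ⟨π₁, K₁, hE₁, ⟨p₁, hp₁, hP₁⟩, n₁, hn₁, hN₁⟩ :=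
      h₁ X (fun n => by have := hX n; omega) π K hπ
    -- The gate of a tuple is fed by the gates of its extensions by a value of the quantifier.
    have hD : ∀ (p : ℕ → Prop) (t : ℕ), Delta0 fun v : Fin 3 → ℕ =>
        p t ∧ ∃ y, y < v 0 + b ∧ v 2 = pairCode y (v 1) :=
      fun p t => (Delta0.const _).and (Delta0.ex (P := fun v y => v 2 = pairCode y (v 1))
        ((Term.var 0).add (.const b)) (.eq' (.var 3) (.pairCode (.var 0) (.var 2))))
    obtain ⟨π₂, hE₂, hd, hc⟩ := exists_extends π₁ K₁
      (W := fun t n x z => t = p₁ ∧ ∃ y, y < n + b ∧ z = pairCode y x)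
      (W' := fun t n x z => t = n₁ ∧ ∃ y, y < n + b ∧ z = pairCode y x)
      (hD fun t => t = p₁) (hD fun t => t = n₁)
    have hB : ∀ (w : List S) (v : Fin k → ℕ), (∀ i, v i < B.eval w.length) →
        ∀ y < w.length + b, ∀ i, (Fin.cons y v : Fin (k + 1) → ℕ) i <
          (B + Polynomial.X + Polynomial.C b).eval w.length := by
      intro w v hv y hy
      simp only [Polynomial.eval_add, Polynomial.eval_X, Polynomial.eval_C]
      refine Fin.cases ?_ fun i => ?_
      · simp only [Fin.cons_zero]; omega
      · have := hv i
        simp only [Fin.cons_succ]; omega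
    have hlt : ∀ (w : List S) (v : Fin k → ℕ), (∀ i, v i < B.eval w.length) →
        ∀ y < w.length + b, pairCode y (code v) < X.eval w.length := by
      intro w v hv y hy
      rw [← code_cons]
      exact (code_lt (hB w v hv y hy)).trans_le (by have := hX w.length; omega)
    refine ⟨π₂, K₁ + 2, hE₁.trans hE₂, ⟨K₁, by omega, fun w v hv => ?_⟩, K₁ + 1, by omega,
      fun w v hv => ?_⟩
    · rw [hd]
      constructor
      · rintro ⟨t, _, _, _, ⟨rfl, y, hy, rfl⟩, h⟩
        rw [← code_cons, hP₁ w _ (hB w v hv y hy)] at h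
        exact ⟨y, hy, by simpa using h⟩
      · rintro ⟨y, hy, h⟩
        refine ⟨p₁, hp₁, _, hlt w v hv y hy, ⟨rfl, y, hy, rfl⟩, ?_⟩
        rw [← code_cons, hP₁ w _ (hB w v hv y hy)]
        simpa using h
    · rw [hc]
      constructor
      · rintro H ⟨y, hy, h⟩
        have := H n₁ hn₁ _ (hlt w v hv y hy) ⟨rfl, y, hy, rfl⟩
        rw [← code_cons, hN₁ w _ (hB w v hv y hy)] at this
        exact this (by simpa using h)
      · rintro H t _ _ _ ⟨rfl, y, hy, rfl⟩
        rw [← code_cons, hN₁ w _ (hB w v hv y hy)]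
        exact fun h => H ⟨y, hy, by simpa using h⟩

theorem exists_ready [Finite S] : ∃ (π : ℕ → Layer S) (K : ℕ), 0 < K ∧ Ready π K := by
  obtain ⟨n, ⟨e⟩⟩ := Finite.exists_equiv_fin S
  refine ⟨fun t => ⟨if h : t < n then .lit (e.symm ⟨t, h⟩) else .conj, fun _ _ _ _ => False,
    fun t => .const _⟩, n + 1, Nat.succ_pos _, fun c => ⟨e c, ?_, ?_⟩, n, Nat.lt_succ_self n, ?_⟩
  · exact (e c).isLt.trans n.lt_succ_self
  · simp
  · simp

/-- Functions on words whose output letters are first-order definable are computed by uniform AC⁰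
families. -/
theorem exists_isAC0_outputs {G : Type} [Finite S] [Finite G] (L : Polynomial ℕ)
    {P : G → List S → ℕ → Prop} (hP : ∀ c, FO fun w (v : Fin 1 → ℕ) => P c w (v 0)) :
    ∃ C : CircuitFamily S G, C.IsAC0 ∧ ∀ (w : List S) (y : List G),
      y.length ≤ L.eval w.length →
      (∀ i < L.eval w.length, ∀ c, P c w i ↔ y[i]? = some c) → C.Outputs w y := by
  classical
  have key : ∀ s : Set G, s.Finite → ∃ X₀ : Polynomial ℕ, ∀ X : Polynomial ℕ,
      (∀ n, X₀.eval n ≤ X.eval n) → ∃ (π : ℕ → Layer S) (K : ℕ), 0 < K ∧ Ready π K ∧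
        ∀ c ∈ s, ∃ t < K, Realizes π X L t fun w (v : Fin 1 → ℕ) => P c w (v 0) := by
    intro s hs
    induction s, hs using Set.Finite.induction_on with
    | empty =>
      refine ⟨0, fun X _ => ?_⟩
      obtain ⟨π, K, hK, hπ⟩ := exists_ready (S := S)
      exact ⟨π, K, hK, hπ, by simp⟩
    | @insert c s _ _ ih =>
      obtain ⟨X₁, h₁⟩ := ih
      obtain ⟨X₂, h₂⟩ := (hP c).realize L
      refine ⟨X₁ + X₂, fun X hX => ?_⟩
      simp only [Polynomial.eval_add] at hX
      obtain ⟨π₁, K₁, hK₁, hπ₁, hs⟩ := h₁ X fun n => by have := hX n; omega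
      obtain ⟨π₂, K₂, hE, hc, -⟩ := h₂ X (fun n => by have := hX n; omega) π₁ K₁ hπ₁
      refine ⟨π₂, K₂, hK₁.trans_le hE.1, hπ₁.extends hE, ?_⟩
      rintro c' (rfl | hc')
      · exact hc
      · obtain ⟨t, ht, hr⟩ := hs c' hc'
        exact ⟨t, ht.trans_le hE.1, hr.extends ht hE⟩
  obtain ⟨X₀, h⟩ := key Set.univ Set.finite_univ
  obtain ⟨π, K, hK, -, ho⟩ := h (X₀ + codeBound L 1) fun n => by simp
  choose o ho hr using fun c => ho c (Set.mem_univ c)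
  have hb : ∀ n, ∀ i < L.eval n, ∀ j, (![i] : Fin 1 → ℕ) j < L.eval n := by
    intro n i hi j
    fin_cases j
    exact hi
  have hL : ∀ n, ∀ i < L.eval n, code ![i] < (X₀ + codeBound L 1).eval n := by
    intro n i hi
    refine (code_lt (hb n i hi)).trans_le ?_
    simp
  refine ⟨layerCircuit π K _ L o ho hL, layerCircuit_isAC0 hK, fun w y hy hP => ?_⟩
  refine layerCircuit_outputs hK w y hy fun i hi c => ?_
  rw [hr c w ![i] (hb _ i hi)]
  exact hP i hi c

/-- First-order definable properties of words are decided by uniform AC⁰ families. -/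
theorem exists_isAC0_answers [Finite S] {P : List S → Prop}
    (hP : FO fun w (_ : Fin 1 → ℕ) => P w) :
    ∃ C : CircuitFamily S Bool, C.IsAC0 ∧ ∀ w, C.Answers w (P w) := by
  obtain ⟨C, hC, h⟩ := exists_isAC0_outputs (G := Bool) (S := S) 1
    (P := fun c w _ => (P w ↔ c = true)) (by
      intro c
      cases c
      · simpa using hP.not
      · simpa using hP)
  refine ⟨C, hC, fun w => ⟨fun hp => h w _ (by simp) ?_, fun hp => h w _ (by simp) ?_⟩⟩ <;>
  · intro i hi c
    obtain rfl : i = 0 := by simpa using hi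
    cases c <;> simp [hp]

end FirstOrder

/-! ### Closure properties of first-order definability -/

section FirstOrderLibrary

variable {S : Type} {k m : ℕ}

namespace FO

variable {P Q : List S → (Fin k → ℕ) → Prop} {s t : (Fin k → ℕ) → ℕ}

theorem of_iff (h : FO P) (hPQ : ∀ w v, Q w v ↔ P w v) : FO Q := by
  rwa [show Q = P from funext fun w => funext fun v => propext (hPQ w v)]

theorem of_delta0 {R : (Fin k → ℕ) → Prop} (h : Delta0 R) : FO fun (_ : List S) v => R v :=
  FO.rel (R := fun _ => R) h.tail

theorem const (p : Prop) : FO fun (_ : List S) (_ : Fin k → ℕ) => p := of_delta0 (.const p)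

theorem eq' (hs : Term s) (ht : Term t) : FO fun (_ : List S) v => s v = t v :=
  of_delta0 (.eq' hs ht)

theorem lt (hs : Term s) (ht : Term t) : FO fun (_ : List S) v => s v < t v :=
  of_delta0 (.lt hs ht)

theorem or (hP : FO P) (hQ : FO Q) : FO fun w v => P w v ∨ Q w v :=
  (hP.not.and hQ.not).not.of_iff fun w v => by tauto

theorem imp (hP : FO P) (hQ : FO Q) : FO fun w v => P w v → Q w v :=
  (hP.not.or hQ).of_iff fun w v => by tauto

theorem iff (hP : FO P) (hQ : FO Q) : FO fun w v => P w v ↔ Q w v :=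
  ((hP.imp hQ).and (hQ.imp hP)).of_iff fun w v => by tauto

theorem all (b : ℕ) {P : List S → (Fin k → ℕ) → ℕ → Prop}
    (h : FO fun w (v : Fin (k + 1) → ℕ) => P w (Fin.tail v) (v 0)) :
    FO fun w v => ∀ y, y < w.length + b → P w v y :=
  (FO.ex b (P := fun w v y => ¬ P w v y) h.not).not.of_iff fun w v => by simp

theorem getElem? (ht : Term t) (c : S) : FO fun w v => w[t v]? = some c := by
  refine (FO.ex 0 (P := fun w v y => y = t v ∧ w[y]? = some c)
    ((FO.eq' (.var 0) ht.tail).and (.letter 0 c))).of_iff fun w v => ?_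
  constructor
  · intro h
    refine ⟨t v, ?_, rfl, h⟩
    obtain ⟨h, -⟩ := List.getElem?_eq_some_iff.1 h
    exact h
  · rintro ⟨_, _, rfl, h⟩
    exact h

theorem comp {P : List S → (Fin m → ℕ) → Prop} (hP : FO P) :
    ∀ {k : ℕ} {s : Fin m → (Fin k → ℕ) → ℕ}, (∀ i, Term (s i)) →
      FO fun w v => P w fun i => s i v := by
  induction hP with
  | @rel m R hR =>
    intro k s hs
    refine FO.rel (R := fun n v => R n fun i => s i v) ?_
    refine (hR.comp (s := Fin.cons (fun v : Fin (k + 1) → ℕ => v 0) fun i v => s i (Fin.tail v))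
      (Fin.cases (.var 0) fun i => (hs i).tail)).of_iff fun v => ?_
    exact Iff.rfl
  | letter i c => exact fun hs => getElem? (hs i) c
  | not _ ih => exact fun hs => (ih hs).not
  | and _ _ ih1 ih2 => exact fun hs => (ih1 hs).and (ih2 hs)
  | @ex m b P _ ih =>
    intro k s hs
    refine FO.ex b (P := fun w v y => P w (fun i => s i v) y) ?_
    exact ih (s := Fin.cons (fun v : Fin (k + 1) → ℕ => v 0) fun i v => s i (Fin.tail v))
      (Fin.cases (.var 0) fun i => (hs i).tail)

theorem tail (h : FO P) : FO fun w (v : Fin (k + 1) → ℕ) => P w (Fin.tail v) :=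
  h.comp (s := fun i v => v i.succ) fun _ => .var _

/-- Quantification over tuples of positions. -/
theorem exVec : ∀ {k m : ℕ} {R : List S → (Fin m → ℕ) → (Fin k → ℕ) → Prop},
    FO (fun w (u : Fin (k + m) → ℕ) =>
      R w (fun j => u (Fin.natAdd k j)) fun i => u (Fin.castAdd m i)) →
    FO fun w u => ∃ v : Fin k → ℕ, (∀ i, v i < w.length) ∧ R w u v := by
  intro k
  induction k with
  | zero =>
    intro m R h
    refine (h.comp (s := fun i u => u (i.cast (Nat.zero_add m))) fun i => .var _).of_iff
      fun w u => ?_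
    simp only [IsEmpty.forall_iff, true_and]
    constructor
    · rintro ⟨v, hv⟩
      convert hv using 2
      simp
    · intro hR
      refine ⟨Fin.elim0, ?_⟩
      convert hR using 2
      simp
  | succ k ih =>
    intro m R h
    have h1 : FO fun w (u : Fin (m + 1) → ℕ) => ∃ v : Fin k → ℕ, (∀ i, v i < w.length) ∧
        R w (Fin.tail u) (Fin.cons (u 0) v) := by
      refine ih (R := fun w u v => R w (Fin.tail u) (Fin.cons (u 0) v)) ?_
      let s : Fin (k + 1 + m) → (Fin (k + (m + 1)) → ℕ) → ℕ :=
        Fin.addCases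
          (Fin.cases (fun u => u (Fin.natAdd k 0)) fun i u => u (Fin.castAdd (m + 1) i))
          fun j u => u (Fin.natAdd k j.succ)
      have hs : ∀ i, Term (s i) := by
        refine Fin.addCases (Fin.cases ?_ fun i => ?_) fun j => ?_ <;>
          simp only [s, Fin.addCases_left, Fin.addCases_right, Fin.cases_zero, Fin.cases_succ] <;>
          exact .var _
      refine (h.comp hs).of_iff fun w u => ?_
      have e1 : (fun j => s (Fin.natAdd (k + 1) j) u) =
          Fin.tail fun j => u (Fin.natAdd k j) := by
        funext j
        simp only [s, Fin.addCases_right]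
        rfl
      have e2 : (fun i => s (Fin.castAdd m i) u) =
          Fin.cons (u (Fin.natAdd k 0)) fun i => u (Fin.castAdd (m + 1) i) := by
        funext i
        induction i using Fin.cases <;> simp [s, Fin.addCases_left]
      rw [e1, e2]
    refine (FO.ex 0 (P := fun w u y => ∃ v : Fin k → ℕ, (∀ i, v i < w.length) ∧
      R w u (Fin.cons y v)) h1).of_iff fun w u => ⟨?_, ?_⟩
    · rintro ⟨v, hv, hR⟩
      exact ⟨v 0, hv 0, Fin.tail v, fun i => hv i.succ, by rwa [Fin.cons_self_tail]⟩
    · rintro ⟨y, hy, v, hv, hR⟩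
      exact ⟨Fin.cons y v, Fin.cases hy hv, hR⟩

theorem exists_finite {ι : Type*} [Finite ι] {P : ι → List S → (Fin k → ℕ) → Prop}
    (h : ∀ i, FO (P i)) : FO fun w v => ∃ i, P i w v := by
  have key : ∀ s : Set ι, s.Finite → FO fun w v => ∃ i ∈ s, P i w v := by
    intro s hs
    induction s, hs using Set.Finite.induction_on with
    | empty => exact (const False).of_iff fun w v => by simp
    | @insert i s _ _ ih => exact ((h i).or ih).of_iff fun w v => by simp
  exact (key Set.univ Set.finite_univ).of_iff fun w v => by simp

theorem forall_finite {ι : Type*} [Finite ι] {P : ι → List S → (Fin k → ℕ) → Prop}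
    (h : ∀ i, FO (P i)) : FO fun w v => ∀ i, P i w v :=
  (exists_finite fun i => (h i).not).not.of_iff fun w v => by simp

/-- A property that depends only on finitely many definable properties is definable. -/
theorem pattern {ι : Type*} [Finite ι] {P : ι → List S → (Fin k → ℕ) → Prop}
    (h : ∀ i, FO (P i)) (G : Set (ι → Prop)) : FO fun w v => (fun i => P i w v) ∈ G := by
  refine (exists_finite (ι := ι → Prop) fun f =>
    (const (f ∈ G)).and (forall_finite fun i => (h i).iff (const (f i)))).of_iff fun w v => ?_
  constructor
  · exact fun hG => ⟨_, hG, fun i => Iff.rfl⟩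
  · rintro ⟨f, hf, hi⟩
    rwa [show (fun i => P i w v) = f from funext fun i => propext (hi i)]

end FO

/-- Definability of the digits of a number that depends on a word and a tuple. It suffices to
consider non-zero digits. -/
def FODigits (D : List S → (Fin k → ℕ) → ℕ → ℕ) : Prop :=
  ∀ c, c ≠ 0 → FO fun w (u : Fin (k + 1) → ℕ) => D w (Fin.tail u) (u 0) = c

theorem FODigits.comp {D : List S → (Fin m → ℕ) → ℕ → ℕ} (hD : FODigits D)
    {s : Fin m → (Fin k → ℕ) → ℕ} (hs : ∀ i, Term (s i)) {t : (Fin k → ℕ) → ℕ} (ht : Term t)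
    {c : ℕ} (hc : c ≠ 0) : FO fun w v => D w (fun i => s i v) (t v) = c :=
  (hD c hc).comp (s := Fin.cons t s) (Fin.cases ht hs)

theorem FODigits.subst {D : List S → (Fin m → ℕ) → ℕ → ℕ} (hD : FODigits D)
    {s : Fin m → (Fin k → ℕ) → ℕ} (hs : ∀ i, Term (s i)) :
    FODigits fun w v => D w fun i => s i v := fun _ hc =>
  hD.comp (s := fun i v => s i (Fin.tail v)) (fun i => (hs i).tail) (.var 0) hc

theorem FODigits.tail {D : List S → (Fin k → ℕ) → ℕ → ℕ} (hD : FODigits D) :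
    FODigits fun w (v : Fin (k + 1) → ℕ) => D w (Fin.tail v) :=
  hD.subst (s := fun i v => v i.succ) fun _ => .var _

/-- The sequence `f` of digits is lexicographically smaller than `g`, and they first differ at an
index below the length of the word plus `K`. -/
def NumLt (K : ℕ) (w : List S) (f g : ℕ → ℕ) : Prop :=
  ∃ i, i < w.length + K ∧ f i < g i ∧ ∀ j, j < w.length + K → j < i → f j = g j

theorem FODigits.numLt {B : ℕ} (K : ℕ) {D D' : List S → (Fin k → ℕ) → ℕ → ℕ}
    (hD : FODigits D) (hD' : FODigits D') (hB : ∀ w v i, D w v i < B)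
    (hB' : ∀ w v i, D' w v i < B) : FO fun w v => NumLt K w (D w v) (D' w v) := by
  refine FO.ex K (P := fun w v i => D w v i < D' w v i ∧
    ∀ j, j < w.length + K → j < i → D w v j = D' w v j) (.and ?_ ?_)
  · refine (FO.exists_finite (ι := {c : Fin B // c.val ≠ 0}) fun c => (hD' _ c.2).and
      (FO.forall_finite (ι := {c' : Fin B // c.1 ≤ c'}) fun c' => (hD c'.1.val ?_).not)).of_iff
      fun w u => ⟨fun h => ?_, ?_⟩
    · have h1 : c.1.val ≤ c'.1.val := c'.2
      have h2 := c.2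
      omega
    · refine ⟨⟨⟨_, hB' w (Fin.tail u) (u 0)⟩, by simp only; omega⟩, rfl, fun c' hc' => ?_⟩
      have h1 : D' w (Fin.tail u) (u 0) ≤ c'.1.val := c'.2
      omega
    · rintro ⟨c, h1, h2⟩
      by_contra hlt
      exact h2 ⟨⟨_, hB w (Fin.tail u) (u 0)⟩,
        by change c.1.val ≤ D w (Fin.tail u) (u 0); omega⟩ rfl
  · refine FO.all K (P := fun w v j => j < v 0 → D w (Fin.tail v) j = D' w (Fin.tail v) j)
      (FO.imp (.lt (.var 0) (.var 1)) ?_)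
    refine (FO.forall_finite (ι := {c : Fin B // c.val ≠ 0}) fun c =>
      (hD.tail _ c.2).iff (hD'.tail _ c.2)).of_iff fun w v => ?_
    have key : ∀ x y : ℕ, x < B → y < B →
        (x = y ↔ ∀ c : {c : Fin B // c.val ≠ 0}, x = c.1.val ↔ y = c.1.val) := by
      refine fun x y hx hy => ⟨fun h c => by rw [h], fun h => ?_⟩
      by_cases h0 : x = 0
      · by_contra hne
        exact hne ((h ⟨⟨y, hy⟩, fun h1 => hne (h0.trans h1.symm)⟩).2 rfl)
      · exact ((h ⟨⟨x, hx⟩, h0⟩).1 rfl).symm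
    exact key _ _ (hB _ _ _) (hB' _ _ _)

/-- A function that vanishes from some point on has definable digits. -/
theorem FODigits.const {f : ℕ → ℕ} {K : ℕ} (hf : ∀ i, K ≤ i → f i = 0) :
    FODigits fun (_ : List S) (_ : Fin k → ℕ) => f := by
  intro c hc
  refine (FO.exists_finite (ι := Fin K) fun i => (FO.eq' (.var 0) (.const i.val)).and
    (FO.const (f i = c))).of_iff fun w u => ?_
  constructor
  · intro h
    by_cases hK : K ≤ u 0
    · exact absurd ((hf _ hK).symm.trans h).symm hc
    · exact ⟨⟨u 0, not_le.1 hK⟩, rfl, h⟩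
  · rintro ⟨i, h1, h2⟩
    rw [h1]
    exact h2

end FirstOrderLibrary

/-! ### Digits of numerals -/

section Numerals

variable {b : ℕ}

/-- The digits of a list of digits, padded with zeros. -/
def fracDigit (cs : List (Fin b)) (i : ℕ) : ℕ := (cs[i]?).elim 0 fun c => c.val

/-- The digits of a numeral; the digit with index `0` stands before the point. -/
def Numeral.dig : Numeral b → ℕ → ℕ
  | .one, 0 => 1
  | .one, _ + 1 => 0
  | .frac _, 0 => 0
  | .frac cs, i + 1 => fracDigit cs i

theorem fracDigit_lt (hb : 2 ≤ b) (cs : List (Fin b)) (i : ℕ) : fracDigit cs i < b := by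
  unfold fracDigit
  cases h : cs[i]? with
  | none => simp only [Option.elim]; omega
  | some c => exact c.isLt

theorem Numeral.dig_lt (hb : 2 ≤ b) (c : Numeral b) (i : ℕ) : c.dig i < b := by
  cases c <;> cases i <;> simp only [Numeral.dig] <;> first | omega | exact fracDigit_lt hb _ _

theorem Numeral.dig_eq_zero (c : Numeral b) {i : ℕ} (hi : (encNumeral c).length ≤ i) :
    c.dig i = 0 := by
  cases c with
  | one =>
    cases i with
    | zero => simp [encNumeral] at hi
    | succ i => rfl
  | frac cs =>
    cases i with
    | zero => rfl
    | succ i =>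
      simp only [encNumeral, List.length_append, List.length_map, List.length_singleton,
        Nat.add_le_add_iff_right] at hi
      simp [Numeral.dig, fracDigit, List.getElem?_eq_none hi]

/-- Lexicographic comparison of digit sequences. -/
def LexLt (f g : ℕ → ℕ) : Prop := ∃ i, f i < g i ∧ ∀ j < i, f j = g j

theorem lexLt_iff (f g : ℕ → ℕ) :
    LexLt f g ↔ f 0 < g 0 ∨ f 0 = g 0 ∧ LexLt (fun i => f (i + 1)) fun i => g (i + 1) := by
  constructor
  · rintro ⟨i, hi, hj⟩
    cases i with
    | zero => exact .inl hi
    | succ i => exact .inr ⟨hj 0 i.succ_pos, i, hi, fun j h => hj _ (Nat.succ_lt_succ h)⟩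
  · rintro (h | ⟨h, i, hi, hj⟩)
    · exact ⟨0, h, fun j h => absurd h (Nat.not_lt_zero j)⟩
    · refine ⟨i + 1, hi, fun j h' => ?_⟩
      cases j with
      | zero => exact h
      | succ j => exact hj j (Nat.lt_of_succ_lt_succ h')

theorem not_lexLt_self (f : ℕ → ℕ) : ¬ LexLt f f := fun ⟨_, h, _⟩ => lt_irrefl _ h

theorem fracVal_lt_one (cs : List (Fin b)) : fracVal cs < 1 := by
  induction cs with
  | nil => simp [fracVal]
  | cons c cs ih =>
    have hb : (0 : ℝ) < b := by exact_mod_cast c.pos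
    have hc : ((c : ℕ) : ℝ) + 1 ≤ b := by exact_mod_cast c.isLt
    simp only [fracVal]
    rw [div_lt_one hb]
    linarith

theorem fracVal_eq (cs : List (Fin b)) :
    fracVal cs = (fracDigit cs 0 + fracVal cs.tail) / b := by
  cases cs <;> simp [fracVal, fracDigit]

theorem fracDigit_tail (cs : List (Fin b)) (i : ℕ) :
    fracDigit cs.tail i = fracDigit cs (i + 1) := by
  cases cs <;> simp [fracDigit]

theorem fracVal_lt_iff (hb : 2 ≤ b) (cs ds : List (Fin b)) :
    fracVal cs < fracVal ds ↔ LexLt (fracDigit cs) (fracDigit ds) := by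
  have key : ∀ n, ∀ cs ds : List (Fin b), cs.length ≤ n → ds.length ≤ n →
      (fracVal cs < fracVal ds ↔ LexLt (fracDigit cs) (fracDigit ds)) := by
    intro n
    induction n with
    | zero =>
      intro cs ds hc hd
      rw [List.length_eq_zero_iff.1 (Nat.le_zero.1 hc),
        List.length_eq_zero_iff.1 (Nat.le_zero.1 hd)]
      simp [not_lexLt_self]
    | succ n ih =>
      intro cs ds hc hd
      have hb' : (0 : ℝ) < b := by exact_mod_cast (by omega : 0 < b)
      have e : ∀ l : List (Fin b), (fun i => fracDigit l (i + 1)) = fracDigit l.tail := fun l =>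
        funext fun i => (fracDigit_tail l i).symm
      rw [lexLt_iff, e, e, ← ih cs.tail ds.tail (by simp; omega) (by simp; omega), fracVal_eq cs,
        fracVal_eq ds, div_lt_div_iff_of_pos_right hb']
      have h0 := (fracVal_mem cs.tail).1
      have h1 := fracVal_lt_one cs.tail
      have h2 := (fracVal_mem ds.tail).1
      have h3 := fracVal_lt_one ds.tail
      rcases lt_trichotomy (fracDigit cs 0) (fracDigit ds 0) with h | h | h
      · have : (fracDigit cs 0 : ℝ) + 1 ≤ fracDigit ds 0 := by exact_mod_cast h
        exact ⟨fun _ => .inl h, fun _ => by linarith⟩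
      · rw [h]; simp
      · have : (fracDigit ds 0 : ℝ) + 1 ≤ fracDigit cs 0 := by exact_mod_cast h
        exact ⟨fun _ => by linarith, fun h' => by omega⟩
  exact key (max cs.length ds.length) cs ds (le_max_left _ _) (le_max_right _ _)

/-- Numerals are compared lexicographically, since an expansion `0.c₁c₂…cₘ` is smaller than `1`. -/
theorem Numeral.val_lt_iff (hb : 2 ≤ b) (c d : Numeral b) : c.val < d.val ↔ LexLt c.dig d.dig := by
  rw [lexLt_iff]
  cases c with
  | one =>
    cases d with
    | one => simp [Numeral.dig, not_lexLt_self]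
    | frac ds => simp [Numeral.val, Numeral.dig, unitInterval.le_one']
  | frac cs =>
    cases d with
    | one =>
      simp only [Numeral.val, Numeral.dig, Nat.zero_lt_one, true_or, iff_true]
      exact Subtype.mk_lt_mk.2 (fracVal_lt_one cs)
    | frac ds =>
      simp only [Numeral.val, Numeral.dig, lt_self_iff_false, false_or, true_and]
      exact Subtype.mk_lt_mk.trans (fracVal_lt_iff hb cs ds)

/-- For digits that vanish from the bound of `NumLt` on, the bound is immaterial. -/
theorem numLt_iff {S : Type} {K : ℕ} {w : List S} {f g : ℕ → ℕ}
    (hg : ∀ i, w.length + K ≤ i → g i = 0) : NumLt K w f g ↔ LexLt f g := by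
  constructor
  · rintro ⟨i, hi, h, hj⟩
    exact ⟨i, h, fun j hji => hj j (hji.trans hi) hji⟩
  · rintro ⟨i, h, hj⟩
    refine ⟨i, ?_, h, fun j _ hji => hj j hji⟩
    by_contra hi
    rw [hg i (not_lt.1 hi)] at h
    exact Nat.not_lt_zero _ h

end Numerals

/-! ### Reading input words -/

section Words

variable {b : ℕ}

instance : Finite (Letter b) := by
  let f : Letter b → Bool ⊕ Fin b ⊕ Fin 9
    | .bit v => .inl v
    | .digit c => .inr (.inl c)
    | .sep => .inr (.inr 0)
    | .one => .inr (.inr 1)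
    | .halt => .inr (.inr 2)
    | .nameTag => .inr (.inr 3)
    | .exTag => .inr (.inr 4)
    | .exInvTag => .inr (.inr 5)
    | .roleTag => .inr (.inr 6)
    | .ansTag => .inr (.inr 7)
    | .degTag => .inr (.inr 8)
  refine Finite.of_injective f fun x y h => ?_
  cases x <;> cases y <;> simp_all [f]

/-- The word `u` occurs in `w` at position `p`. -/
def At {S : Type} (w : List S) (p : ℕ) (u : List S) : Prop := ∀ i < u.length, w[p + i]? = u[i]?

section

variable {S : Type} {w u v : List S} {p : ℕ} {c : S}

theorem at_cons : At w p (c :: u) ↔ w[p]? = some c ∧ At w (p + 1) u := by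
  constructor
  · intro h
    refine ⟨by simpa using h 0 (by simp), fun i hi => ?_⟩
    have := h (i + 1) (by simpa using hi)
    rw [List.getElem?_cons_succ] at this
    rw [← this]
    congr 1
    omega
  · rintro ⟨h0, h⟩ i hi
    cases i with
    | zero => simpa using h0
    | succ i =>
      rw [List.getElem?_cons_succ, ← h i (by simpa using hi)]
      congr 1
      omega

theorem at_append : At w p (u ++ v) ↔ At w p u ∧ At w (p + u.length) v := by
  induction u generalizing p with
  | nil => simp [At]
  | cons c u ih =>
    rw [List.cons_append, at_cons, at_cons, ih, and_assoc, List.length_cons]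
    rw [show p + 1 + u.length = p + (u.length + 1) by omega]

theorem at_of_append (l u r : List S) : At (l ++ (u ++ r)) l.length u := by
  intro i hi
  rw [List.getElem?_append_right (by omega), Nat.add_sub_cancel_left,
    List.getElem?_append_left hi]

theorem At.shift {l : List S} (h : At w p u) : At (l ++ w) (l.length + p) u := by
  intro i hi
  rw [List.getElem?_append_right (by omega), ← h i hi]
  congr 1
  omega

theorem lt_length_of_getElem? (h : w[p]? = some c) : p < w.length :=
  (List.getElem?_eq_some_iff.1 h).1

theorem fo_at {k : ℕ} {t : (Fin k → ℕ) → ℕ} (ht : Term t) (u : List S) :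
    FO fun w v => At w (t v) u := by
  refine (FO.forall_finite (ι := Fin u.length) fun i =>
    FO.getElem? (ht.add (.const i.val)) u[i]).of_iff fun w v => ?_
  constructor
  · intro h i
    rw [h i i.isLt]
    simp
  · intro h i hi
    rw [List.getElem?_eq_getElem hi]
    exact h ⟨i, hi⟩

end

variable {w : List (Letter b)} {p q : ℕ} {u u' : List Bool}

@[simp] theorem length_encWord (u : List Bool) :
    (encWord u : List (Letter b)).length = u.length + 1 := by simp [encWord]

theorem At.bit (h : At w p (encWord u)) {i : ℕ} (hi : i < u.length) :
    w[p + i]? = some (.bit u[i]) := by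
  rw [h i (by simp; omega)]
  simp [encWord, List.getElem?_append_left, hi]

theorem At.sep (h : At w p (encWord u)) : w[p + u.length]? = some .sep := by
  rw [h _ (by simp)]
  simp [encWord]

/-- The number of bits before the first separator is the length of the encoded word. -/
theorem At.length_eq (h : At w p (encWord u)) {l : ℕ} (hl : w[p + l]? = some .sep)
    (hb : ∀ i < l, ∃ v, w[p + i]? = some (.bit v)) : l = u.length := by
  rcases lt_trichotomy l u.length with hlt | heq | hlt
  · rw [h.bit hlt] at hl
    simp at hl
  · exact heq
  · obtain ⟨v, hv⟩ := hb _ hlt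
    rw [h.sep] at hv
    simp at hv

/-- The word at `p` ends just before `q`. -/
def Next (w : List (Letter b)) (p q : ℕ) : Prop :=
  ∃ l, l < w.length ∧ q = p + l + 1 ∧ w[p + l]? = some .sep ∧
    ∀ i, i < w.length → i < l → ∃ v, w[p + i]? = some (.bit v)

theorem At.next_iff (h : At w p (encWord u)) : Next w p q ↔ q = p + u.length + 1 := by
  constructor
  · rintro ⟨l, hl, rfl, hs, hb⟩
    rw [h.length_eq hs fun i hi => hb i (hi.trans hl) hi]
  · rintro rfl
    refine ⟨u.length, ?_, rfl, h.sep, fun i _ hi => ⟨_, h.bit hi⟩⟩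
    have := lt_length_of_getElem? h.sep
    omega

/-- The same word is written at `p` and at `q`. -/
def SameWord (w : List (Letter b)) (p q : ℕ) : Prop :=
  ∃ l, l < w.length ∧ w[p + l]? = some .sep ∧ w[q + l]? = some .sep ∧
    ∀ i, i < w.length → i < l → ∃ v, w[p + i]? = some (.bit v) ∧ w[q + i]? = some (.bit v)

theorem At.sameWord_iff (h : At w p (encWord u)) (h' : At w q (encWord u')) :
    SameWord w p q ↔ u = u' := by
  constructor
  · rintro ⟨l, hl, hs, hs', hb⟩
    have e := h.length_eq hs fun i hi => (hb i (hi.trans hl) hi).imp fun _ => And.left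
    have e' := h'.length_eq hs' fun i hi => (hb i (hi.trans hl) hi).imp fun _ => And.right
    refine List.ext_getElem (e.symm.trans e') fun i hi hi' => ?_
    obtain ⟨v, h1, h2⟩ := hb i (by omega) (by omega)
    rw [h.bit hi] at h1
    rw [h'.bit hi'] at h2
    simp only [Option.some_inj, Letter.bit.injEq] at h1 h2
    rw [h1, h2]
  · rintro rfl
    refine ⟨u.length, ?_, h.sep, h'.sep, fun i _ hi => ⟨_, h.bit hi, h'.bit hi⟩⟩
    have := lt_length_of_getElem? h.sep
    omega

/-- Encoded words are prefix-free. -/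
theorem At.encWord_iff (h : At w p (encWord u)) : At w p (encWord u') ↔ u = u' :=
  ⟨fun h' => (h.sameWord_iff h').1 ((h.sameWord_iff h).2 rfl), fun e => e ▸ h⟩

section FO

variable {k : ℕ} {s t : (Fin k → ℕ) → ℕ}

theorem fo_next (hs : Term s) (ht : Term t) :
    FO fun (w : List (Letter b)) v => Next w (s v) (t v) := by
  refine FO.ex 0 (P := fun (w : List (Letter b)) v l => t v = s v + l + 1 ∧
    w[s v + l]? = some .sep ∧ ∀ i, i < w.length → i < l → ∃ x, w[s v + i]? = some (.bit x))
    (.and (.eq' ht.tail ((hs.tail.add (.var 0)).add (.const 1)))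
      (.and (.getElem? (hs.tail.add (.var 0)) _) ?_))
  exact FO.all 0 (P := fun (w : List (Letter b)) v i => i < v 0 →
    ∃ x, w[s (Fin.tail v) + i]? = some (.bit x))
    (FO.imp (.lt (.var 0) (.var 1)) (FO.exists_finite fun x =>
      .getElem? (hs.tail.tail.add (.var 0)) _))

theorem fo_sameWord (hs : Term s) (ht : Term t) :
    FO fun (w : List (Letter b)) v => SameWord w (s v) (t v) := by
  refine FO.ex 0 (P := fun (w : List (Letter b)) v l =>
    w[s v + l]? = some .sep ∧ w[t v + l]? = some .sep ∧
    ∀ i, i < w.length → i < l → ∃ x, w[s v + i]? = some (.bit x) ∧ w[t v + i]? = some (.bit x))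
    (.and (.getElem? (hs.tail.add (.var 0)) _) (.and (.getElem? (ht.tail.add (.var 0)) _) ?_))
  exact FO.all 0 (P := fun (w : List (Letter b)) v i => i < v 0 →
    ∃ x, w[s (Fin.tail v) + i]? = some (.bit x) ∧ w[t (Fin.tail v) + i]? = some (.bit x))
    (FO.imp (.lt (.var 0) (.var 1)) (FO.exists_finite fun x =>
      .and (.getElem? (hs.tail.tail.add (.var 0)) _) (.getElem? (ht.tail.tail.add (.var 0)) _)))

end FO

/-- The value of a digit; other letters, and positions beyond the end of the word, count as
zero. -/
def digitVal : Option (Letter b) → ℕ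
  | some (.digit c) => c
  | _ => 0

/-- The digits of the numeral written at a position, padded with zeros; the digit with index `0`
stands before the point. -/
noncomputable def wordDig (w : List (Letter b)) (p : ℕ) : ℕ → ℕ
  | 0 => open Classical in if w[p]? = some .one then 1 else 0
  | i + 1 => open Classical in
    if ∀ j < i, ∃ c, w[p + j]? = some (.digit c) then digitVal w[p + i]? else 0

theorem wordDig_lt (hb : 2 ≤ b) (w : List (Letter b)) (p i : ℕ) : wordDig w p i < b := by
  cases i with
  | zero => simp only [wordDig]; split_ifs <;> omega
  | succ i =>
    simp only [wordDig]
    split_ifs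
    · unfold digitVal
      split
      · exact Fin.isLt _
      · omega
    · omega

theorem At.wordDig_eq {c : Numeral b} (h : At w p (encNumeral c)) : wordDig w p = c.dig := by
  funext i
  cases c with
  | one =>
    have h0 : w[p]? = some .one := by simpa [encNumeral] using h 0 (by simp [encNumeral])
    cases i with
    | zero => simp [wordDig, Numeral.dig, h0]
    | succ i =>
      simp only [wordDig, Numeral.dig]
      cases i with
      | zero => simp [h0, digitVal]
      | succ i =>
        rw [if_neg]
        intro hd
        obtain ⟨c, hc⟩ := hd 0 (Nat.succ_pos i)
        simp [h0] at hc
  | frac cs =>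
    have hd : ∀ i (hi : i < cs.length), w[p + i]? = some (.digit cs[i]) := by
      intro i hi
      rw [h i (by simp [encNumeral]; omega)]
      simp [encNumeral, List.getElem?_append_left, hi]
    have hh : w[p + cs.length]? = some .halt := by
      rw [h _ (by simp [encNumeral])]
      simp [encNumeral]
    cases i with
    | zero =>
      simp only [wordDig, Numeral.dig]
      rw [if_neg]
      intro h1
      by_cases h0 : 0 < cs.length
      · have := hd 0 h0
        rw [Nat.add_zero, h1] at this
        simp at this
      · rw [show cs.length = 0 by omega, Nat.add_zero, h1] at hh
        simp at hh
    | succ i =>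
      simp only [wordDig, Numeral.dig, fracDigit]
      rcases lt_trichotomy i cs.length with hi | hi | hi
      · rw [if_pos fun j hj => ⟨_, hd j (hj.trans hi)⟩, hd i hi]
        simp [digitVal, hi]
      · rw [if_pos fun j hj => ⟨_, hd j (hi ▸ hj)⟩, hi, hh]
        simp [digitVal]
      · rw [if_neg, List.getElem?_eq_none hi.le]
        · rfl
        · intro h'
          obtain ⟨c, hc⟩ := h' _ hi
          rw [hh] at hc
          simp at hc

theorem foDigits_wordDig {k : ℕ} {t : (Fin k → ℕ) → ℕ} (ht : Term t) :
    FODigits fun (w : List (Letter b)) v => wordDig w (t v) := by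
  intro c hc
  have h2 : FO fun (w : List (Letter b)) (u : Fin (k + 1) → ℕ) => ∃ i, i < w.length + 0 ∧
      (u 0 = i + 1 ∧ (∀ j, j < w.length + 0 → j < i →
        ∃ d, w[t (Fin.tail u) + j]? = some (.digit d)) ∧
        ∃ d : {d : Fin b // d.val = c}, w[t (Fin.tail u) + i]? = some (.digit d.1)) := by
    refine FO.ex 0 (P := fun (w : List (Letter b)) u i => u 0 = i + 1 ∧
        (∀ j, j < w.length + 0 → j < i → ∃ d, w[t (Fin.tail u) + j]? = some (.digit d)) ∧
        ∃ d : {d : Fin b // d.val = c}, w[t (Fin.tail u) + i]? = some (.digit d.1))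
      (.and (.eq' (.var 1) ((Term.var 0).add (.const 1))) (.and ?_ ?_))
    · exact FO.all 0 (P := fun (w : List (Letter b)) u j => j < u 0 →
        ∃ d, w[t (Fin.tail (Fin.tail u)) + j]? = some (.digit d))
        (FO.imp (.lt (.var 0) (.var 1)) (FO.exists_finite fun d =>
          .getElem? (ht.tail.tail.tail.add (.var 0)) _))
    · exact FO.exists_finite fun d => .getElem? (ht.tail.tail.add (.var 0)) _
  refine (FO.or (FO.and (FO.eq' (.var 0) (.const 0)) (FO.and (FO.const (c = 1))
    (FO.getElem? ht.tail .one))) h2).of_iff fun w u => ?_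
  beta_reduce
  cases hu : u 0 with
  | zero =>
    simp only [wordDig]
    split_ifs with h <;> simp [h, hc, eq_comm]
  | succ i =>
    simp only [wordDig]
    constructor
    · intro h
      split_ifs at h with h1
      · cases hl : w[t (Fin.tail u) + i]? with
        | none => rw [hl] at h; exact absurd h.symm hc
        | some l =>
          rw [hl] at h
          cases l with
          | digit d =>
            refine .inr ⟨i, ?_, rfl, fun j _ hj => h1 j hj, ⟨d, h⟩, hl⟩
            have := lt_length_of_getElem? hl
            omega
          | _ => exact absurd h.symm hc
      · exact absurd h.symm hc
    · rintro (⟨h, -⟩ | ⟨i', hi', h, h1, d, hd⟩)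
      · exact absurd h (Nat.succ_ne_zero i)
      · obtain rfl : i = i' := by omega
        rw [if_pos fun j hj => h1 j (hj.trans hi') hj, hd]
        exact d.2

/-- The `i`-th letter of the numeral written at `m` is `c`. -/
def NumeralLetter (w : List (Letter b)) (m i : ℕ) (c : Letter b) : Prop :=
  w[m + i]? = some c ∧ ∀ j, j < w.length → j < i → ¬ w[m + j]? = some .halt

theorem At.numeralLetter_iff {m i : ℕ} {c : Letter b} {d : Numeral b}
    (h : At w m (encNumeral d)) : NumeralLetter w m i c ↔ (encNumeral d)[i]? = some c := by
  obtain ⟨l, hl, hnot⟩ : ∃ l : List (Letter b), encNumeral d = l ++ [.halt] ∧ .halt ∉ l := by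
    cases d with
    | one => exact ⟨[.one], rfl, by simp⟩
    | frac cs => exact ⟨cs.map .digit, rfl, by simp⟩
  have hh : w[m + l.length]? = some .halt := by
    rw [h _ (by simp [hl]), hl]
    simp
  constructor
  · rintro ⟨h1, h2⟩
    by_cases hi : i < (encNumeral d).length
    · rw [← h i hi, h1]
    · rw [hl, List.length_append, List.length_singleton] at hi
      have := lt_length_of_getElem? h1
      exact absurd hh (h2 l.length (by omega) (by omega))
  · intro h1
    have hi := lt_length_of_getElem? h1
    refine ⟨(h i hi).trans h1, fun j _ hj h2 => hnot ?_⟩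
    rw [h j (hj.trans hi), hl] at h2
    rw [hl, List.length_append, List.length_singleton] at hi
    rw [List.getElem?_append_left (by omega)] at h2
    exact List.mem_of_getElem? h2

theorem fo_numeralLetter {k : ℕ} {s t : (Fin k → ℕ) → ℕ} (hs : Term s) (ht : Term t)
    (c : Letter b) : FO fun w v => NumeralLetter w (s v) (t v) c :=
  .and (.getElem? (hs.add ht) c) (FO.all 0 (P := fun (w : List (Letter b)) v j => j < t v →
    ¬ w[s v + j]? = some .halt)
    (FO.imp (.lt (.var 0) ht.tail) (FO.getElem? (hs.tail.add (.var 0)) _).not))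

end Words

/-! ### Reading the encoding of the data -/

section Assertions

variable {NC NR NI : Type} {b : ℕ} (N : Naming NC NR NI) {w : List (Letter b)}

/-- The letters with which assertions start. -/
def Letter.IsTag : Letter b → Prop
  | .nameTag | .exTag | .exInvTag | .roleTag => True
  | _ => False

/-- The letter that starts the assertions with a given predicate. -/
def kindTag : Basic NC NR ⊕ NR → Letter b
  | .inl (.name _) => .nameTag
  | .inl (.ex (.name _)) => .exTag
  | .inl (.ex (.inv _)) => .exInvTag
  | .inr _ => .roleTag

/-- The name in a predicate, as a binary word. -/
def kindName : Basic NC NR ⊕ NR → List Bool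
  | .inl (.name A) => N.conc A
  | .inl (.ex (.name P)) => N.role P
  | .inl (.ex (.inv P)) => N.role P
  | .inr P => N.role P

/-- The encoding of a predicate. -/
def kindWord (κ : Basic NC NR ⊕ NR) : List (Letter b) := kindTag κ :: encWord (kindName N κ)

theorem kind_eq_of_tag_eq {κ κ' : Basic NC NR ⊕ NR}
    (h : (kindTag κ : Letter b) = kindTag κ') (h' : kindName N κ = kindName N κ') : κ = κ' := by
  rcases κ with (A | (P | P)) | P <;> rcases κ' with (A' | (P' | P')) | P' <;>
    simp only [kindTag, reduceCtorEq, kindName] at h h' ⊢ <;>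
    first
      | rw [N.conc_injective h']
      | rw [N.role_injective h']

theorem isTag_kindTag (κ : Basic NC NR ⊕ NR) : (kindTag κ : Letter b).IsTag := by
  rcases κ with (A | (P | P)) | P <;> trivial

theorem At.kindWord_iff {κ κ' : Basic NC NR ⊕ NR} {p : ℕ} (h : At w p (kindWord N κ)) :
    At w p (kindWord N κ') ↔ κ = κ' := by
  refine ⟨fun h' => ?_, fun e => e ▸ h⟩
  obtain ⟨h1, h2⟩ := at_cons.1 h
  obtain ⟨h1', h2'⟩ := at_cons.1 h'
  rw [h1] at h1'
  exact kind_eq_of_tag_eq N (Option.some_inj.1 h1') (h2.encWord_iff.1 h2')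

/-- An assertion starts at `p`. -/
def TagAt (w : List (Letter b)) (p : ℕ) : Prop :=
  ∃ c : {c : Letter b // c.IsTag}, w[p]? = some c.1

/-- The individuals and the degree of the assertion at `p` are written at `p₁`, `p₂` and `m`
(with `p₂ = p₁` for concept assertions). -/
def Fields (w : List (Letter b)) (p p₁ p₂ m : ℕ) : Prop :=
  Next w (p + 1) p₁ ∧ (w[p]? = some .roleTag ∧ Next w p₁ p₂ ∧ Next w p₂ m ∨
    ¬ w[p]? = some .roleTag ∧ p₂ = p₁ ∧ Next w p₁ m)

/-- The parts of the assertion `α` occur at the given positions. -/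
structure Locates (w : List (Letter b)) (p p₁ p₂ m : ℕ) (α : Assertion NC NR NI (Numeral b)) :
    Prop where
  kind : At w p (kindWord N α.kind)
  fst : At w p₁ (encWord (N.ind α.fst))
  snd : At w p₂ (encWord (N.ind α.snd))
  deg : At w m (encNumeral α.deg)

/-- The positions of the parts of an assertion are determined by its own position. -/
theorem At.fields {p : ℕ} {α : Assertion NC NR NI (Numeral b)}
    (h : At w p (encAssertion N α)) : ∃ x₁ x₂ y,
      (∀ p₁ p₂ m, Fields w p p₁ p₂ m ↔ p₁ = x₁ ∧ p₂ = x₂ ∧ m = y) ∧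
        Locates N w p x₁ x₂ y α := by
  cases α with
  | concept B a d =>
    have e : encAssertion N (.concept B a d) =
        kindWord N (.inl B) ++ (encWord (N.ind a) ++ encNumeral d) := by
      rcases B with A | (P | P) <;> simp [encAssertion, encBasic, kindWord, kindTag, kindName]
    rw [e, at_append, at_append] at h
    obtain ⟨h1, h2, h3⟩ := h
    obtain ⟨h4, h5⟩ := at_cons.1 h1
    have hr : ¬ w[p]? = some .roleTag := by
      rw [h4]
      rcases B with A | (P | P) <;> simp [kindTag]
    have e1 : p + 1 + (kindName N (.inl B : Basic NC NR ⊕ NR)).length + 1 =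
        p + (kindWord (b := b) N (.inl B)).length := by simp [kindWord]; omega
    refine ⟨_, _, _, fun p₁ p₂ m => ?_, h1, h2, h2, h3⟩
    unfold Fields
    rw [h5.next_iff, e1]
    refine and_congr_right fun hp => ?_
    subst hp
    simp only [hr, false_and, false_or, not_false_iff, true_and, length_encWord, h2.next_iff]
    rfl
  | role P a c d =>
    have e : encAssertion N (.role P a c d) =
        kindWord N (.inr P) ++ (encWord (N.ind a) ++ (encWord (N.ind c) ++ encNumeral d)) := by
      simp [encAssertion, kindWord, kindTag, kindName]
    rw [e, at_append, at_append, at_append] at h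
    obtain ⟨h1, h2, h3, h4⟩ := h
    obtain ⟨h5, h6⟩ := at_cons.1 h1
    have e1 : p + 1 + (kindName N (.inr P : Basic NC NR ⊕ NR)).length + 1 =
        p + (kindWord (b := b) N (.inr P)).length := by simp [kindWord]; omega
    refine ⟨_, _, _, fun p₁ p₂ m => ?_, h1, h2, h3, h4⟩
    unfold Fields
    rw [h6.next_iff, e1]
    refine and_congr_right fun hp => ?_
    subst hp
    rw [h2.next_iff]
    simp only [h5, kindTag, not_true_eq_false, false_and, or_false, true_and, length_encWord]
    refine and_congr_right fun hp => ?_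
    subst hp
    rw [length_encWord] at h3
    exact h3.next_iff

/-- The `i`-th component of the candidate tuple is written at `z`. -/
def AnsAt (w : List (Letter b)) : ℕ → ℕ → Prop
  | 0, z => ∃ y, y < w.length ∧ z = y + 1 ∧ w[y]? = some .ansTag ∧
      ∀ j, j < w.length → j < y → ¬ w[j]? = some .ansTag
  | i + 1, z => ∃ y, y < w.length ∧ AnsAt w i y ∧ ∃ x, x < w.length ∧ Next w y x ∧ z = x + 1

/-- The word contains the encodings of the assertions `A`, of the tuple `a`, and of no other
assertion. -/
structure Reads {k : ℕ} (w : List (Letter b)) (A : List (Assertion NC NR NI (Numeral b)))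
    (a : Fin k → NI) : Prop where
  exists_at : ∀ α ∈ A, ∃ p, At w p (encAssertion N α)
  of_tagAt : ∀ p, TagAt w p → ∃ α ∈ A, At w p (encAssertion N α)
  ans : ∀ i : Fin k, ∃ z, (∀ y, AnsAt w i y ↔ y = z) ∧ At w z (encWord (N.ind (a i)))

theorem mem_encWord {u : List Bool} {c : Letter b} (h : c ∈ (encWord u : List (Letter b))) :
    (∃ v, c = .bit v) ∨ c = .sep := by
  simp only [encWord, List.mem_append, List.mem_map, List.mem_singleton] at h
  rcases h with ⟨v, _, rfl⟩ | rfl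
  · exact .inl ⟨v, rfl⟩
  · exact .inr rfl

theorem mem_encNumeral {d : Numeral b} {c : Letter b} (h : c ∈ encNumeral d) :
    (∃ x, c = .digit x) ∨ c = .one ∨ c = .halt := by
  cases d with
  | one => exact .inr (by simpa [encNumeral] using h)
  | frac cs =>
    simp only [encNumeral, List.mem_append, List.mem_map, List.mem_singleton] at h
    rcases h with ⟨x, _, rfl⟩ | rfl
    · exact .inl ⟨x, rfl⟩
    · exact .inr (.inr rfl)

/-- An encoded assertion consists of its tag and letters that are not tags. -/
theorem encAssertion_eq_cons (α : Assertion NC NR NI (Numeral b)) :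
    ∃ l, encAssertion N α = kindTag α.kind :: l ∧
      ∀ c ∈ l, ¬ c.IsTag ∧ c ≠ .ansTag ∧ c ≠ .degTag := by
  have hw : ∀ (u : List Bool) (c : Letter b), c ∈ (encWord u : List (Letter b)) →
      ¬ c.IsTag ∧ c ≠ .ansTag ∧ c ≠ .degTag := by
    intro u c h
    rcases mem_encWord h with ⟨v, rfl⟩ | rfl <;> simp [Letter.IsTag]
  have hn : ∀ (d : Numeral b) (c : Letter b), c ∈ encNumeral d →
      ¬ c.IsTag ∧ c ≠ .ansTag ∧ c ≠ .degTag := by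
    intro d c h
    rcases mem_encNumeral h with ⟨v, rfl⟩ | rfl | rfl <;> simp [Letter.IsTag]
  cases α with
  | concept B a d =>
    refine ⟨encWord (kindName N (.inl B)) ++ (encWord (N.ind a) ++ encNumeral d), ?_, ?_⟩
    · rcases B with A | (P | P) <;>
        simp [encAssertion, encBasic, kindTag, kindName, Assertion.kind]
    · intro c hc
      simp only [List.mem_append] at hc
      rcases hc with hc | hc | hc <;> first | exact hw _ _ hc | exact hn _ _ hc
  | role P a a' d =>
    refine ⟨encWord (N.role P) ++ (encWord (N.ind a) ++ (encWord (N.ind a') ++ encNumeral d)),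
      ?_, ?_⟩
    · simp [encAssertion, kindTag, Assertion.kind]
    · intro c hc
      simp only [List.mem_append] at hc
      rcases hc with hc | hc | hc | hc <;> first | exact hw _ _ hc | exact hn _ _ hc

/-- Tags only occur at the beginning of assertions. -/
theorem exists_at_of_tag {r : List (Letter b)} (hr : ∀ c ∈ r, ¬ c.IsTag) :
    ∀ (A : List (Assertion NC NR NI (Numeral b))) {p : ℕ} {c : Letter b}, c.IsTag →
      (A.flatMap (encAssertion N) ++ r)[p]? = some c →
      ∃ α ∈ A, At (A.flatMap (encAssertion N) ++ r) p (encAssertion N α) := by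
  intro A
  induction A with
  | nil =>
    intro p c hc h
    exact absurd hc (hr c (List.mem_of_getElem? h))
  | cons α A ih =>
    intro p c hc h
    rw [List.flatMap_cons, List.append_assoc] at h ⊢
    by_cases hp : p < (encAssertion N α).length
    · obtain ⟨l, hl, hnt⟩ := encAssertion_eq_cons N α
      rw [List.getElem?_append_left hp, hl] at h
      cases p with
      | zero => exact ⟨α, by simp, at_of_append [] _ _⟩
      | succ p =>
        rw [List.getElem?_cons_succ] at h
        exact absurd hc (hnt c (List.mem_of_getElem? h)).1
    · rw [List.getElem?_append_right (not_lt.1 hp)] at h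
      obtain ⟨β, hβ, hat⟩ := ih hc h
      refine ⟨β, List.mem_cons_of_mem _ hβ, ?_⟩
      have := hat.shift (l := encAssertion N α)
      rwa [Nat.add_sub_cancel' (not_lt.1 hp)] at this

theorem ansAt_iff {pre r : List (Letter b)} (hpre : ∀ c ∈ pre, c ≠ .ansTag) (l : List NI) (i : ℕ)
    (hi : i < l.length) : ∃ z,
      (∀ y, AnsAt (pre ++ ((l.flatMap fun c => .ansTag :: encWord (N.ind c)) ++ r)) i y ↔
        y = z) ∧
      At (pre ++ ((l.flatMap fun c => .ansTag :: encWord (N.ind c)) ++ r)) z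
        (encWord (N.ind l[i])) := by
  generalize hw : pre ++ ((l.flatMap fun c => .ansTag :: encWord (N.ind c)) ++ r) = w
  have hat : ∀ i (hi : i < l.length), At w (pre.length + ((l.take i).flatMap fun c =>
      (.ansTag :: encWord (N.ind c) : List (Letter b))).length)
        (.ansTag :: encWord (N.ind l[i])) := by
    intro i hi
    have e : w = (pre ++ (l.take i).flatMap fun c => .ansTag :: encWord (N.ind c)) ++
        ((.ansTag :: encWord (N.ind l[i])) ++
          (((l.drop (i + 1)).flatMap fun c => .ansTag :: encWord (N.ind c)) ++ r)) := by
      rw [← hw]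
      conv_lhs => rw [← List.take_append_drop i l, List.drop_eq_getElem_cons hi]
      simp only [List.flatMap_append, List.flatMap_cons, List.append_assoc, List.cons_append]
    rw [e, ← List.length_append]
    exact at_of_append _ _ _
  refine ⟨_, ?_, (at_cons.1 (hat i hi)).2⟩
  induction i with
  | zero =>
    have h0 := (at_cons.1 (hat 0 hi)).1
    simp only [List.take_zero, List.flatMap_nil, List.length_nil, Nat.add_zero] at h0 ⊢
    have hlt : ∀ j < pre.length, ¬ w[j]? = some .ansTag := by
      intro j hj h
      rw [← hw, List.getElem?_append_left hj] at h
      exact hpre _ (List.mem_of_getElem? h) rfl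
    intro y
    constructor
    · rintro ⟨x, hx, rfl, h1, h2⟩
      rcases lt_trichotomy x pre.length with h | h | h
      · exact absurd h1 (hlt x h)
      · rw [h]
      · exact absurd h0 (h2 _ (by omega) h)
    · rintro rfl
      exact ⟨_, lt_length_of_getElem? h0, rfl, h0, fun j _ hj => hlt j hj⟩
  | succ i ih =>
    have hi' : i < l.length := by omega
    have h1 := (at_cons.1 (hat i hi')).2
    have h2 := (at_cons.1 (hat (i + 1) hi)).1
    have e : ((l.take (i + 1)).flatMap fun c =>
        (.ansTag :: encWord (N.ind c) : List (Letter b))).length =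
        ((l.take i).flatMap fun c => (.ansTag :: encWord (N.ind c) : List (Letter b))).length +
          ((N.ind l[i]).length + 2) := by
      rw [List.take_succ_eq_append_getElem hi', List.flatMap_append, List.length_append]
      simp
    intro y
    rw [e] at h2 ⊢
    have hlen := lt_length_of_getElem? h2
    constructor
    · rintro ⟨y', _, hy', x, _, hx, rfl⟩
      rw [ih hi'] at hy'
      subst hy'
      rw [h1.next_iff] at hx
      omega
    · rintro rfl
      refine ⟨_, ?_, (ih hi' _).2 rfl, _, hlen, h1.next_iff.2 ?_, rfl⟩ <;> omega

theorem reads_append {k : ℕ} (A : List (Assertion NC NR NI (Numeral b))) (a : Fin k → NI)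
    {r : List (Letter b)} (hr : ∀ c ∈ r, ¬ c.IsTag) : Reads N (encInput N A a ++ r) A a := by
  have hseg : ∀ c ∈ ((List.ofFn a).flatMap fun c =>
      (.ansTag :: encWord (N.ind c) : List (Letter b))) ++ r, ¬ c.IsTag := by
    intro c hc
    rcases List.mem_append.1 hc with hc | hc
    · obtain ⟨x, _, hx⟩ := List.mem_flatMap.1 hc
      rcases List.mem_cons.1 hx with rfl | hx
      · simp [Letter.IsTag]
      · rcases mem_encWord hx with ⟨v, rfl⟩ | rfl <;> simp [Letter.IsTag]
    · exact hr c hc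
  have hpre : ∀ c ∈ A.flatMap (encAssertion N), c ≠ .ansTag := by
    intro c hc
    obtain ⟨α, _, hα⟩ := List.mem_flatMap.1 hc
    obtain ⟨l, hl, h⟩ := encAssertion_eq_cons N α
    rw [hl] at hα
    rcases List.mem_cons.1 hα with rfl | hα
    · rintro h
      have := isTag_kindTag (b := b) α.kind
      rw [h] at this
      exact this
    · exact (h c hα).2.1
  unfold encInput
  rw [List.append_assoc]
  refine ⟨fun α hα => ?_, ?_, fun i => ?_⟩
  · obtain ⟨s, t, rfl⟩ := List.append_of_mem hα
    refine ⟨(s.flatMap (encAssertion N)).length, ?_⟩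
    rw [List.flatMap_append, List.flatMap_cons, List.append_assoc, List.append_assoc]
    exact at_of_append _ _ _
  · rintro p ⟨c, hc⟩
    exact exists_at_of_tag N hseg A c.2 hc
  · obtain ⟨z, h1, h2⟩ := ansAt_iff N (r := r) hpre (List.ofFn a) i (by simp)
    refine ⟨z, h1, ?_⟩
    simpa using h2

theorem degTag_iff {k : ℕ} (A : List (Assertion NC NR NI (Numeral b))) (a : Fin k → NI)
    (d : Numeral b) (p : ℕ) :
    (encInputDeg N A a d)[p]? = some .degTag ↔ p = (encInput N A a).length := by
  have h1 : ∀ c ∈ encInput N A a, c ≠ .degTag := by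
    intro c hc
    rcases List.mem_append.1 hc with hc | hc
    · obtain ⟨α, _, hα⟩ := List.mem_flatMap.1 hc
      obtain ⟨l, hl, h⟩ := encAssertion_eq_cons N α
      rw [hl] at hα
      rcases List.mem_cons.1 hα with rfl | hα
      · rintro h
        have := isTag_kindTag (b := b) α.kind
        rw [h] at this
        exact this
      · exact (h c hα).2.2
    · obtain ⟨x, _, hx⟩ := List.mem_flatMap.1 hc
      rcases List.mem_cons.1 hx with rfl | hx
      · simp
      · rcases mem_encWord hx with ⟨v, rfl⟩ | rfl <;> simp
  have h2 : ∀ c ∈ encNumeral d, c ≠ .degTag := by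
    intro c hc
    rcases mem_encNumeral hc with ⟨v, rfl⟩ | rfl | rfl <;> simp
  unfold encInputDeg
  rcases lt_trichotomy p (encInput N A a).length with h | h | h
  · rw [List.getElem?_append_left h]
    exact ⟨fun h' => absurd rfl (h1 _ (List.mem_of_getElem? h')), fun h' => absurd h' h.ne⟩
  · simp [h]
  · rw [List.getElem?_append_right h.le]
    obtain ⟨j, hj⟩ := Nat.exists_eq_add_of_lt h
    rw [show p - (encInput N A a).length = j + 1 by omega, List.getElem?_cons_succ]
    exact ⟨fun h' => absurd rfl (h2 _ (List.mem_of_getElem? h')), fun h' => absurd h' h.ne'⟩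

theorem reads_encInput {k : ℕ} (A : List (Assertion NC NR NI (Numeral b))) (a : Fin k → NI) :
    Reads N (encInput N A a) A a := by
  simpa using reads_append N A a (r := []) (by simp)

theorem reads_encInputDeg {k : ℕ} (A : List (Assertion NC NR NI (Numeral b))) (a : Fin k → NI)
    (d : Numeral b) : Reads N (encInputDeg N A a d) A a := by
  refine reads_append N A a fun c hc => ?_
  rcases List.mem_cons.1 hc with rfl | hc
  · simp [Letter.IsTag]
  · rcases mem_encNumeral hc with ⟨v, rfl⟩ | rfl | rfl <;> simp [Letter.IsTag]

theorem at_numeral_encInputDeg {k : ℕ} (A : List (Assertion NC NR NI (Numeral b)))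
    (a : Fin k → NI) (d : Numeral b) :
    At (encInputDeg N A a d) ((encInput N A a).length + 1) (encNumeral d) := by
  have h := at_of_append (encInput N A a) (.degTag :: encNumeral d) []
  rw [List.append_nil] at h
  exact (at_cons.1 h).2

section FO

variable {k : ℕ} {t t₁ t₂ t₃ : (Fin k → ℕ) → ℕ}

theorem fo_tagAt (ht : Term t) : FO fun (w : List (Letter b)) v => TagAt w (t v) :=
  FO.exists_finite fun _ => .getElem? ht _

theorem fo_fields (ht : Term t) (h₁ : Term t₁) (h₂ : Term t₂) (h₃ : Term t₃) :
    FO fun (w : List (Letter b)) v => Fields w (t v) (t₁ v) (t₂ v) (t₃ v) :=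
  (fo_next (ht.add (.const 1)) h₁).and
    (((FO.getElem? ht _).and ((fo_next h₁ h₂).and (fo_next h₂ h₃))).or
      ((FO.getElem? ht _).not.and ((FO.eq' h₂ h₁).and (fo_next h₁ h₃))))

theorem fo_ansAt (i : ℕ) : ∀ {k : ℕ} {t : (Fin k → ℕ) → ℕ}, Term t →
    FO fun (w : List (Letter b)) v => AnsAt w i (t v) := by
  induction i with
  | zero =>
    intro k t ht
    refine FO.ex 0 (P := fun (w : List (Letter b)) v y => t v = y + 1 ∧ w[y]? = some .ansTag ∧
      ∀ j, j < w.length → j < y → ¬ w[j]? = some .ansTag)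
      (.and (.eq' ht.tail ((Term.var 0).add (.const 1))) (.and (.getElem? (.var 0) _) ?_))
    exact FO.all 0 (P := fun (w : List (Letter b)) v j => j < v 0 → ¬ w[j]? = some .ansTag)
      (FO.imp (.lt (.var 0) (.var 1)) (FO.getElem? (.var 0) _).not)
  | succ i ih =>
    intro k t ht
    refine FO.ex 0 (P := fun (w : List (Letter b)) v y => AnsAt w i y ∧
      ∃ x, x < w.length ∧ Next w y x ∧ t v = x + 1) (.and (ih (.var 0)) ?_)
    exact FO.ex 0 (P := fun (w : List (Letter b)) v x => Next w (v 0) x ∧ t (Fin.tail v) = x + 1)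
      (.and (fo_next (.var 1) (.var 0)) (.eq' ht.tail.tail ((Term.var 0).add (.const 1))))

end FO

end Assertions

/-! ### First-order formulas for entailment -/

section Patterns

variable {NC NR NI : Type} {b k : ℕ}

/-- The data that determine whether some assertions, one for each query atom, entail the query:
which of the relevant predicates the assertions have, which slots name the same individual, and
which slots name which individuals of the query. -/
abbrev PatternIndex (X : Set (Basic NC NR)) (q : CQ NC NR NI k) : Type :=
  (Fin q.atoms.length × {κ : Basic NC NR ⊕ NR // kindBasic κ ∈ X}) ⊕
    ((Fin q.atoms.length ⊕ Fin q.atoms.length ⊕ Fin k) ×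
      (Fin q.atoms.length ⊕ Fin q.atoms.length ⊕ Fin k)) ⊕
    (Fin q.atoms.length ⊕ Fin q.atoms.length ⊕ Fin k) ×
      {c : NI // c ∈ q.atoms.flatMap Atom.inds}

theorem finite_patternIndex {X : Set (Basic NC NR)} (hX : X.Finite) (q : CQ NC NR NI k) :
    Finite (PatternIndex X q) := by
  have h1 : {κ : Basic NC NR ⊕ NR | kindBasic κ ∈ X}.Finite := by
    have hinj : Function.Injective fun P : NR => (Basic.ex (.name P) : Basic NC NR) := by
      intro P P' h
      simpa using h
    refine ((hX.image Sum.inl).union ((hX.preimage hinj.injOn).image Sum.inr)).subset ?_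
    rintro (B | P) h
    · exact .inl ⟨B, h, rfl⟩
    · exact .inr ⟨P, h, rfl⟩
  have := h1.to_subtype
  have : Finite {κ : Basic NC NR ⊕ NR // kindBasic κ ∈ X} := this
  have : Finite {c : NI // c ∈ q.atoms.flatMap Atom.inds} :=
    (List.finite_toSet (q.atoms.flatMap Atom.inds)).to_subtype
  infer_instance

/-- The pattern of a family of assertions and a tuple. -/
def pattern (X : Set (Basic NC NR)) (q : CQ NC NR NI k)
    (α : Fin q.atoms.length → Assertion NC NR NI Degree) (a : Fin k → NI) :
    PatternIndex X q → Prop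
  | .inl (i, κ) => (α i).kind = κ.1
  | .inr (.inl (s, t)) => slotInd α a s = slotInd α a t
  | .inr (.inr (s, c)) => slotInd α a s = c.1

/-- The patterns of relevant assertions that entail the query. -/
def goodPatterns (X : Set (Basic NC NR)) (T : Set (Inclusion NC NR)) (q : CQ NC NR NI k) :
    Set (PatternIndex X q → Prop) :=
  {f | ∃ α a, (∀ i, kindBasic (α i).kind ∈ X) ∧ pattern X q α a = f ∧
    ChaseEntails T (Set.range α) q a}

/-- Whether a family of assertions entails the query can be read off its pattern. -/
theorem pattern_mem_goodPatterns {X : Set (Basic NC NR)} {T : Set (Inclusion NC NR)}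
    {q : CQ NC NR NI k} {α : Fin q.atoms.length → Assertion NC NR NI Degree} {a : Fin k → NI} :
    pattern X q α a ∈ goodPatterns X T q ↔
      (∀ i, kindBasic (α i).kind ∈ X) ∧ ChaseEntails T (Set.range α) q a := by
  constructor
  · rintro ⟨α', a', hX, hp, hE⟩
    have hk : ∀ i, (α' i).kind = (α i).kind := fun i =>
      ((congrFun hp (.inl (i, ⟨_, hX i⟩))).mp rfl).symm
    refine ⟨fun i => hk i ▸ hX i, hE.of_pattern hk (fun s t => ?_) fun s β hβ c hc => ?_⟩
    · exact iff_of_eq (congrFun hp (.inr (.inl (s, t))))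
    · exact iff_of_eq (congrFun hp (.inr (.inr (s, ⟨c, List.mem_flatMap.2 ⟨β, hβ, hc⟩⟩))))
  · rintro ⟨h1, h2⟩
    exact ⟨α, a, h1, rfl, h2⟩

/-- The position at which the individual of a slot is written. -/
def slotPos {ι : Type} (p₁ p₂ : ι → ℕ) (z : Fin k → ℕ) : ι ⊕ ι ⊕ Fin k → ℕ
  | .inl i => p₁ i
  | .inr (.inl i) => p₂ i
  | .inr (.inr i) => z i

/-- The pattern of assertions and a tuple that are written at given positions of a word. -/
def wordPattern (N : Naming NC NR NI) (X : Set (Basic NC NR)) (q : CQ NC NR NI k)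
    (w : List (Letter b)) (p p₁ p₂ : Fin q.atoms.length → ℕ) (z : Fin k → ℕ) :
    PatternIndex X q → Prop
  | .inl (i, κ) => At w (p i) (kindWord N κ.1)
  | .inr (.inl (s, t)) => SameWord w (slotPos p₁ p₂ z s) (slotPos p₁ p₂ z t)
  | .inr (.inr (s, c)) => At w (slotPos p₁ p₂ z s) (encWord (N.ind c.1))

theorem wordPattern_eq {N : Naming NC NR NI} {X : Set (Basic NC NR)} {q : CQ NC NR NI k}
    {w : List (Letter b)} {p p₁ p₂ m : Fin q.atoms.length → ℕ} {z : Fin k → ℕ}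
    {α : Fin q.atoms.length → Assertion NC NR NI (Numeral b)} {a : Fin k → NI}
    (hα : ∀ i, Locates N w (p i) (p₁ i) (p₂ i) (m i) (α i))
    (ha : ∀ i, At w (z i) (encWord (N.ind (a i)))) :
    wordPattern N X q w p p₁ p₂ z = pattern X q (fun i => (α i).map Numeral.val) a := by
  have hs : ∀ s, At w (slotPos p₁ p₂ z s)
      (encWord (N.ind (slotInd (fun i => (α i).map Numeral.val) a s))) := by
    rintro (i | i | i)
    · simpa [slotPos, slotInd] using (hα i).fst
    · simpa [slotPos, slotInd] using (hα i).snd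
    · exact ha i
  funext x
  rcases x with ⟨i, κ⟩ | ⟨s, t⟩ | ⟨s, c⟩
  · refine propext (((hα i).kind.kindWord_iff N).trans ?_)
    simp [pattern]
  · exact propext (((hs s).sameWord_iff (hs t)).trans N.ind_injective.eq_iff)
  · exact propext ((hs s).encWord_iff.trans N.ind_injective.eq_iff)

end Patterns

section Formulas

variable {NC NR NI : Type} {b k : ℕ}

/-- The constants of the formulas for a fixed TBox and query: a finite set `X` of basic concepts,
closed under inverses, that contains those of the query and of the left-hand sides of the TBox;
numerals `cst` for `0`, `1` and the degrees of the TBox; and a bound `K` for their lengths. -/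
structure QuerySetup (N : Naming NC NR NI) (b : ℕ) (T : Set (Inclusion NC NR))
    (q : CQ NC NR NI k) where
  two_le : 2 ≤ b
  X : Set (Basic NC NR)
  X_finite : X.Finite
  lhs_mem : ∀ α ∈ T, α.lhs ∈ X
  flip_mem : ∀ B ∈ X, B.flip ∈ X
  basic_mem : ∀ α ∈ q.atoms, α.basic ∈ X
  J : ℕ
  cst : Fin J → Numeral b
  exists_cst : ∀ x ∈ insert 0 (insert 1 (Inclusion.degree '' T)), ∃ j, (cst j).val = x
  K : ℕ
  length_cst : ∀ j, (encNumeral (cst j)).length ≤ K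

theorem Numeral.val_zero : (Numeral.frac [] : Numeral b).val = 0 := Subtype.ext rfl

theorem exists_querySetup (N : Naming NC NR NI) (hb : 2 ≤ b) {T : Set (Inclusion NC NR)}
    (hT : T.Finite) (hdeg : ∀ α ∈ T, ∃ c : Numeral b, c.val = α.degree) (q : CQ NC NR NI k) :
    Nonempty (QuerySetup N b T q) := by
  classical
  let Y : Set (Basic NC NR) := Inclusion.lhs '' T ∪ {B | B ∈ q.atoms.map Atom.basic}
  have hY : Y.Finite := (hT.image _).union (List.finite_toSet _)
  have hval : ∀ x : (insert 0 (insert 1 (Inclusion.degree '' T)) : Set Degree),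
      ∃ c : Numeral b, c.val = x := by
    rintro ⟨x, rfl | rfl | ⟨α, hα, rfl⟩⟩
    · exact ⟨.frac [], Numeral.val_zero⟩
    · exact ⟨.one, rfl⟩
    · exact hdeg α hα
  choose c hc using hval
  have hfin : (insert 0 (insert 1 (Inclusion.degree '' T)) : Set Degree).Finite :=
    ((hT.image _).insert 1).insert 0
  have := hfin.to_subtype
  obtain ⟨J, ⟨e⟩⟩ :=
    Finite.exists_equiv_fin (insert 0 (insert 1 (Inclusion.degree '' T)) : Set Degree)
  exact ⟨{
    two_le := hb
    X := Y ∪ Basic.flip '' Y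
    X_finite := hY.union (hY.image _)
    lhs_mem := fun α hα => .inl (.inl ⟨α, hα, rfl⟩)
    flip_mem := by
      rintro B (hB | ⟨B, hB, rfl⟩)
      · exact .inr ⟨B, hB, rfl⟩
      · exact .inl (by rwa [Basic.flip_flip])
    basic_mem := fun α hα => .inl (.inr (List.mem_map_of_mem hα))
    J := J
    cst := fun j => c (e.symm j)
    exists_cst := fun x hx => ⟨e ⟨x, hx⟩, by rw [e.symm_apply_apply, hc]⟩
    K := Finset.univ.sup fun j => (encNumeral (c (e.symm j))).length
    length_cst := fun j => Finset.le_sup (f := fun j => (encNumeral (c (e.symm j))).length)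
      (Finset.mem_univ j) }⟩

variable {N : Naming NC NR NI} {T : Set (Inclusion NC NR)} {q : CQ NC NR NI k}

namespace QuerySetup

variable (S : QuerySetup N b T q)

/-- The query is entailed by the inclusions `T'` and the assertions of the word whose degree is not
below the degree with the digits `D`. -/
def Cut (T' : Set (Inclusion NC NR)) (w : List (Letter b)) (D : ℕ → ℕ) : Prop :=
  ∃ z : Fin k → ℕ, (∀ i, z i < w.length) ∧ ((∀ i : Fin k, AnsAt w i (z i)) ∧
    ∃ p : Fin q.atoms.length → ℕ, (∀ i, p i < w.length) ∧
    ∃ p₁ : Fin q.atoms.length → ℕ, (∀ i, p₁ i < w.length) ∧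
    ∃ p₂ : Fin q.atoms.length → ℕ, (∀ i, p₂ i < w.length) ∧
    ∃ m : Fin q.atoms.length → ℕ, (∀ i, m i < w.length) ∧
      ((∀ i, TagAt w (p i) ∧ Fields w (p i) (p₁ i) (p₂ i) (m i) ∧
        ¬ NumLt S.K w (wordDig w (m i)) D) ∧
      wordPattern N S.X q w p p₁ p₂ z ∈ goodPatterns S.X T' q))

/-- The query is entailed to the degree with the digits `D`: this degree is `0`, or the cut at it
entails the query. The cut of the TBox is determined by the set `f` of the constants in it. -/
def Entails (w : List (Letter b)) (D : ℕ → ℕ) : Prop :=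
  ¬ NumLt S.K w (Numeral.frac [] : Numeral b).dig D ∨
  ∃ f : Fin S.J → Prop, (∀ j, ¬ NumLt S.K w (S.cst j).dig D ↔ f j) ∧
    S.Cut {α ∈ T | ∃ j, (S.cst j).val = α.degree ∧ f j} w D

/-- The numeral of an assertion is written at `m`. -/
def NumeralAt (w : List (Letter b)) (m : ℕ) : Prop :=
  ∃ p, p < w.length ∧ ∃ p₁, p₁ < w.length ∧ ∃ p₂, p₂ < w.length ∧
    (TagAt w p ∧ Fields w p p₁ p₂ m)

/-- The degree with the digits `D` is the degree of the answer. -/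
def IsAns (w : List (Letter b)) (D : ℕ → ℕ) : Prop :=
  S.Entails w D ∧ (∀ j, NumLt S.K w D (S.cst j).dig → ¬ S.Entails w (S.cst j).dig) ∧
    ∀ m, m < w.length → NumeralAt w m → NumLt S.K w D (wordDig w m) →
      ¬ S.Entails w (wordDig w m)

/-- The `i`-th letter of the degree of the answer is `c`. To have a definite numeral, the first
suitable constant is preferred, and otherwise the first suitable numeral of the word. -/
def Output (c : Letter b) (w : List (Letter b)) (i : ℕ) : Prop :=
  (∃ j, S.IsAns w (S.cst j).dig ∧ (∀ j' : {j' // j' < j}, ¬ S.IsAns w (S.cst j'.1).dig) ∧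
    (encNumeral (S.cst j))[i]? = some c) ∨
  (∀ j, ¬ S.IsAns w (S.cst j).dig) ∧ ∃ m, m < w.length ∧
    ((NumeralAt w m ∧ S.IsAns w (wordDig w m)) ∧
      (∀ m', m' < w.length → m' < m → ¬ (NumeralAt w m' ∧ S.IsAns w (wordDig w m'))) ∧
      NumeralLetter w m i c)

end QuerySetup

end Formulas

/-! ### First-order definability of the formulas -/

section Definability

variable {NC NR NI : Type} {b k : ℕ} {N : Naming NC NR NI} {T : Set (Inclusion NC NR)}
  {q : CQ NC NR NI k}

namespace QuerySetup

variable (S : QuerySetup N b T q) {n : ℕ} {D D' : List (Letter b) → (Fin n → ℕ) → ℕ → ℕ}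

theorem dig_cst_eq_zero (j : Fin S.J) {i : ℕ} (hi : S.K ≤ i) : (S.cst j).dig i = 0 :=
  (S.cst j).dig_eq_zero ((S.length_cst j).trans hi)

theorem foDigits_cst (j : Fin S.J) :
    FODigits fun (_ : List (Letter b)) (_ : Fin n → ℕ) => (S.cst j).dig :=
  .const fun _ => S.dig_cst_eq_zero j

theorem fo_numLt (hD : FODigits D) (hB : ∀ w v i, D w v i < b) (hD' : FODigits D')
    (hB' : ∀ w v i, D' w v i < b) : FO fun w v => NumLt S.K w (D w v) (D' w v) :=
  hD.numLt S.K hD' hB hB'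

theorem fo_cut (T' : Set (Inclusion NC NR)) (hD : FODigits D) (hB : ∀ w v i, D w v i < b) :
    FO fun w v => S.Cut T' w (D w v) := by
  have := finite_patternIndex S.X_finite q
  refine FO.exVec (.and (FO.forall_finite fun i => fo_ansAt _ (.var _)) ?_)
  refine FO.exVec (FO.exVec (FO.exVec (FO.exVec (.and (FO.forall_finite fun i => ?_) ?_))))
  · refine .and (fo_tagAt (.var _)) (.and (fo_fields (.var _) (.var _) (.var _) (.var _)) ?_)
    exact (S.fo_numLt (foDigits_wordDig (.var _)) (fun w v => wordDig_lt S.two_le w _)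
      (hD.subst fun _ => .var _) fun w v => hB w _).not
  · refine FO.pattern (P := fun x w u => wordPattern N S.X q w _ _ _ _ x) ?_ _
    have hs : ∀ s : Fin q.atoms.length ⊕ Fin q.atoms.length ⊕ Fin k,
        Term fun u : Fin (q.atoms.length + (q.atoms.length + (q.atoms.length +
          (q.atoms.length + (k + n))))) → ℕ => slotPos
            (fun i => u (Fin.natAdd _ (Fin.natAdd _ (Fin.castAdd _ i))))
            (fun i => u (Fin.natAdd _ (Fin.castAdd _ i)))
            (fun i => u (Fin.natAdd _ (Fin.natAdd _ (Fin.natAdd _ (Fin.natAdd _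
              (Fin.castAdd _ i)))))) s := by
      rintro (i | i | i) <;> exact .var _
    rintro (⟨i, κ⟩ | ⟨s, t⟩ | ⟨s, c⟩)
    · exact fo_at (.var _) _
    · exact fo_sameWord (hs s) (hs t)
    · exact fo_at (hs s) _

theorem fo_entails (hD : FODigits D) (hB : ∀ w v i, D w v i < b) :
    FO fun w v => S.Entails w (D w v) := by
  refine .or (S.fo_numLt (.const (K := 1) fun i hi => ?_)
    (fun _ _ => Numeral.dig_lt S.two_le _) hD hB).not
    (FO.exists_finite fun f => .and (FO.forall_finite fun j =>
      (S.fo_numLt (S.foDigits_cst j) (fun _ _ => Numeral.dig_lt S.two_le _) hD hB).not.iff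
        (.const _)) (S.fo_cut _ hD hB))
  exact Numeral.dig_eq_zero _ (by simpa [encNumeral] using hi)

theorem fo_numeralAt {t : (Fin n → ℕ) → ℕ} (ht : Term t) :
    FO fun (w : List (Letter b)) v => NumeralAt w (t v) := by
  refine FO.ex 0 (P := fun w v p => ∃ p₁, p₁ < w.length ∧ ∃ p₂, p₂ < w.length ∧
    (TagAt w p ∧ Fields w p p₁ p₂ (t v))) ?_
  refine FO.ex 0 (P := fun w v p₁ => ∃ p₂, p₂ < w.length ∧
    (TagAt w (v 0) ∧ Fields w (v 0) p₁ p₂ (t (Fin.tail v)))) ?_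
  exact FO.ex 0 (P := fun w v p₂ => TagAt w (v 1) ∧
    Fields w (v 1) (v 0) p₂ (t (Fin.tail (Fin.tail v))))
    (.and (fo_tagAt (.var 2)) (fo_fields (.var 2) (.var 1) (.var 0) ht.tail.tail.tail))

theorem fo_isAns (hD : FODigits D) (hB : ∀ w v i, D w v i < b) :
    FO fun w v => S.IsAns w (D w v) := by
  have hc : ∀ j : Fin S.J, ∀ (_ : List (Letter b)) (_ : Fin n → ℕ) i, (S.cst j).dig i < b :=
    fun j _ _ => Numeral.dig_lt S.two_le _
  refine .and (S.fo_entails hD hB) (.and (FO.forall_finite fun j => .imp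
    (S.fo_numLt hD hB (S.foDigits_cst j) (hc j))
    (S.fo_entails (S.foDigits_cst j) (hc j)).not) ?_)
  have hw : ∀ (w : List (Letter b)) (v : Fin (n + 1) → ℕ) i, wordDig w (v 0) i < b :=
    fun w v => wordDig_lt S.two_le w _
  exact FO.all 0 (P := fun w v m => NumeralAt w m → NumLt S.K w (D w v) (wordDig w m) →
    ¬ S.Entails w (wordDig w m)) (.imp (fo_numeralAt (.var 0)) (.imp
      (S.fo_numLt hD.tail (fun w v => hB w _) (foDigits_wordDig (.var 0)) hw)
      (S.fo_entails (foDigits_wordDig (.var 0)) hw).not))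

theorem fo_output (c : Letter b) {t : (Fin n → ℕ) → ℕ} (ht : Term t) :
    FO fun w v => S.Output c w (t v) := by
  have hc : ∀ {n : ℕ} (j : Fin S.J), FO fun w (_ : Fin n → ℕ) => S.IsAns w (S.cst j).dig :=
    fun j => S.fo_isAns (S.foDigits_cst j) fun _ _ => Numeral.dig_lt S.two_le _
  have hw : ∀ {n : ℕ} {t : (Fin n → ℕ) → ℕ}, Term t →
      FO fun (w : List (Letter b)) v => NumeralAt w (t v) ∧ S.IsAns w (wordDig w (t v)) :=
    fun ht => (fo_numeralAt ht).and
      (S.fo_isAns (foDigits_wordDig ht) fun w _ => wordDig_lt S.two_le w _)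
  refine .or (FO.exists_finite fun j => .and (hc j) (.and (FO.forall_finite fun j' =>
    (hc j'.1).not) ?_)) (.and (FO.forall_finite fun j => (hc j).not) ?_)
  · refine (FO.exists_finite (ι := Fin (encNumeral (S.cst j)).length) fun i =>
      (FO.eq' ht (.const i.val)).and (.const ((encNumeral (S.cst j))[i] = c))).of_iff
        fun w v => ?_
    rw [List.getElem?_eq_some_iff]
    constructor
    · rintro ⟨hi, h⟩
      exact ⟨⟨_, hi⟩, rfl, h⟩
    · rintro ⟨i, h1, h2⟩
      exact ⟨h1 ▸ i.isLt, by simp only [h1]; exact h2⟩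
  · refine FO.ex 0 (P := fun w v m => (NumeralAt w m ∧ S.IsAns w (wordDig w m)) ∧
      (∀ m', m' < w.length → m' < m → ¬ (NumeralAt w m' ∧ S.IsAns w (wordDig w m'))) ∧
      NumeralLetter w m (t v) c)
      (.and (hw (.var 0)) (.and ?_ (fo_numeralLetter (.var 0) ht.tail c)))
    exact FO.all 0 (P := fun w v m' => m' < v 0 →
      ¬ (NumeralAt w m' ∧ S.IsAns w (wordDig w m')))
      (.imp (.lt (.var 0) (.var 1)) (hw (.var 0)).not)

end QuerySetup

end Definability

/-! ### Correctness of the formulas -/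

section Correctness

variable {NC NR NI : Type} {b k : ℕ} {N : Naming NC NR NI} {T : Set (Inclusion NC NR)}
  {q : CQ NC NR NI k} {w : List (Letter b)} {A : List (Assertion NC NR NI (Numeral b))}
  {a : Fin k → NI}

theorem At.length_le {S : Type} {w u : List S} {p : ℕ} (h : At w p u) (hu : u ≠ []) :
    p + u.length ≤ w.length := by
  have h0 : 0 < u.length := List.length_pos_of_ne_nil hu
  have h1 := h (u.length - 1) (by omega)
  rw [List.getElem?_eq_getElem (l := u) (by omega)] at h1
  have := lt_length_of_getElem? h1
  omega

theorem encNumeral_ne_nil (d : Numeral b) : encNumeral d ≠ [] := by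
  cases d <;> simp [encNumeral]

theorem Reads.locates (hR : Reads N w A a) {p p₁ p₂ m : ℕ} (hp : TagAt w p)
    (hF : Fields w p p₁ p₂ m) : ∃ α ∈ A, Locates N w p p₁ p₂ m α := by
  obtain ⟨α, hα, hat⟩ := hR.of_tagAt p hp
  obtain ⟨x₁, x₂, y, hiff, hL⟩ := hat.fields
  obtain ⟨rfl, rfl, rfl⟩ := (hiff _ _ _).1 hF
  exact ⟨α, hα, hL⟩

theorem Reads.exists_locates (hR : Reads N w A a) {α : Assertion NC NR NI (Numeral b)}
    (hα : α ∈ A) : ∃ p p₁ p₂ m, p < w.length ∧ p₁ < w.length ∧ p₂ < w.length ∧ m < w.length ∧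
      TagAt w p ∧ Fields w p p₁ p₂ m ∧ Locates N w p p₁ p₂ m α := by
  obtain ⟨p, hat⟩ := hR.exists_at α hα
  obtain ⟨x₁, x₂, y, hiff, hL⟩ := hat.fields
  have hlt : ∀ {x : ℕ} {u : List Bool}, At w x (encWord u) → x < w.length := by
    intro x u h
    have := lt_length_of_getElem? h.sep
    omega
  have hp := (at_cons.1 hL.kind).1
  have hy := hL.deg.length_le (encNumeral_ne_nil _)
  have hy' := List.length_pos_of_ne_nil (encNumeral_ne_nil α.deg)
  exact ⟨p, x₁, x₂, y, lt_length_of_getElem? hp, hlt hL.fst, hlt hL.snd, by omega,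
    ⟨⟨_, isTag_kindTag _⟩, hp⟩, (hiff _ _ _).2 ⟨rfl, rfl, rfl⟩, hL⟩

theorem Reads.at_of_numeralAt (hR : Reads N w A a) {m : ℕ} (h : QuerySetup.NumeralAt w m) :
    ∃ α ∈ A, At w m (encNumeral α.deg) := by
  obtain ⟨p, _, p₁, _, p₂, _, hp, hF⟩ := h
  obtain ⟨α, hα, hL⟩ := hR.locates hp hF
  exact ⟨α, hα, hL.deg⟩

theorem Reads.exists_numeralAt (hR : Reads N w A a) {α : Assertion NC NR NI (Numeral b)}
    (hα : α ∈ A) : ∃ m, m < w.length ∧ QuerySetup.NumeralAt w m ∧ At w m (encNumeral α.deg) := by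
  obtain ⟨p, p₁, p₂, m, h, h₁, h₂, hm, hp, hF, hL⟩ := hR.exists_locates hα
  exact ⟨m, hm, ⟨p, h, p₁, h₁, p₂, h₂, hp, hF⟩, hL.deg⟩

namespace QuerySetup

variable (S : QuerySetup N b T q)

/-- The non-zero digits of `d` lie within the bound for comparisons. -/
def Short (w : List (Letter b)) (d : Numeral b) : Prop :=
  ∀ i, w.length + S.K ≤ i → d.dig i = 0

theorem short_cst (j : Fin S.J) : S.Short w (S.cst j) := fun _ hi =>
  S.dig_cst_eq_zero j ((Nat.le_add_left _ _).trans hi)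

theorem short_of_at {m : ℕ} {d : Numeral b} (h : At w m (encNumeral d)) : S.Short w d := by
  intro i hi
  have := h.length_le (encNumeral_ne_nil d)
  exact d.dig_eq_zero (by omega)

theorem numLt_iff_val_lt {c d : Numeral b} (hd : S.Short w d) :
    NumLt S.K w c.dig d.dig ↔ c.val < d.val := by
  rw [numLt_iff hd, Numeral.val_lt_iff S.two_le]

/-- The formula for cuts is correct: assertions of the word that form a good pattern are the same
as assertions that entail the query. -/
theorem cut_iff (hR : Reads N w A a) (hT : T.Finite) {T' : Set (Inclusion NC NR)} (hT' : T' ⊆ T)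
    {d : Numeral b} (hd : S.Short w d) : S.Cut T' w d.dig ↔
      ChaseEntails T' (cutA (Ontology.ofData T hT A).abox (Set.Ici d.val)) q a := by
  constructor
  · rintro ⟨z, -, hz, p, -, p₁, -, p₂, -, m, -, hp, hgood⟩
    have ha : ∀ i, At w (z i) (encWord (N.ind (a i))) := by
      intro i
      obtain ⟨y, hy, hat⟩ := hR.ans i
      rw [(hy _).1 (hz i)]
      exact hat
    choose α hα hL using fun i => hR.locates (hp i).1 (hp i).2.1
    rw [wordPattern_eq hL ha, pattern_mem_goodPatterns] at hgood
    refine hgood.2.mono subset_rfl ?_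
    rintro _ ⟨i, rfl⟩
    refine ⟨⟨α i, hα i, rfl⟩, ?_⟩
    have := (hp i).2.2
    rw [(hL i).deg.wordDig_eq, S.numLt_iff_val_lt hd, not_lt] at this
    simpa using this
  · intro h
    rw [chaseEntails_iff_exists (fun α hα => S.lhs_mem α (hT' hα)) S.flip_mem S.basic_mem] at h
    obtain ⟨α, hα, hE⟩ := h
    have hex : ∀ i, ∃ β ∈ A, β.map Numeral.val = α i := fun i => (hα i).1.1
    choose β hβ hβα using hex
    obtain rfl : (fun i => (β i).map Numeral.val) = α := funext hβα
    choose p p₁ p₂ m h h₁ h₂ hm hp hF hL using fun i => hR.exists_locates (hβ i)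
    choose z hz ha using hR.ans
    refine ⟨z, fun i => ?_, fun i => (hz i _).2 rfl, p, h, p₁, h₁, p₂, h₂, m, hm,
      fun i => ⟨hp i, hF i, ?_⟩, ?_⟩
    · have := lt_length_of_getElem? (ha i).sep
      omega
    · rw [(hL i).deg.wordDig_eq, S.numLt_iff_val_lt hd, not_lt]
      simpa using (hα i).1.2
    · rw [wordPattern_eq hL ha, pattern_mem_goodPatterns]
      exact ⟨fun i => (hα i).2, hE⟩

variable {s : Sem} {hT : T.Finite}

theorem entails_iff (hR : Reads N w A a) (hO : (Ontology.ofData T hT A).Consistent s)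
    {d : Numeral b} (hd : S.Short w d) :
    S.Entails w d.dig ↔ (Ontology.ofData T hT A).EntailsDeg s q a d.val := by
  rw [entailsDeg_iff hO]
  refine or_congr ?_ ?_
  · rw [S.numLt_iff_val_lt hd, Numeral.val_zero, not_lt]
    exact ⟨fun h => le_antisymm h unitInterval.nonneg', fun h => h.le⟩
  · have hc : ∀ j, ¬ NumLt S.K w (S.cst j).dig d.dig ↔ d.val ≤ (S.cst j).val := fun j => by
      rw [S.numLt_iff_val_lt hd, not_lt]
    have hcut : {α ∈ T | ∃ j, (S.cst j).val = α.degree ∧ d.val ≤ (S.cst j).val} =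
        cutT T (Set.Ici d.val) := by
      ext α
      refine and_congr_right fun hα => ⟨fun ⟨j, hj, h⟩ => hj ▸ h, fun h => ?_⟩
      obtain ⟨j, hj⟩ := S.exists_cst α.degree (.inr (.inr ⟨α, hα, rfl⟩))
      exact ⟨j, hj, by rw [hj]; exact h⟩
    have key : (∃ f : Fin S.J → Prop, (∀ j, ¬ NumLt S.K w (S.cst j).dig d.dig ↔ f j) ∧
        S.Cut {α ∈ T | ∃ j, (S.cst j).val = α.degree ∧ f j} w d.dig) ↔
        S.Cut (cutT T (Set.Ici d.val)) w d.dig := by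
      rw [← hcut]
      constructor
      · rintro ⟨f, hf, h⟩
        obtain rfl : f = fun j => d.val ≤ (S.cst j).val :=
          funext fun j => propext ((hf j).symm.trans (hc j))
        exact h
      · exact fun h => ⟨_, hc, h⟩
    rw [key, S.cut_iff hR hT (fun _ h => h.1) hd]
    rfl

theorem isAns_iff (hR : Reads N w A a) (hO : (Ontology.ofData T hT A).Consistent s)
    {d : Numeral b} (hd : S.Short w d) :
    S.IsAns w d.dig ↔ (Ontology.ofData T hT A).IsAnsDegree s q a d.val := by
  constructor
  · rintro ⟨h1, h2, h3⟩
    refine (isAnsDegree_iff hO).2 ⟨(S.entails_iff hR hO hd).1 h1, ?_⟩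
    have hcst : ∀ x ∈ insert 0 (insert 1 (Inclusion.degree '' T)), d.val < x →
        ¬ (Ontology.ofData T hT A).EntailsDeg s q a x := by
      intro x hx hlt
      obtain ⟨j, rfl⟩ := S.exists_cst x hx
      rw [← S.entails_iff hR hO (S.short_cst j)]
      exact h2 j ((S.numLt_iff_val_lt (S.short_cst j)).2 hlt)
    rintro x (rfl | hx | ⟨β, ⟨α, hα, rfl⟩, rfl⟩) hlt
    · exact hcst _ (.inr (.inl rfl)) hlt
    · exact hcst _ (.inr (.inr hx)) hlt
    · rw [Assertion.deg_map] at hlt ⊢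
      obtain ⟨m, hm, hn, hat⟩ := hR.exists_numeralAt hα
      have hs := S.short_of_at hat
      rw [← S.entails_iff hR hO hs, ← hat.wordDig_eq]
      refine h3 m hm hn ?_
      rw [hat.wordDig_eq]
      exact (S.numLt_iff_val_lt hs).2 hlt
  · rintro ⟨h1, h2⟩
    refine ⟨(S.entails_iff hR hO hd).2 h1, fun j hlt => ?_, fun m _ hn hlt => ?_⟩
    · rw [S.entails_iff hR hO (S.short_cst j)]
      exact h2 _ ((S.numLt_iff_val_lt (S.short_cst j)).1 hlt)
    · obtain ⟨α, _, hat⟩ := hR.at_of_numeralAt hn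
      have hs := S.short_of_at hat
      rw [hat.wordDig_eq] at hlt ⊢
      rw [S.entails_iff hR hO hs]
      exact h2 _ ((S.numLt_iff_val_lt hs).1 hlt)

/-- The output formula describes a numeral for the degree of the answer. -/
theorem exists_output (hR : Reads N w A a) (hO : (Ontology.ofData T hT A).Consistent s) :
    ∃ d : Numeral b, (Ontology.ofData T hT A).IsAnsDegree s q a d.val ∧
      (encNumeral d).length ≤ w.length + S.K ∧
      ∀ i c, S.Output c w i ↔ (encNumeral d)[i]? = some c := by
  by_cases hj : ∃ j, S.IsAns w (S.cst j).dig
  · obtain ⟨j, hj, hmin⟩ := WellFounded.has_min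
      (wellFounded_lt (α := Fin S.J)) {j | S.IsAns w (S.cst j).dig} hj
    refine ⟨S.cst j, (S.isAns_iff hR hO (S.short_cst j)).1 hj,
      (S.length_cst j).trans (Nat.le_add_left _ _), fun i c => ⟨?_, ?_⟩⟩
    · rintro (⟨j', h1, h2, h3⟩ | ⟨h, -⟩)
      · obtain rfl : j' = j := by
          rcases lt_trichotomy j' j with h | h | h
          · exact absurd h (hmin j' h1)
          · exact h
          · exact absurd hj (h2 ⟨j, h⟩)
        exact h3
      · exact absurd hj (h j)
    · exact fun h => .inl ⟨j, hj, fun j' hj' => hmin j'.1 hj' j'.2, h⟩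
  · push Not at hj
    obtain ⟨x, hx, hans⟩ := exists_isAnsDegree hO q a
    have hcst : ∀ y ∈ insert 0 (insert 1 (Inclusion.degree '' T)), y ≠ x := by
      rintro y hy rfl
      obtain ⟨j, rfl⟩ := S.exists_cst y hy
      exact hj j ((S.isAns_iff hR hO (S.short_cst j)).2 hans)
    have hex : ∃ m, m < w.length ∧ NumeralAt w m ∧ S.IsAns w (wordDig w m) := by
      rcases hx with rfl | rfl | hx | ⟨β, ⟨α, hα, rfl⟩, rfl⟩
      · exact absurd rfl (hcst _ (.inl rfl))
      · exact absurd rfl (hcst _ (.inr (.inl rfl)))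
      · exact absurd rfl (hcst _ (.inr (.inr hx)))
      · obtain ⟨m, hm, hn, hat⟩ := hR.exists_numeralAt hα
        refine ⟨m, hm, hn, ?_⟩
        rw [hat.wordDig_eq, S.isAns_iff hR hO (S.short_of_at hat)]
        simpa using hans
    obtain ⟨m, ⟨hm, hn, hI⟩, hmin⟩ := WellFounded.has_min (wellFounded_lt (α := ℕ))
      {m | m < w.length ∧ NumeralAt w m ∧ S.IsAns w (wordDig w m)} hex
    obtain ⟨α, _, hat⟩ := hR.at_of_numeralAt hn
    have hlen := hat.length_le (encNumeral_ne_nil _)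
    refine ⟨α.deg, ?_, by omega, fun i c => ⟨?_, ?_⟩⟩
    · rwa [hat.wordDig_eq, S.isAns_iff hR hO (S.short_of_at hat)] at hI
    · rintro (⟨j, h, -⟩ | ⟨-, m', hm', ⟨hn', hI'⟩, hmin', hl⟩)
      · exact absurd h (hj j)
      · obtain rfl : m' = m := by
          rcases lt_trichotomy m' m with h | h | h
          · exact absurd h (hmin m' ⟨hm', hn', hI'⟩)
          · exact h
          · exact absurd ⟨hn, hI⟩ (hmin' m hm h)
        exact hat.numeralLetter_iff.1 hl
    · exact fun h => .inr ⟨hj, m, hm, ⟨hn, hI⟩,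
        fun m' hm' hlt hm'' => hmin m' ⟨hm', hm''⟩ hlt, hat.numeralLetter_iff.2 h⟩

/-- Properties of the degree that follows the tag of degrees are decided by uniform AC⁰
families. -/
theorem exists_isAC0_degree {P : List (Letter b) → (ℕ → ℕ) → Prop}
    (hP : FO fun w (v : Fin 2 → ℕ) => P w (wordDig w (v 0 + 1))) :
    ∃ C : CircuitFamily (Letter b) Bool, C.IsAC0 ∧
      ∀ (A : List (Assertion NC NR NI (Numeral b))) (a : Fin k → NI) (d : Numeral b),
        C.Answers (encInputDeg N A a d) (P (encInputDeg N A a d) d.dig) := by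
  obtain ⟨C, hC, h⟩ := exists_isAC0_answers (S := Letter b)
    (FO.ex 0 (P := fun w (_ : Fin 1 → ℕ) y => w[y]? = some .degTag ∧ P w (wordDig w (y + 1)))
      (.and (.getElem? (.var 0) _) hP))
  refine ⟨C, hC, fun A a d => ?_⟩
  have hiff : (∃ y, y < (encInputDeg N A a d).length + 0 ∧
      ((encInputDeg N A a d)[y]? = some .degTag ∧
        P (encInputDeg N A a d) (wordDig (encInputDeg N A a d) (y + 1)))) ↔
      P (encInputDeg N A a d) d.dig := by
    simp only [degTag_iff]
    have hat := at_numeral_encInputDeg N A a d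
    constructor
    · rintro ⟨_, _, rfl, h⟩
      rwa [hat.wordDig_eq] at h
    · intro h
      refine ⟨_, ?_, rfl, by rwa [hat.wordDig_eq]⟩
      exact lt_length_of_getElem? ((degTag_iff N A a d _).2 rfl)
  rw [← hiff]
  exact h _

end QuerySetup

end Correctness

end FuzzyDL

open FuzzyDL

theorem mainTheorem4 (NC NR NI : Type) :
    -- Degree queries and threshold queries, over a consistent ontology.
    (∀ O : Ontology NC NR NI, O.Consistent Sem.all →
      ∀ (k : ℕ) (q : CQ NC NR NI k) (a : Fin k → NI) (d : Degree),
        (O.EntailsDeg Sem.witnessed q a d ↔ O.EntailsTQ Sem.witnessed (q.toTQ d) a) ∧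
        (O.EntailsDeg Sem.all q a d ↔ O.EntailsDeg Sem.witnessed q a d) ∧
        (O.EntailsDeg Sem.all q a d ↔
          ∀ d' : Degree, d' < d → O.EntailsTQ Sem.all (q.toTQ d') a)) ∧
    -- Data complexity: the TBox and the query are fixed; the ABox, the candidate tuple and, in the
    -- decision problems, the degree are the input.
    (∀ (b : ℕ), 2 ≤ b → ∀ (N : Naming NC NR NI)
      (T : Set (Inclusion NC NR)) (hT : T.Finite),
      (∀ α ∈ T, ∃ c : Numeral b, c.val = α.degree) →
      ∀ (k : ℕ) (q : CQ NC NR NI k),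
        (∃ C : CircuitFamily (Letter b) Bool, C.IsAC0 ∧
          ∀ (s : Sem) (A : List (Assertion NC NR NI (Numeral b))),
            (Ontology.ofData T hT A).Consistent s →
            ∀ (a : Fin k → NI) (d : Numeral b),
              C.Answers (encInputDeg N A a d)
                ((Ontology.ofData T hT A).EntailsDeg s q a d.val)) ∧
        (∃ C : CircuitFamily (Letter b) Bool, C.IsAC0 ∧
          ∀ (s : Sem) (A : List (Assertion NC NR NI (Numeral b))),
            (Ontology.ofData T hT A).Consistent s →
            ∀ (a : Fin k → NI) (d : Numeral b),
              C.Answers (encInputDeg N A a d)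
                ((Ontology.ofData T hT A).IsAnsDegree s q a d.val)) ∧
        (∃ C : CircuitFamily (Letter b) (Letter b), C.IsAC0 ∧
          ∀ (s : Sem) (A : List (Assertion NC NR NI (Numeral b))),
            (Ontology.ofData T hT A).Consistent s →
            ∀ a : Fin k → NI, ∃ d : Numeral b,
              (Ontology.ofData T hT A).IsAnsDegree s q a d.val ∧
              C.Outputs (encInput N A a) (encNumeral d))) := by
  refine ⟨fun O hO k q a d => ⟨entailsDeg_witnessed_iff_entailsTQ hO q a d,
    entailsDeg_all_iff_witnessed hO q a d, entailsDeg_all_iff_forall_entailsTQ O q a d⟩, ?_⟩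
  intro b hb N T hT hdeg k q
  obtain ⟨S⟩ := exists_querySetup N hb hT hdeg q
  have hshort : ∀ (A : List (Assertion NC NR NI (Numeral b))) (a : Fin k → NI) (d : Numeral b),
      S.Short (encInputDeg N A a d) d := fun A a d =>
    S.short_of_at (at_numeral_encInputDeg N A a d)
  have hword : FODigits fun (w : List (Letter b)) (v : Fin 2 → ℕ) => wordDig w (v 0 + 1) :=
    foDigits_wordDig ((Term.var 0).add (.const 1))
  refine ⟨?_, ?_, ?_⟩
  · obtain ⟨C, hC, h⟩ := QuerySetup.exists_isAC0_degree (N := N) (k := k)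
      (S.fo_entails hword fun w _ => wordDig_lt hb w _)
    refine ⟨C, hC, fun s A hO a d => ?_⟩
    rw [← S.entails_iff (reads_encInputDeg N A a d) hO (hshort A a d)]
    exact h A a d
  · obtain ⟨C, hC, h⟩ := QuerySetup.exists_isAC0_degree (N := N) (k := k)
      (S.fo_isAns hword fun w _ => wordDig_lt hb w _)
    refine ⟨C, hC, fun s A hO a d => ?_⟩
    rw [← S.isAns_iff (reads_encInputDeg N A a d) hO (hshort A a d)]
    exact h A a d
  · obtain ⟨C, hC, h⟩ := exists_isAC0_outputs (G := Letter b) (Polynomial.X + Polynomial.C S.K)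
      fun c => S.fo_output c (.var (0 : Fin 1))
    refine ⟨C, hC, fun s A hO a => ?_⟩
    obtain ⟨d, hd, hlen, hout⟩ := S.exists_output (reads_encInput N A a) hO
    exact ⟨d, hd, h _ _ (by simpa using hlen) fun i _ c => hout i c⟩
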